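/- **Setting.** Node names come from an infinite linearly ordered set. A graph stream $S=(S_1,\dots,S_T)$ is a sequence of finite sets of nodes and edges (possibly empty), where every node and edge arrives at most once, there are no loops, and an edge arrives no earlier than its endpoints; $S_{[t]}$ is the prefix $S_1,\dots,S_t$, identified, when we speak of degrees, with the graph formed by everything that has arrived through time $t$. A graph is $(D,\ell)$-bounded if at most $\ell$ of its nodes have degree greater than $D$. Two graphs or streams are node neighbors if one results from the other by removing a node and all its adjacent edges; two streams are edge neighbors if one results from the other by removing one edge, or an isolated node, or a node of degree $1$ together with its edge. Random variables $X,X'$ are $(\varepsilon,\delta)$-indistinguishable if $\Pr[X\in Y]\le e^{\varepsilon}\Pr[X'\in Y]+\delta$ and $\Pr[X'\in Y]\le e^{\varepsilon}\Pr[X\in Y]+\delta$ for all events $Y$. An algorithm is $(\varepsilon,\delta)$-node-DP (edge-DP) under continual observation if its entire output streams on any two node-neighboring (edge-neighboring) input streams of length $T$ are $(\varepsilon,\delta)$-indistinguishable; it is $D$-restricted node-DP (edge-DP) if this holds for neighboring streams of maximum degree at most $D$. **Algorithm.** Let $\varepsilon_{\mathsf{Test}}>0$, $\beta_{\mathsf{Test}},\beta\in(0,1]$,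 $D\ge 0$, $T\ge 1$ (with $D,T$ integers), and put $$\tau=-\frac{8\ln(1/\beta_{\mathsf{Test}})}{\varepsilon_{\mathsf{Test}}},\qquad \ell=\Big\lceil \frac{8\ln\big(T/(\beta\beta_{\mathsf{Test}})\big)}{\varepsilon_{\mathsf{Test}}}\Big\rceil,\qquad D'=D+\ell .$$ Let $\mathcal A$ be a randomized streaming algorithm. The projection $\Pi_{D'}$ handles the edges in order of arrival, and lexicographically by their endpoints within a time step; it passes on all nodes, and an edge $\{u,v\}$ exactly if fewer than $D'$ of the edges handled before are adjacent to $u$ and fewer than $D'$ are adjacent to $v$ (edges not passed on count as well). Let $q_t$ be minus the minimum node distance (length of a shortest chain of node-neighboring graphs) between $S_{[t]}$ and a graph with at least $\ell$ nodes of degree greater than $D'$. The algorithm $\mathsf{BB}$ draws independent $Z\sim\mathrm{Lap}(2/\varepsilon_{\mathsf{Test}})$ and $Z_1,\dots,Z_T\sim\mathrm{Lap}(4/\varepsilon_{\mathsf{Test}})$, independent of the coins of $\mathcal A$. At time $t$ it outputs the answer of $\mathcal A$, run on $\Pi_{D'}(S)$, at time $t$, if $q_s+Z_s<\tau+Z$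 for all $s\le t$; otherwise it outputs $\bot$. **Theorem.** The constants in $O(\cdot)$ and $\Theta(\cdot)$ below are absolute, and $\varepsilon',\delta'\ge 0$. 1. *(Node privacy from restricted edge privacy.)* If $\mathcal A$ is $D'$-restricted $(\varepsilon',\delta')$-edge-DP under continual observation for streams of length $T$, then $\mathsf{BB}$ is $(\varepsilon,\delta)$-node-DP under continual observation for all streams of length $T$, with $$\varepsilon=\varepsilon_{\mathsf{Test}}+\varepsilon'(D'+\ell),\qquad \delta=(1+e^{\varepsilon_{\mathsf{Test}}})e^{\varepsilon}\beta_{\mathsf{Test}}+\delta' e^{\varepsilon'(D'+\ell)}(D'+\ell),$$ and $\delta=O(\beta_{\mathsf{Test}}+\delta'(D+\ell))$ when $\varepsilon\le 1$. In particular, for given $0<\varepsilon\le 1$, $0<\delta\le 1$ and $T\ge 2$, to reach $(\varepsilon,\delta)$-node-DP it suffices to set $\varepsilon_{\mathsf{Test}}=\varepsilon/2$, $\beta_{\mathsf{Test}}=\delta/30$ and suitable (namely, those for which the two displayed equations hold) $\varepsilon'=\Theta(\varepsilon/B)$ and $\delta'=\Theta(\delta/B)$, where $B=D+\frac{\log(T/(\beta\delta))}{\varepsilon}$.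 2. *(Node privacy from restricted node privacy.)* If $\mathcal A$ is $D'$-restricted $(\varepsilon',\delta')$-node-DP under continual observation for streams of length $T$, then $\mathsf{BB}$ is $(\varepsilon,\delta)$-node-DP under continual observation for all streams of length $T$, with $$\varepsilon=\varepsilon_{\mathsf{Test}}+\varepsilon'(2\ell+1),\qquad \delta=(1+e^{\varepsilon_{\mathsf{Test}}})e^{\varepsilon}\beta_{\mathsf{Test}}+\delta' e^{\varepsilon'(2\ell+1)}(2\ell+1),$$ and $\delta=O(\beta_{\mathsf{Test}}+\delta'\ell)$ when $\varepsilon\le 1$ and $\delta'\le 1$. In particular, for given $0<\varepsilon\le 1$, $0<\delta\le 1$ and $T\ge 2$, to reach $(\varepsilon,\delta)$-node-DP it suffices to set $\varepsilon_{\mathsf{Test}}=\varepsilon/2$, $\beta_{\mathsf{Test}}=\delta/30$ and suitable (namely, those for which the two displayed equations hold) $\varepsilon'=\Theta(\varepsilon/B)$ and $\delta'=\Theta(\delta/B)$, where $B=\frac{\log(T/(\beta\delta))}{\varepsilon}$. 3. *(Accuracy.)* If $S_{[t']}$ is $(D,0)$-bounded, then with probability at least $1-\beta$ the outputs of $\mathcal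 A$ (run on $\Pi_{D'}(S)$) are released at all time steps $t\le t'$. 4. *(Time and space.)* $\mathsf{BB}$ can be implemented by one fixed program, for all parameters and all $\mathcal A$, on a random access machine with unit-cost hash tables, real registers and Laplace samples, which receives $D',\ell,\varepsilon_{\mathsf{Test}},\tau$ as parameters, receives the arriving nodes and edges in the above order, and calls $\mathcal A$ as a black box, so that for all $t\in[T]$ its total time through time step $t$ is at most $R_{[t]}+O(n_{[t]}+m_{[t]}+t)$ and its total space is at most $S^{\mathcal A}_{[t]}+O(n_{[t]}+1)$. Here $R_{[t]}$ and $S^{\mathcal A}_{[t]}$ are the time and space that $\mathcal A$, with the same coins, uses through time step $t$ on $\Pi_{D'}(S)$, and $n_{[t]}$, $m_{[t]}$ are the numbers of nodes and edges of $S_{[t]}$. -/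

import Mathlib

open MeasureTheory

universe u v w

/-! ## Finite graphs with node names in `V` -/

/-- A finite simple graph whose nodes are drawn from the set `V` of possible node names. -/
@[ext] structure FinGraph (V : Type u) where
  verts : Finset V
  edges : Finset (Sym2 V)
  no_loops : ∀ e ∈ edges, ¬ e.IsDiag
  endpoints : ∀ e ∈ edges, ∀ x ∈ e, x ∈ verts

namespace FinGraph

/-- Degree of the node `x`. -/
def degree {V : Type u} [DecidableEq V] (G : FinGraph V) (x : V) : ℕ :=
  (G.edges.filter (fun e => x ∈ e)).card

/-- Remove the node `x` and all edges adjacent to it. -/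
def removeNode {V : Type u} [DecidableEq V] (G : FinGraph V) (x : V) : FinGraph V where
  verts := G.verts.erase x
  edges := G.edges.filter (fun e => x ∉ e)
  no_loops := fun e he => G.no_loops e (Finset.mem_filter.1 he).1
  endpoints := fun e he y hy => Finset.mem_erase.2
    ⟨fun h => (Finset.mem_filter.1 he).2 (h ▸ hy), G.endpoints e (Finset.mem_filter.1 he).1 y hy⟩

/-- The nodes of degree greater than `D`. -/
def highDegree {V : Type u} [DecidableEq V] (G : FinGraph V) (D : ℕ) : Finset V :=
  G.verts.filter (fun x => D < G.degree x)

/-- `(D, ℓ)`-bounded: at most `ℓ` nodes have degree greater than `D`. -/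
def Bounded {V : Type u} [DecidableEq V] (G : FinGraph V) (D ℓ : ℕ) : Prop :=
  (G.highDegree D).card ≤ ℓ

/-- The graph whose points are the finite graphs on names in `V`, two of them being joined when
they are node neighbors: one results from the other by removing a node and its adjacent edges. -/
def nodeNeighborGraph (V : Type u) [DecidableEq V] : SimpleGraph (FinGraph V) :=
  SimpleGraph.fromRel (fun G G' => ∃ x ∈ G.verts, G' = G.removeNode x)

/-- Node distance: the length of a shortest chain of node-neighboring graphs. -/
noncomputable def nodeDist {V : Type u} [DecidableEq V] (G G' : FinGraph V) : ℕ :=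
  (nodeNeighborGraph V).dist G G'

/-- The minimum node distance from `G` to a graph with at least `ℓ` nodes of degree greater
than `D`. -/
noncomputable def distToGraph {V : Type u} [DecidableEq V] (D ℓ : ℕ) (G : FinGraph V) : ℕ :=
  sInf {d | ∃ H : FinGraph V, ℓ ≤ (H.highDegree D).card ∧ nodeDist G H = d}

end FinGraph

/-! ## Graph streams -/

/-- What arrives in one time step: a set of nodes and a set of edges (both empty if nothing
arrives). -/
abbrev Arrival (V : Type u) : Type u := Finset V × Finset (Sym2 V)

/-- A graph stream of length `T`. Every node and every edge arrives at most once, and the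
endpoints of an edge arrive no later than the edge. Time steps are `0, …, T - 1`. -/
@[ext] structure GraphStream (V : Type u) (T : ℕ) where
  nodes : Fin T → Finset V
  edges : Fin T → Finset (Sym2 V)
  nodes_once : ∀ s t, s ≠ t → Disjoint (nodes s) (nodes t)
  edges_once : ∀ s t, s ≠ t → Disjoint (edges s) (edges t)
  no_loops : ∀ t, ∀ e ∈ edges t, ¬ e.IsDiag
  endpoints : ∀ t, ∀ e ∈ edges t, ∀ x ∈ e, ∃ s ≤ t, x ∈ nodes s

namespace GraphStream

/-- The stream as the list of its arrivals. -/
def toList {V : Type u} {T : ℕ} (S : GraphStream V T) : List (Arrival V) :=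
  List.ofFn (fun t => (S.nodes t, S.edges t))

/-- The flattened graph of the first `k` terms. -/
def flat {V : Type u} [DecidableEq V] {T : ℕ} (S : GraphStream V T) (k : ℕ) : FinGraph V where
  verts := (Finset.univ.filter (fun t : Fin T => (t : ℕ) < k)).biUnion S.nodes
  edges := (Finset.univ.filter (fun t : Fin T => (t : ℕ) < k)).biUnion S.edges
  no_loops := by
    intro e he
    obtain ⟨t, -, h⟩ := Finset.mem_biUnion.1 he
    exact S.no_loops t e h
  endpoints := by
    intro e he x hx
    obtain ⟨t, ht, h⟩ := Finset.mem_biUnion.1 he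
    obtain ⟨s, hs, h'⟩ := S.endpoints t e h x hx
    refine Finset.mem_biUnion.2 ⟨s, Finset.mem_filter.2 ⟨Finset.mem_univ s, ?_⟩, h'⟩
    exact lt_of_le_of_lt hs (Finset.mem_filter.1 ht).2

/-- Remove the node `x` and all its adjacent edges, from all time steps. -/
def removeNode {V : Type u} [DecidableEq V] {T : ℕ} (S : GraphStream V T) (x : V) :
    GraphStream V T where
  nodes := fun t => (S.nodes t).erase x
  edges := fun t => (S.edges t).filter (fun e => x ∉ e)
  nodes_once := fun s t h =>
    (S.nodes_once s t h).mono (Finset.erase_subset _ _) (Finset.erase_subset _ _)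
  edges_once := fun s t h =>
    (S.edges_once s t h).mono (Finset.filter_subset _ _) (Finset.filter_subset _ _)
  no_loops := fun t e he => S.no_loops t e (Finset.mem_filter.1 he).1
  endpoints := by
    intro t e he y hy
    obtain ⟨s, hs, h⟩ := S.endpoints t e (Finset.mem_filter.1 he).1 y hy
    exact ⟨s, hs, Finset.mem_erase.2 ⟨fun h => (Finset.mem_filter.1 he).2 (h ▸ hy), h⟩⟩

/-- Remove the edge `e`. -/
def removeEdge {V : Type u} [DecidableEq V] {T : ℕ} (S : GraphStream V T) (e : Sym2 V) :
    GraphStream V T where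
  nodes := S.nodes
  edges := fun t => (S.edges t).erase e
  nodes_once := S.nodes_once
  edges_once := fun s t h =>
    (S.edges_once s t h).mono (Finset.erase_subset _ _) (Finset.erase_subset _ _)
  no_loops := fun t f hf => S.no_loops t f (Finset.mem_of_mem_erase hf)
  endpoints := fun t f hf => S.endpoints t f (Finset.mem_of_mem_erase hf)

/-- `S'` results from `S` by removing a node and all its adjacent edges. -/
def NodeReduct {V : Type u} [DecidableEq V] {T : ℕ} (S S' : GraphStream V T) : Prop :=
  ∃ x ∈ (S.flat T).verts, S' = S.removeNode x

/-- `S'` results from `S` by removing one edge, an isolated node, or a node of degree one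
together with its adjacent edge. -/
def EdgeReduct {V : Type u} [DecidableEq V] {T : ℕ} (S S' : GraphStream V T) : Prop :=
  (∃ e ∈ (S.flat T).edges, S' = S.removeEdge e) ∨
  (∃ x ∈ (S.flat T).verts, (S.flat T).degree x = 0 ∧ S' = S.removeNode x) ∨
  (∃ x ∈ (S.flat T).verts, (S.flat T).degree x = 1 ∧ S' = S.removeNode x)

/-- Node-neighboring graph streams. -/
def NodeNeighbor {V : Type u} [DecidableEq V] {T : ℕ} (S S' : GraphStream V T) : Prop :=
  NodeReduct S S' ∨ NodeReduct S' S

/-- Edge-neighboring graph streams. -/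
def EdgeNeighbor {V : Type u} [DecidableEq V] {T : ℕ} (S S' : GraphStream V T) : Prop :=
  EdgeReduct S S' ∨ EdgeReduct S' S

/-- The stream has maximum degree at most `D`. -/
def MaxDegreeLE {V : Type u} [DecidableEq V] {T : ℕ} (S : GraphStream V T) (D : ℕ) : Prop :=
  ∀ x ∈ (S.flat T).verts, (S.flat T).degree x ≤ D

end GraphStream

/-! ## Differential privacy -/

/-- `(ε, δ)`-indistinguishability of two random variables `X`, `X'` on the probability
space `(Ω, P)`. -/
def Indist {Ω : Type v} {Z : Type w} [MeasurableSpace Ω] [MeasurableSpace Z] (P : Measure Ω)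
    (ε δ : ℝ) (X X' : Ω → Z) : Prop :=
  ∀ B : Set Z, MeasurableSet B →
    P (X ⁻¹' B) ≤ ENNReal.ofReal (Real.exp ε) * P (X' ⁻¹' B) + ENNReal.ofReal δ ∧
    P (X' ⁻¹' B) ≤ ENNReal.ofReal (Real.exp ε) * P (X ⁻¹' B) + ENNReal.ofReal δ

/-- `(ε, δ)`-node-DP of the randomized algorithm that maps the stream `S` to the random
variable `M S`. (Under continual observation, `M S` is the entire output stream.) -/
def NodeDP {V : Type u} [DecidableEq V] {T : ℕ} {Ω : Type v} {Z : Type w} [MeasurableSpace Ω]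
    [MeasurableSpace Z] (P : Measure Ω) (M : GraphStream V T → Ω → Z) (ε δ : ℝ) : Prop :=
  ∀ S S' : GraphStream V T, S.NodeNeighbor S' → Indist P ε δ (M S) (M S')

/-- `D`-restricted `(ε, δ)`-node-DP. -/
def RestrictedNodeDP {V : Type u} [DecidableEq V] {T : ℕ} {Ω : Type v} {Z : Type w}
    [MeasurableSpace Ω] [MeasurableSpace Z] (D : ℕ) (P : Measure Ω)
    (M : GraphStream V T → Ω → Z) (ε δ : ℝ) : Prop :=
  ∀ S S' : GraphStream V T, S.MaxDegreeLE D → S'.MaxDegreeLE D → S.NodeNeighbor S' →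
    Indist P ε δ (M S) (M S')

/-- `D`-restricted `(ε, δ)`-edge-DP. -/
def RestrictedEdgeDP {V : Type u} [DecidableEq V] {T : ℕ} {Ω : Type v} {Z : Type w}
    [MeasurableSpace Ω] [MeasurableSpace Z] (D : ℕ) (P : Measure Ω)
    (M : GraphStream V T → Ω → Z) (ε δ : ℝ) : Prop :=
  ∀ S S' : GraphStream V T, S.MaxDegreeLE D → S'.MaxDegreeLE D → S.EdgeNeighbor S' →
    Indist P ε δ (M S) (M S')

/-! ## Randomized streaming algorithms -/

/-- An arbitrary randomized streaming algorithm on graph streams, with outputs in `Y`. Its coins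
`ω : Coins` have law `coinLaw`; with coins `ω`, the answer that it gives after having received
`x₁, …, x_t` is `out ω [x₁, …, x_t]`. While it handles the last element of `[x₁, …, x_t]`
it takes `stepTime ω [x₁, …, x_t]` steps and uses at most `stepSpace ω [x₁, …, x_t]` cells; these
two functions are arbitrary, so that they can be the costs of any implementation. -/
structure StreamAlg (V : Type u) (Y : Type v) [MeasurableSpace Y] where
  Coins : Type w
  instMeas : MeasurableSpace Coins
  coinLaw : Measure Coins
  isProb : IsProbabilityMeasure coinLaw
  out : Coins → List (Arrival V) → Y
  measurable_out : ∀ xs, Measurable (fun ω => out ω xs)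
  stepTime : Coins → List (Arrival V) → ℕ
  stepSpace : Coins → List (Arrival V) → ℕ

attribute [instance] StreamAlg.instMeas StreamAlg.isProb

namespace StreamAlg

/-- The output stream of the algorithm on a list of arrivals. -/
def outputOn {V : Type u} {Y : Type v} [MeasurableSpace Y] (A : StreamAlg.{u, v, w} V Y)
    (T : ℕ) (xs : List (Arrival V)) (ω : A.Coins) : Fin T → Y :=
  fun t => A.out ω (xs.take (t + 1))

/-- The output stream of the algorithm on a graph stream. -/
def output {V : Type u} {Y : Type v} [MeasurableSpace Y] (A : StreamAlg.{u, v, w} V Y)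
    {T : ℕ} (S : GraphStream V T) (ω : A.Coins) : Fin T → Y :=
  A.outputOn T S.toList ω

/-- Total running time on the time steps in `xs`. -/
def runtime {V : Type u} {Y : Type v} [MeasurableSpace Y] (A : StreamAlg.{u, v, w} V Y)
    (ω : A.Coins) (xs : List (Arrival V)) : ℕ :=
  ∑ i ∈ Finset.range xs.length, A.stepTime ω (xs.take (i + 1))

/-- Space used (the peak) over the time steps in `xs`. -/
def space {V : Type u} {Y : Type v} [MeasurableSpace Y] (A : StreamAlg.{u, v, w} V Y)
    (ω : A.Coins) (xs : List (Arrival V)) : ℕ :=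
  (Finset.range xs.length).sup (fun i => A.stepSpace ω (xs.take (i + 1)))

end StreamAlg

/-! ## The time-aware projection with the original-degree criterion -/

/-- The edges in the consistent order: each edge is written `(a, b)` with `a < b`, and the pairs
are ordered lexicographically. -/
def orderedEdges {V : Type u} [LinearOrder V] (E : Finset (Sym2 V)) : List (V × V) :=
  ((E.image (fun e => toLex (e.inf, e.sup))).sort).map ofLex

/-- One pass of the edge loop: keep the edge if both counters are less than `D`; increment
both counters in either case. -/
def projEdge {V : Type u} [DecidableEq V] (D : ℕ) (st : (V → ℕ) × Finset (Sym2 V))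
    (p : V × V) : (V → ℕ) × Finset (Sym2 V) :=
  (fun x => st.1 x + (if x = p.1 ∨ x = p.2 then 1 else 0),
    if st.1 p.1 < D ∧ st.1 p.2 < D then insert s(p.1, p.2) st.2 else st.2)

/-- One time step, from the counters `d`: the new counters and the projected edges. -/
def projArrival {V : Type u} [LinearOrder V] (D : ℕ) (d : V → ℕ) (x : Arrival V) :
    (V → ℕ) × Finset (Sym2 V) :=
  (orderedEdges x.2).foldl (projEdge D) (fun y => if y ∈ x.1 then 0 else d y, ∅)

/-- The projection from the counters `d`. -/
def projFrom {V : Type u} [LinearOrder V] (D : ℕ) : (V → ℕ) → List (Arrival V) → List (Arrival V)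
  | _, [] => []
  | d, x :: xs => (x.1, (projArrival D d x).2) :: projFrom D (projArrival D d x).1 xs

/-- The projection of a stream to maximum degree at most `D`. -/
def proj {V : Type u} [LinearOrder V] (D : ℕ) (xs : List (Arrival V)) : List (Arrival V) :=
  projFrom D (fun _ => 0) xs

/-! ## Sparse vector, propose-test-release, and the black-box transformation -/

/-- The Laplace distribution with scale `b`. -/
noncomputable def laplace (b : ℝ) : Measure ℝ :=
  volume.withDensity (fun x => ENNReal.ofReal (1 / (2 * b) * Real.exp (-|x| / b)))

/-- Scale `1 / ε₁` of the threshold noise, where `ε₁ = ε / 2`. -/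
noncomputable def svtThresholdScale (ε : ℝ) : ℝ := 1 / (ε / 2)

/-- Scale `2 c / ε₂` of the query noise, where `ε₂ = ε / 2`. -/
noncomputable def svtQueryScale (c : ℕ) (ε : ℝ) : ℝ := 2 * c / (ε / 2)

/-- The noise of sparse vector: independent `Z` and `Z_t`. -/
noncomputable def svtNoise (c : ℕ) (ε : ℝ) (T : ℕ) : Measure (ℝ × (Fin T → ℝ)) :=
  (laplace (svtThresholdScale ε)).prod (Measure.pi (fun _ => laplace (svtQueryScale c ε)))

open Classical in
/-- The counter of sparse vector before time step `t`, for cutoff `c`, threshold `τ`, query values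
`q` and noise `z = (Z, Z_·)`. -/
noncomputable def svtCount {T : ℕ} (c : ℕ) (τ : ℝ) (q : Fin T → ℝ) (z : ℝ × (Fin T → ℝ)) : ℕ → ℕ
  | 0 => 0
  | t + 1 =>
    if (∃ h : t < T, q ⟨t, h⟩ + z.2 ⟨t, h⟩ ≥ τ + z.1) ∧ svtCount c τ q z t < c then
      svtCount c τ q z t + 1
    else svtCount c τ q z t

open Classical in
/-- The answers of sparse vector; `false` stands for `⊥` and `true` for `⊤`. -/
noncomputable def svt {T : ℕ} (c : ℕ) (τ : ℝ) (q : Fin T → ℝ) (z : ℝ × (Fin T → ℝ))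
    (t : Fin T) : Bool :=
  if q t + z.2 t ≥ τ + z.1 ∧ svtCount c τ q z t < c then false else true

/-- Propose-test-release: at each time step, the verdict of the test, and the output of the base
algorithm as long as the test has not failed, `⊥` (that is, `Sum.inr ()`) afterwards. -/
def ptr {T : ℕ} {Y : Type v} (test : Fin T → Bool) (base : Fin T → Y) (t : Fin T) :
    Bool × (Y ⊕ Unit) :=
  (test t, if ∀ s ≤ t, test s = true then Sum.inl (base t) else Sum.inr ())

/-- The slack `ℓ`. -/
noncomputable def bbSlack (εTest βTest β : ℝ) (T : ℕ) : ℕ :=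
  ⌈8 * Real.log (T / (β * βTest)) / εTest⌉₊

/-- The degree bound `D' = D + ℓ`. -/
noncomputable def bbDegree (εTest βTest β : ℝ) (D T : ℕ) : ℕ := D + bbSlack εTest βTest β T

/-- The threshold `τ`. -/
noncomputable def bbThreshold (εTest βTest : ℝ) : ℝ := -8 * Real.log (1 / βTest) / εTest

/-- The output of the base algorithm on the projected stream. -/
noncomputable def bbBase {V : Type u} [LinearOrder V] {Y : Type v} [MeasurableSpace Y]
    (A : StreamAlg.{u, v, w} V Y) (εTest βTest β : ℝ) (D : ℕ) {T : ℕ} (S : GraphStream V T)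
    (ω : A.Coins) : Fin T → Y :=
  A.outputOn T (proj (bbDegree εTest βTest β D T) S.toList) ω

/-- The verdicts of the test: sparse vector with cutoff `1` on the negated distances. -/
noncomputable def bbTest {V : Type u} [LinearOrder V] (εTest βTest β : ℝ) (D : ℕ) {T : ℕ}
    (S : GraphStream V T) (z : ℝ × (Fin T → ℝ)) : Fin T → Bool :=
  svt 1 (bbThreshold εTest βTest)
    (fun t => -((S.flat (t + 1)).distToGraph (bbDegree εTest βTest β D T)
      (bbSlack εTest βTest β T) : ℝ)) z

/-- The output stream of the black-box transformation, with coins `p.1` of the base algorithm and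
noise `p.2` of sparse vector. -/
noncomputable def bbOutput {V : Type u} [LinearOrder V] {Y : Type v} [MeasurableSpace Y]
    (A : StreamAlg.{u, v, w} V Y) (εTest βTest β : ℝ) (D : ℕ) {T : ℕ} (S : GraphStream V T)
    (p : A.Coins × (ℝ × (Fin T → ℝ))) : Fin T → Y ⊕ Unit :=
  fun t => (ptr (bbTest εTest βTest β D S p.2) (bbBase A εTest βTest β D S p.1) t).2

/-- The law of all the randomness of the black-box transformation. -/
noncomputable def bbLaw {V : Type u} {Y : Type v} [MeasurableSpace Y]
    (A : StreamAlg.{u, v, w} V Y) (εTest : ℝ) (T : ℕ) : Measure (A.Coins × (ℝ × (Fin T → ℝ))) :=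
  A.coinLaw.prod (svtNoise 1 εTest T)

/-! ## A streaming random access machine

The machine has registers for natural numbers and for reals, and hash tables with natural-number
entries, keyed by natural numbers or by node names; entries that were never written are `0`. Every
instruction, every evaluation of a test and the reading of every input item takes one step. The
space is the number of cells (registers and table entries) ever written. The machine can
draw Laplace noise, and it holds a base algorithm as a black box, which it can hand nodes and edges
and ask to carry out its next time step, whose costs are added to those of the machine. -/

namespace StreamRAM

/-- Memory cells. -/
inductive Cell (V : Type u) : Type u
  | ireg (i : ℕ)
  | rreg (i : ℕ)
  | itab (tab key : ℕ)
  | ntab (tab : ℕ) (key : V)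

/-- Instructions; `snd` selects one of the two nodes of the current input item. -/
inductive Instr : Type
  | iconst (dst n : ℕ)
  | iadd (dst a b : ℕ)
  | isub (dst a b : ℕ)
  | iload (dst tab key : ℕ)
  | istore (tab key src : ℕ)
  | nload (dst tab : ℕ) (snd : Bool)
  | nstore (tab : ℕ) (snd : Bool) (src : ℕ)
  | rofint (dst a : ℕ)
  | radd (dst a b : ℕ)
  | rsub (dst a b : ℕ)
  | rdiv (dst a b : ℕ)
  | draw (dst scale : ℕ)
  | sendNode
  | sendEdge
  | emitBase
  | emitBot

/-- Tests. -/
inductive Test : Type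
  | ile (a b : ℕ)
  | rle (a b : ℕ)

/-- Structured code. -/
inductive Code : Type
  | skip
  | instr (i : Instr)
  | seq (c c' : Code)
  | ite (b : Test) (c c' : Code)
  | loop (b : Test) (c : Code)

/-- A streaming program: code to be run at the start, for each arriving node, for each arriving
edge, and at the end of each time step. -/
structure Program : Type where
  start : Code
  onNode : Code
  onEdge : Code
  onEnd : Code

/-- Configurations. `item` is the current input item (`(x, x)` for a node `x`), `draws` the
number of noise samples drawn so far, `pending` what has been handed to the base algorithm for its
next time step, `history` the elements on which the base algorithm has run, `baseSpace` the
peak space of the base algorithm so far, and `out` the outputs so far. -/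
structure Config (V : Type u) (Y : Type v) where
  ireg : ℕ → ℕ
  rreg : ℕ → ℝ
  itab : ℕ → ℕ → ℕ
  ntab : ℕ → V → ℕ
  item : Option (V × V)
  draws : ℕ
  pending : Arrival V
  history : List (Arrival V)
  out : List (Y ⊕ Unit)
  time : ℕ
  written : Set (Cell V)
  baseSpace : ℕ

namespace Config

/-- Total space: the cells written by the machine, and the space of the base algorithm. -/
noncomputable def space {V : Type u} {Y : Type v} (s : Config V Y) : ℕ :=
  s.written.ncard + s.baseSpace

/-- Let `n` steps pass. -/
def wait {V : Type u} {Y : Type v} (s : Config V Y) (n : ℕ) : Config V Y :=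
  { s with time := s.time + n }

/-- Write an integer register. -/
def setI {V : Type u} {Y : Type v} (s : Config V Y) (i n : ℕ) : Config V Y :=
  { s with ireg := Function.update s.ireg i n, written := insert (Cell.ireg i) s.written }

/-- Write a real register. -/
noncomputable def setR {V : Type u} {Y : Type v} (s : Config V Y) (i : ℕ) (r : ℝ) : Config V Y :=
  { s with rreg := Function.update s.rreg i r, written := insert (Cell.rreg i) s.written }

/-- Write an entry of a table keyed by natural numbers. -/
def setItab {V : Type u} {Y : Type v} (s : Config V Y) (tab key n : ℕ) : Config V Y :=
  { s with
    itab := Function.update s.itab tab (Function.update (s.itab tab) key n)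
    written := insert (Cell.itab tab key) s.written }

/-- Write an entry of a table keyed by node names. -/
def setNtab {V : Type u} [DecidableEq V] {Y : Type v} (s : Config V Y) (tab : ℕ) (key : V)
    (n : ℕ) : Config V Y :=
  { s with
    ntab := Function.update s.ntab tab (Function.update (s.ntab tab) key n)
    written := insert (Cell.ntab tab key) s.written }

/-- The selected node of the current item, if there is a current item. -/
def node {V : Type u} {Y : Type v} (s : Config V Y) (snd : Bool) : Option V :=
  s.item.map (fun p => if snd then p.2 else p.1)

end Config

/-- The effect of an instruction apart from the one step that it takes. The `i`-th draw with
scale `b` yields `b * ξ i`, where `ξ` is the sequence of standard Laplace samples that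
the machine is given, so that the draw is a sample of the Laplace distribution with scale `b`. -/
noncomputable def Instr.effect {V : Type u} [DecidableEq V] {Y : Type v} [MeasurableSpace Y]
    (A : StreamAlg.{u, v, w} V Y) (ω : A.Coins) (ξ : ℕ → ℝ) (s : Config V Y) :
    Instr → Config V Y
  | .iconst dst n => s.setI dst n
  | .iadd dst a b => s.setI dst (s.ireg a + s.ireg b)
  | .isub dst a b => s.setI dst (s.ireg a - s.ireg b)
  | .iload dst tab key => s.setI dst (s.itab tab (s.ireg key))
  | .istore tab key src => s.setItab tab (s.ireg key) (s.ireg src)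
  | .nload dst tab snd => (s.node snd).elim s (fun x => s.setI dst (s.ntab tab x))
  | .nstore tab snd src => (s.node snd).elim s (fun x => s.setNtab tab x (s.ireg src))
  | .rofint dst a => s.setR dst (s.ireg a)
  | .radd dst a b => s.setR dst (s.rreg a + s.rreg b)
  | .rsub dst a b => s.setR dst (s.rreg a - s.rreg b)
  | .rdiv dst a b => s.setR dst (s.rreg a / s.rreg b)
  | .draw dst scale => { s.setR dst (s.rreg scale * ξ s.draws) with draws := s.draws + 1 }
  | .sendNode => s.item.elim s (fun p =>
      { s with pending := (insert p.1 s.pending.1, s.pending.2) })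
  | .sendEdge => s.item.elim s (fun p =>
      { s with pending := (s.pending.1, insert s(p.1, p.2) s.pending.2) })
  | .emitBase =>
      { s with
        pending := (∅, ∅)
        history := s.history ++ [s.pending]
        out := s.out ++ [Sum.inl (A.out ω (s.history ++ [s.pending]))]
        time := s.time + A.stepTime ω (s.history ++ [s.pending])
        baseSpace := max s.baseSpace (A.stepSpace ω (s.history ++ [s.pending])) }
  | .emitBot => { s with out := s.out ++ [Sum.inr ()] }

/-- Truth of a test. -/
def Test.Holds {V : Type u} {Y : Type v} (s : Config V Y) : Test → Prop
  | .ile a b => s.ireg a ≤ s.ireg b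
  | .rle a b => s.rreg a ≤ s.rreg b

/-- `Run A ω ξ c s s'`: the code `c`, started in `s`, terminates in `s'`. -/
inductive Run {V : Type u} [DecidableEq V] {Y : Type v} [MeasurableSpace Y]
    (A : StreamAlg.{u, v, w} V Y) (ω : A.Coins) (ξ : ℕ → ℝ) :
    Code → Config V Y → Config V Y → Prop
  | skip (s : Config V Y) : Run A ω ξ Code.skip s s
  | instr (i : Instr) (s : Config V Y) :
      Run A ω ξ (Code.instr i) s ((i.effect A ω ξ s).wait 1)
  | seq {c c' : Code} {s s' s'' : Config V Y} :
      Run A ω ξ c s s' → Run A ω ξ c' s' s'' → Run A ω ξ (Code.seq c c') s s''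
  | ite_true {b : Test} {c c' : Code} {s s' : Config V Y} :
      b.Holds s → Run A ω ξ c (s.wait 1) s' → Run A ω ξ (Code.ite b c c') s s'
  | ite_false {b : Test} {c c' : Code} {s s' : Config V Y} :
      ¬ b.Holds s → Run A ω ξ c' (s.wait 1) s' → Run A ω ξ (Code.ite b c c') s s'
  | loop_true {b : Test} {c : Code} {s s' s'' : Config V Y} :
      b.Holds s → Run A ω ξ c (s.wait 1) s' → Run A ω ξ (Code.loop b c) s' s'' →
      Run A ω ξ (Code.loop b c) s s''
  | loop_false {b : Test} {c : Code} {s : Config V Y} :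
      ¬ b.Holds s → Run A ω ξ (Code.loop b c) s (s.wait 1)

/-- Run the code `c` once for each item of a list; reading an item takes one step. -/
inductive RunItems {V : Type u} [DecidableEq V] {Y : Type v} [MeasurableSpace Y]
    (A : StreamAlg.{u, v, w} V Y) (ω : A.Coins) (ξ : ℕ → ℝ) (c : Code) :
    List (V × V) → Config V Y → Config V Y → Prop
  | nil (s : Config V Y) : RunItems A ω ξ c [] s s
  | cons {p : V × V} {ps : List (V × V)} {s s' s'' : Config V Y} :
      Run A ω ξ c (Config.wait { s with item := some p } 1) s' → RunItems A ω ξ c ps s' s'' →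
      RunItems A ω ξ c (p :: ps) s s''

/-- One time step: the arriving nodes in increasing order, then the arriving edges in
the consistent order, then the code for the end of the step, which takes one step to enter. -/
def RunArrival {V : Type u} [LinearOrder V] {Y : Type v} [MeasurableSpace Y]
    (A : StreamAlg.{u, v, w} V Y) (ω : A.Coins) (ξ : ℕ → ℝ) (P : Program) (x : Arrival V)
    (s s' : Config V Y) : Prop :=
  ∃ s₁ s₂ : Config V Y,
    RunItems A ω ξ P.onNode (x.1.sort.map (fun y => (y, y))) { s with pending := (∅, ∅) } s₁ ∧
    RunItems A ω ξ P.onEdge (orderedEdges x.2) s₁ s₂ ∧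
    Run A ω ξ P.onEnd (Config.wait { s₂ with item := none } 1) s'

/-- Successive time steps. -/
inductive RunStream {V : Type u} [LinearOrder V] {Y : Type v} [MeasurableSpace Y]
    (A : StreamAlg.{u, v, w} V Y) (ω : A.Coins) (ξ : ℕ → ℝ) (P : Program) :
    List (Arrival V) → Config V Y → Config V Y → Prop
  | nil (s : Config V Y) : RunStream A ω ξ P [] s s
  | cons {x : Arrival V} {xs : List (Arrival V)} {s s' s'' : Config V Y} :
      RunArrival A ω ξ P x s s' → RunStream A ω ξ P xs s' s'' → RunStream A ω ξ P (x :: xs) s s''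

/-- The initial configuration: integer registers `0`, `1` hold two natural parameters, real
registers `0`, `1` hold two real parameters, and everything else is empty. -/
noncomputable def initial (V : Type u) (Y : Type v) (a b : ℕ) (r r' : ℝ) : Config V Y where
  ireg := fun i => if i = 0 then a else if i = 1 then b else 0
  rreg := fun i => if i = 0 then r else if i = 1 then r' else 0
  itab := fun _ _ => 0
  ntab := fun _ _ => 0
  item := none
  draws := 0
  pending := (∅, ∅)
  history := []
  out := []
  time := 0
  written := {Cell.ireg 0, Cell.ireg 1, Cell.rreg 0, Cell.rreg 1}
  baseSpace := 0

/-- The program `P`, given the parameters `D'`, `ℓ`, `ε_Test`, `τ`, the coins `ω` of the base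
algorithm and the noise samples `ξ`, ends in the configuration `s` after the time steps `xs`. -/
def RunProgram {V : Type u} [LinearOrder V] {Y : Type v} [MeasurableSpace Y]
    (A : StreamAlg.{u, v, w} V Y) (ω : A.Coins) (ξ : ℕ → ℝ) (P : Program) (D' ℓ : ℕ)
    (εTest τ : ℝ) (xs : List (Arrival V)) (s : Config V Y) : Prop :=
  ∃ s₀ : Config V Y, Run A ω ξ P.start (initial V Y D' ℓ εTest τ) s₀ ∧
    RunStream A ω ξ P xs s₀ s

end StreamRAM

/-! Privacy. Let `S'` arise from `S` by removing the node `x`, and let `k` be the first time step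
after which `S` has at least `ℓ` nodes of degree greater than `D'` (`exists_crossing`). At this step
the query of `S` is `0` and, distances having sensitivity one, that of `S'` is at least `-1`. So the
test has failed by then except with probability `β_Test` for `S` and `exp ε_Test * β_Test` for `S'`,
and later answers do not matter. Before that step at most `ℓ` nodes of `S` have degree greater than
`D'`. Removing `x` lowers the counter of another node by at most one, and different edges at a node
are handled at different counter values. Hence every node of high degree accounts for at most one
edge that is passed on only after the removal (`card_new_edges_le`). The two projections therefore
differ by `x` with its at most `D'` edges and by at most `ℓ` further edges: `D' + ℓ` edge steps, or
`2 * ℓ + 1` node steps, an edge being removed by removing an endpoint and adding it again. All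
intermediate streams are substreams of one of the two projections, so they have maximum degree at
most `D'` and the restricted guarantee applies along the chain (`edge_projStream`,
`node_projStream`).

The stopping time is private by the sparse vector argument: translate the threshold noise by `1` and
the noise of the stopping query by `2` (`svtNoise_svtStop_le`). As this noise is independent of the
coins of the base algorithm, the output is, up to the event that the test misses step `k`, a mixture
over the stopping times `n ≤ k` of the base answers cut off at `n`. Comparing the mixtures term by
term multiplies the two exponential factors, and charges the additive loss of the base algorithm
only once (`gated_one_sided`).

Accuracy and running time use a closed form of the distance. With `k` node changes one creates the
largest number of high degree nodes by adding `k` new nodes joined to everything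
(`distToGraph_le_iff`; this is where infinitely many names are needed). If all degrees are at most
`D`, fewer than `ℓ` changes lift no old node above `D + ℓ`, so the distance is at least `ℓ`, and `ℓ`
is large enough for a union bound over the Laplace tails.

The program stores, for every `j`, how many nodes have degree at least `j`; with this table the
closed form is tested in constant time. The distance never increases along a stream, so a bound that
starts at `D' + 2` and only decreases finds it at every step. For `ℓ ≠ 0` the distance plus the
number of nodes is at least `D' + 2` (`le_card_add_distToGraph`), so in total the bound moves at
most once per node (`Invariant`). -/

namespace FinGraph

/-! ### Node distance to graphs with many nodes of high degree. -/

variable {V : Type u} [DecidableEq V]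

/-- The number of nodes of degree greater than `D` after adding `k` fresh nodes that are joined to
all other nodes. -/
def reach (D : ℕ) (G : FinGraph V) (k : ℕ) : ℕ :=
  (G.verts.filter (fun x => D < G.degree x + k)).card
    + if D + 1 < G.verts.card + k then k else 0

theorem reach_zero (D : ℕ) (G : FinGraph V) : reach D G 0 = (G.highDegree D).card := by
  simp [reach, highDegree]

theorem reach_mono (D : ℕ) (G : FinGraph V) : Monotone (reach D G) := by
  intro a b hab
  unfold reach
  refine add_le_add (Finset.card_le_card fun x hx => ?_) ?_
  · rw [Finset.mem_filter] at hx ⊢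
    exact ⟨hx.1, by omega⟩
  · split_ifs <;> omega

theorem removeNode_ne {G : FinGraph V} {x : V} (hx : x ∈ G.verts) : G ≠ G.removeNode x := by
  intro h
  have := congrArg FinGraph.verts h
  rw [this] at hx
  simp [removeNode] at hx

theorem adj_removeNode {G : FinGraph V} {x : V} (hx : x ∈ G.verts) :
    (nodeNeighborGraph V).Adj G (G.removeNode x) := by
  rw [nodeNeighborGraph, SimpleGraph.fromRel_adj]
  exact ⟨removeNode_ne hx, Or.inl ⟨x, hx, rfl⟩⟩

theorem removeNode_of_notMem {G : FinGraph V} {x : V} (hx : x ∉ G.verts) :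
    G.removeNode x = G := by
  ext y
  · simp only [removeNode, Finset.mem_erase]
    exact ⟨fun h => h.2, fun h => ⟨fun h' => hx (h' ▸ h), h⟩⟩
  · simp only [removeNode, Finset.mem_filter]
    exact ⟨fun h => h.1, fun h => ⟨h, fun h' => hx (G.endpoints _ h _ h')⟩⟩

/-- The graph without nodes. -/
def empty (V : Type u) : FinGraph V := ⟨∅, ∅, by simp, by simp⟩

theorem reachable_empty (G : FinGraph V) :
    (nodeNeighborGraph V).Reachable G (empty V) := by
  induction h : G.verts.card generalizing G with
  | zero =>
    rw [Finset.card_eq_zero] at h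
    have : G = empty V := by
      ext y
      · simp [h, empty]
      · simp only [empty, Finset.notMem_empty, iff_false]
        intro hy
        have := G.endpoints y hy _ (Sym2.out_fst_mem y)
        simp [h] at this
    rw [this]
  | succ n ih =>
    obtain ⟨x, hx⟩ : G.verts.Nonempty := Finset.card_pos.1 (by omega)
    refine (adj_removeNode hx).reachable.trans (ih _ ?_)
    simp [removeNode, Finset.card_erase_of_mem hx, h]

/-- `SimpleGraph.dist` takes the default value `0` on unreachable pairs; connectedness excludes
this, so that `nodeDist` is the length of an actual chain and obeys the triangle inequality. -/
theorem nodeNeighborGraph_connected : (nodeNeighborGraph V).Connected :=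
  { preconnected := fun G H => (reachable_empty G).trans (reachable_empty H).symm
    nonempty := ⟨empty V⟩ }

/-- The number of edges at `y` whose other endpoint lies in `W` is at most `|W|`. -/
theorem card_edges_to_le (E : Finset (Sym2 V)) (y : V) (W : Finset V)
    (h : ∀ e ∈ E, ∃ w ∈ W, e = s(y, w)) : E.card ≤ W.card := by
  refine (Finset.card_le_card (t := W.image (fun w => s(y, w))) fun e he => ?_).trans
    Finset.card_image_le
  obtain ⟨w, hw, rfl⟩ := h e he
  exact Finset.mem_image_of_mem _ hw

theorem degree_lt_card (G : FinGraph V) {y : V} (hy : y ∈ G.verts) :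
    G.degree y < G.verts.card := by
  rw [← Finset.card_erase_add_one hy, Nat.lt_succ_iff]
  refine card_edges_to_le _ y _ fun e he => ?_
  rw [Finset.mem_filter] at he
  obtain ⟨w, rfl⟩ := Sym2.mem_iff_exists.1 he.2
  refine ⟨w, Finset.mem_erase.2 ⟨?_, G.endpoints _ he.1 w (Sym2.mem_mk_right y w)⟩, rfl⟩
  rintro rfl
  exact G.no_loops _ he.1 rfl

/-- What a chain of node neighbors of length `n` from `G` to `H` leaves: a set of nodes that are
never removed, all other nodes of `H` having been added. -/
theorem exists_kept {G H : FinGraph V} (p : (nodeNeighborGraph V).Walk G H) :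
    ∃ K ⊆ G.verts ∩ H.verts, (∀ e ∈ H.edges, (∀ z ∈ e, z ∈ K) → e ∈ G.edges) ∧
      (H.verts \ K).card ≤ p.length := by
  induction p using SimpleGraph.Walk.concatRec with
  | @Hnil G => exact ⟨G.verts, by simp, fun e he _ => he, by simp⟩
  | @Hconcat G H H' p h ih =>
    obtain ⟨K, hK, hE, hc⟩ := ih
    rw [nodeNeighborGraph, SimpleGraph.fromRel_adj] at h
    rw [SimpleGraph.Walk.length_concat]
    -- The last step of the chain deletes `x`, which then leaves the kept set, or inserts `x`
    -- outside the kept set. A node that is deleted and later reinserted counts as new.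
    obtain ⟨x, hx, rfl⟩ | ⟨x, hx, rfl⟩ := h.2
    · refine ⟨K.erase x, ?_, ?_, ?_⟩
      · intro y hy
        have := Finset.mem_inter.1 (hK (Finset.mem_of_mem_erase hy))
        exact Finset.mem_inter.2 ⟨this.1, Finset.mem_erase.2 ⟨Finset.ne_of_mem_erase hy, this.2⟩⟩
      · intro e he hz
        exact hE e (Finset.mem_filter.1 he).1 fun z hz' => Finset.mem_of_mem_erase (hz z hz')
      · refine (Finset.card_le_card fun y hy => ?_).trans (hc.trans (Nat.le_succ _))
        simp only [removeNode, Finset.mem_sdiff, Finset.mem_erase] at hy ⊢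
        tauto
    · refine ⟨K, ?_, ?_, ?_⟩
      · intro y hy
        have := Finset.mem_inter.1 (hK hy)
        exact Finset.mem_inter.2 ⟨this.1, Finset.mem_of_mem_erase this.2⟩
      · intro e he hz
        refine hE e (Finset.mem_filter.2 ⟨he, fun hxe => ?_⟩) hz
        have := (Finset.mem_inter.1 (hK (hz x hxe))).2
        simp [removeNode] at this
      · have : H'.verts \ K ⊆ insert x ((H'.removeNode x).verts \ K) := by
          intro y hy
          simp only [removeNode, Finset.mem_sdiff, Finset.mem_erase, Finset.mem_insert] at hy ⊢
          tauto
        exact (Finset.card_le_card this).trans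
          ((Finset.card_insert_le _ _).trans (Nat.succ_le_succ hc))

/-- A kept node gains at most one edge for each node that is not kept, and there are at most as many
of those as steps. The latter can have degree greater than `D` only if `H` has at least `D + 2`
nodes, hence the condition in `reach`. -/
theorem highDegree_card_le_reach {G H : FinGraph V} (D : ℕ)
    (p : (nodeNeighborGraph V).Walk G H) : (H.highDegree D).card ≤ reach D G p.length := by
  obtain ⟨K, hK, hE, hc⟩ := exists_kept p
  set a := p.length
  have hKG : K ⊆ G.verts := fun y hy => (Finset.mem_inter.1 (hK hy)).1
  have hKH : K ⊆ H.verts := fun y hy => (Finset.mem_inter.1 (hK hy)).2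
  have hdeg : ∀ y ∈ K, H.degree y ≤ G.degree y + a := by
    intro y hy
    have h1 : (H.edges.filter (fun e => y ∈ e)) ⊆ (G.edges.filter (fun e => y ∈ e)) ∪
        (H.edges.filter (fun e => ∃ w ∈ H.verts \ K, e = s(y, w))) := by
      intro e he
      rw [Finset.mem_filter] at he
      obtain ⟨w, rfl⟩ := Sym2.mem_iff_exists.1 he.2
      rw [Finset.mem_union, Finset.mem_filter, Finset.mem_filter]
      by_cases hw : w ∈ K
      · refine Or.inl ⟨hE _ he.1 fun z hz => ?_, he.2⟩
        rcases Sym2.mem_iff.1 hz with rfl | rfl <;> assumption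
      · exact Or.inr ⟨he.1, w, Finset.mem_sdiff.2
          ⟨H.endpoints _ he.1 w (Sym2.mem_mk_right y w), hw⟩, rfl⟩
    refine (Finset.card_le_card h1).trans ((Finset.card_union_le _ _).trans
      (add_le_add le_rfl ((card_edges_to_le _ y (H.verts \ K) fun e he => ?_).trans hc)))
    exact (Finset.mem_filter.1 he).2
  have hcard : H.verts.card ≤ G.verts.card + a := by
    rw [← Finset.sdiff_union_of_subset hKH]
    refine (Finset.card_union_le _ _).trans ?_
    have := Finset.card_le_card hKG
    omega
  have hsub : H.highDegree D ⊆ (G.verts.filter (fun x => D < G.degree x + a)) ∪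
      (H.highDegree D).filter (fun y => y ∉ K) := by
    intro y hy
    rw [Finset.mem_union]
    by_cases hyK : y ∈ K
    · refine Or.inl (Finset.mem_filter.2 ⟨hKG hyK, ?_⟩)
      exact (Finset.mem_filter.1 hy).2.trans_le (hdeg y hyK)
    · exact Or.inr (Finset.mem_filter.2 ⟨hy, hyK⟩)
  refine (Finset.card_le_card hsub).trans ((Finset.card_union_le _ _).trans
    (add_le_add le_rfl ?_))
  split_ifs with h
  · refine (Finset.card_le_card fun y hy => ?_).trans hc
    rw [Finset.mem_filter] at hy
    exact Finset.mem_sdiff.2 ⟨(Finset.mem_filter.1 hy.1).1, hy.2⟩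
  · rw [Nat.le_zero, Finset.card_eq_zero, Finset.filter_eq_empty_iff]
    intro y hy
    have h2 := Finset.mem_filter.1 hy
    have := H.degree_lt_card h2.1
    omega

/-- Add the node `x`, joined to all nodes of `G`. -/
def addFull (G : FinGraph V) (x : V) (hx : x ∉ G.verts) : FinGraph V where
  verts := insert x G.verts
  edges := G.edges ∪ G.verts.image (fun y => s(x, y))
  no_loops := by
    intro e he
    rcases Finset.mem_union.1 he with he | he
    · exact G.no_loops e he
    · obtain ⟨y, hy, rfl⟩ := Finset.mem_image.1 he
      rw [Sym2.mk_isDiag_iff]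
      exact fun h => hx (h ▸ hy)
  endpoints := by
    intro e he z hz
    rcases Finset.mem_union.1 he with he | he
    · exact Finset.mem_insert_of_mem (G.endpoints e he z hz)
    · obtain ⟨y, hy, rfl⟩ := Finset.mem_image.1 he
      rcases Sym2.mem_iff.1 hz with rfl | rfl
      · exact Finset.mem_insert_self _ _
      · exact Finset.mem_insert_of_mem hy

theorem removeNode_addFull (G : FinGraph V) (x : V) (hx : x ∉ G.verts) :
    (G.addFull x hx).removeNode x = G := by
  ext e
  · simp [removeNode, addFull, hx]
  · simp only [removeNode, addFull, Finset.mem_filter, Finset.mem_union, Finset.mem_image]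
    constructor
    · rintro ⟨h | ⟨y, -, rfl⟩, hxe⟩
      · exact h
      · exact absurd (Sym2.mem_mk_left x y) hxe
    · exact fun h => ⟨Or.inl h, fun hxe => hx (G.endpoints e h x hxe)⟩

theorem adj_addFull (G : FinGraph V) (x : V) (hx : x ∉ G.verts) :
    (nodeNeighborGraph V).Adj G (G.addFull x hx) := by
  have := adj_removeNode (G := G.addFull x hx) (x := x) (Finset.mem_insert_self _ _)
  rw [removeNode_addFull] at this
  exact this.symm

theorem degree_addFull_old (G : FinGraph V) (x : V) (hx : x ∉ G.verts) {y : V}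
    (hy : y ∈ G.verts) : G.degree y + 1 ≤ (G.addFull x hx).degree y := by
  have hn : s(x, y) ∉ G.edges.filter (fun e => y ∈ e) := fun h =>
    hx (G.endpoints _ (Finset.mem_filter.1 h).1 x (Sym2.mem_mk_left x y))
  unfold degree
  rw [← Finset.card_insert_of_notMem hn]
  refine Finset.card_le_card fun e he => ?_
  rcases Finset.mem_insert.1 he with rfl | he
  · exact Finset.mem_filter.2 ⟨Finset.mem_union_right _ (Finset.mem_image_of_mem _ hy),
      Sym2.mem_mk_right x y⟩
  · rw [Finset.mem_filter] at he
    exact Finset.mem_filter.2 ⟨Finset.mem_union_left _ he.1, he.2⟩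

theorem degree_addFull_new (G : FinGraph V) (x : V) (hx : x ∉ G.verts) :
    G.verts.card ≤ (G.addFull x hx).degree x := by
  unfold degree
  rw [← Finset.card_image_of_injective G.verts
    (f := fun y => s(x, y)) (fun y z h => Sym2.congr_right.1 h)]
  refine Finset.card_le_card fun e he => ?_
  obtain ⟨y, hy, rfl⟩ := Finset.mem_image.1 he
  exact Finset.mem_filter.2 ⟨Finset.mem_union_right _ he, Sym2.mem_mk_left x y⟩

/-- One fully joined node raises every old degree by one, and itself becomes one of the `k + 1` new
nodes: it is an old node of degree at least `G.verts.card` for the remaining `k`. -/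
theorem reach_succ_le (D : ℕ) (G : FinGraph V) (x : V) (hx : x ∉ G.verts) (k : ℕ) :
    reach D G (k + 1) ≤ reach D (G.addFull x hx) k := by
  have hcard : (G.addFull x hx).verts.card = G.verts.card + 1 :=
    Finset.card_insert_of_notMem hx
  have hsub : G.verts.filter (fun y => D < G.degree y + (k + 1)) ⊆
      (G.addFull x hx).verts.filter (fun y => D < (G.addFull x hx).degree y + k) := by
    intro y hy
    rw [Finset.mem_filter] at hy
    have := G.degree_addFull_old x hx hy.1
    exact Finset.mem_filter.2 ⟨Finset.mem_insert_of_mem hy.1, by omega⟩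
  unfold reach
  rw [hcard]
  by_cases h : D + 1 < G.verts.card + (k + 1)
  · rw [if_pos h, if_pos (by omega)]
    have hx' : x ∉ G.verts.filter (fun y => D < G.degree y + (k + 1)) :=
      fun h' => hx (Finset.mem_filter.1 h').1
    have hins : insert x (G.verts.filter (fun y => D < G.degree y + (k + 1))) ⊆
        (G.addFull x hx).verts.filter (fun y => D < (G.addFull x hx).degree y + k) := by
      refine Finset.insert_subset (Finset.mem_filter.2 ⟨Finset.mem_insert_self _ _, ?_⟩) hsub
      have := G.degree_addFull_new x hx
      omega
    have := Finset.card_le_card hins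
    rw [Finset.card_insert_of_notMem hx'] at this
    omega
  · rw [if_neg h]
    exact (Finset.card_le_card hsub).trans (Nat.le_add_right _ _)

theorem exists_reach [Infinite V] (D : ℕ) (k : ℕ) (G : FinGraph V) :
    ∃ H : FinGraph V, reach D G k ≤ (H.highDegree D).card ∧ nodeDist G H ≤ k := by
  induction k generalizing G with
  | zero => exact ⟨G, (reach_zero D G).le, by simp [nodeDist]⟩
  | succ k ih =>
    obtain ⟨x, hx⟩ := Infinite.exists_notMem_finset G.verts
    obtain ⟨H, h1, h2⟩ := ih (G.addFull x hx)
    refine ⟨H, (reach_succ_le D G x hx k).trans h1, ?_⟩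
    have h3 := nodeNeighborGraph_connected (V := V).dist_triangle (u := G) (v := G.addFull x hx)
      (w := H)
    have h4 : (nodeNeighborGraph V).dist G (G.addFull x hx) = 1 :=
      SimpleGraph.dist_eq_one_iff_adj.2 (G.adj_addFull x hx)
    unfold nodeDist at h2 ⊢
    omega

theorem distToGraph_le_of_highDegree {D ℓ : ℕ} (G : FinGraph V) {H : FinGraph V}
    (h : ℓ ≤ (H.highDegree D).card) : distToGraph D ℓ G ≤ nodeDist G H :=
  Nat.sInf_le ⟨H, h, rfl⟩

theorem exists_distToGraph [Infinite V] (D ℓ : ℕ) (G : FinGraph V) :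
    ∃ H : FinGraph V, ℓ ≤ (H.highDegree D).card ∧ nodeDist G H = distToGraph D ℓ G := by
  refine Nat.sInf_mem (s := {d | ∃ H : FinGraph V, ℓ ≤ (H.highDegree D).card ∧ nodeDist G H = d}) ?_
  -- The set must be nonempty, since `sInf ∅ = 0` would be a false distance. With `D + 2 + ℓ` new
  -- nodes the second summand of `reach` alone is at least `ℓ`, whatever `G` is.
  obtain ⟨H, h, -⟩ := exists_reach D (D + 2 + ℓ) G
  refine ⟨_, H, le_trans ?_ h, rfl⟩
  unfold reach
  rw [if_pos (by omega)]
  omega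

/-- The closed form of the distance: no chain beats the greedy one, and the greedy chain exists. It
gives the accuracy bound, monotonicity in the graph, and the test made by the program. -/
theorem distToGraph_le_iff [Infinite V] {D ℓ : ℕ} (G : FinGraph V) (k : ℕ) :
    distToGraph D ℓ G ≤ k ↔ ℓ ≤ reach D G k := by
  constructor
  · intro h
    obtain ⟨H, h1, h2⟩ := exists_distToGraph D ℓ G
    obtain ⟨p, hp⟩ := nodeNeighborGraph_connected (V := V).exists_walk_length_eq_dist G H
    refine h1.trans ((highDegree_card_le_reach D p).trans (reach_mono D G ?_))
    rw [hp]
    exact h2.le.trans h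
  · intro h
    obtain ⟨H, h1, h2⟩ := exists_reach D k G
    exact (distToGraph_le_of_highDegree G (h.trans h1)).trans h2

theorem distToGraph_eq_zero [Infinite V] {D ℓ : ℕ} {G : FinGraph V}
    (h : ℓ ≤ (G.highDegree D).card) : distToGraph D ℓ G = 0 := by
  rw [← Nat.le_zero, distToGraph_le_iff, reach_zero]
  exact h

theorem distToGraph_le_of_adj [Infinite V] (D ℓ : ℕ) {G G' : FinGraph V}
    (h : (nodeNeighborGraph V).Adj G G') : distToGraph D ℓ G ≤ distToGraph D ℓ G' + 1 := by
  obtain ⟨H, h1, h2⟩ := exists_distToGraph D ℓ G'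
  have h3 := nodeNeighborGraph_connected (V := V).dist_triangle (u := G) (v := G') (w := H)
  have h4 : (nodeNeighborGraph V).dist G G' = 1 := SimpleGraph.dist_eq_one_iff_adj.2 h
  refine (distToGraph_le_of_highDegree G h1).trans ?_
  unfold nodeDist at h2 ⊢
  omega

theorem distToGraph_removeNode [Infinite V] (D ℓ : ℕ) (G : FinGraph V) (x : V) :
    distToGraph D ℓ G ≤ distToGraph D ℓ (G.removeNode x) + 1 ∧
      distToGraph D ℓ (G.removeNode x) ≤ distToGraph D ℓ G + 1 := by
  by_cases hx : x ∈ G.verts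
  · exact ⟨distToGraph_le_of_adj D ℓ (adj_removeNode hx),
      distToGraph_le_of_adj D ℓ (adj_removeNode hx).symm⟩
  · rw [removeNode_of_notMem hx]
    omega

/-- If all degrees are at most `D`, then `ℓ` steps are needed to reach `ℓ` nodes of degree
greater than `D + ℓ`. -/
theorem le_distToGraph_of_bounded [Infinite V] {D ℓ : ℕ} {G : FinGraph V} (h : G.Bounded D 0) :
    ℓ ≤ distToGraph (D + ℓ) ℓ G := by
  by_contra! hlt
  have h1 := (distToGraph_le_iff (D := D + ℓ) (ℓ := ℓ) G _).1 le_rfl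
  set k := distToGraph (D + ℓ) ℓ G
  -- With `k < ℓ` no old node is lifted above `D + ℓ`, and the new nodes are only `k`.
  have h2 : G.verts.filter (fun x => D + ℓ < G.degree x + k) = ∅ := by
    rw [Finset.filter_eq_empty_iff]
    intro x hx h'
    have h0 := Finset.card_eq_zero.1 (Nat.le_zero.1 h)
    rw [highDegree, Finset.filter_eq_empty_iff] at h0
    have := h0 hx
    omega
  unfold reach at h1
  rw [h2, Finset.card_empty] at h1
  split_ifs at h1 <;> omega

end FinGraph

/-! ## Laplace noise -/

theorem laplace_Iic {b : ℝ} (hb : 0 < b) {a : ℝ} (ha : a ≤ 0) :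
    laplace b (Set.Iic a) = ENNReal.ofReal (Real.exp (a / b) / 2) := by
  rw [laplace, withDensity_apply _ measurableSet_Iic]
  have h1 : ∀ x ∈ Set.Iic a, ENNReal.ofReal (1 / (2 * b) * Real.exp (-|x| / b)) =
      ENNReal.ofReal (1 / (2 * b) * Real.exp (1 / b * x)) := by
    intro x hx
    rw [abs_of_nonpos (le_trans hx ha), neg_neg, one_div_mul_eq_div b x]
  rw [setLIntegral_congr_fun measurableSet_Iic h1,
    ← ofReal_integral_eq_lintegral_ofReal
      ((integrableOn_exp_mul_Iic (one_div_pos.2 hb) a).const_mul _)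
      (Filter.Eventually.of_forall fun x => by positivity),
    integral_const_mul, integral_exp_mul_Iic (one_div_pos.2 hb)]
  congr 1
  rw [div_mul_eq_mul_div 1 b a, one_mul]
  field_simp

theorem laplace_Ioi {b : ℝ} (hb : 0 < b) {a : ℝ} (ha : 0 ≤ a) :
    laplace b (Set.Ioi a) = ENNReal.ofReal (Real.exp (-a / b) / 2) := by
  rw [laplace, withDensity_apply _ measurableSet_Ioi]
  have h1 : ∀ x ∈ Set.Ioi a, ENNReal.ofReal (1 / (2 * b) * Real.exp (-|x| / b)) =
      ENNReal.ofReal (1 / (2 * b) * Real.exp (-(1 / b) * x)) := by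
    intro x hx
    rw [abs_of_pos (lt_of_le_of_lt ha hx), neg_mul, one_div_mul_eq_div b x, neg_div]
  have hneg : -(1 / b) < 0 := neg_lt_zero.2 (one_div_pos.2 hb)
  rw [setLIntegral_congr_fun measurableSet_Ioi h1,
    ← ofReal_integral_eq_lintegral_ofReal ((integrableOn_exp_mul_Ioi hneg a).const_mul _)
      (Filter.Eventually.of_forall fun x => by positivity),
    integral_const_mul, integral_exp_mul_Ioi hneg]
  congr 1
  rw [neg_mul, div_mul_eq_mul_div 1 b a, one_mul, neg_div]
  field_simp

theorem isProbabilityMeasure_laplace {b : ℝ} (hb : 0 < b) : IsProbabilityMeasure (laplace b) := by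
  constructor
  rw [← Set.Iic_union_Ioi (a := (0 : ℝ)), measure_union (Set.Iic_disjoint_Ioi le_rfl)
    measurableSet_Ioi, laplace_Iic hb le_rfl, laplace_Ioi hb le_rfl,
    ← ENNReal.ofReal_add (by positivity) (by positivity)]
  norm_num

theorem laplace_Ici {b : ℝ} (hb : 0 < b) {a : ℝ} (ha : 0 ≤ a) :
    laplace b (Set.Ici a) = ENNReal.ofReal (Real.exp (-a / b) / 2) := by
  rw [← laplace_Ioi hb ha]
  refine measure_congr ?_
  have : laplace b ≪ volume := withDensity_absolutelyContinuous _ _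
  exact (this.ae_eq Ioi_ae_eq_Ici).symm

/-- Translating Laplace noise by `a` changes probabilities by a factor of at most `exp (|a| / b)`. -/
theorem laplace_preimage_add_le {b : ℝ} (hb : 0 < b) (a : ℝ) {A : Set ℝ} (hA : MeasurableSet A) :
    laplace b ((fun x => x + a) ⁻¹' A) ≤ ENNReal.ofReal (Real.exp (|a| / b)) * laplace b A := by
  have hm : Measurable fun x : ℝ => x + a := measurable_add_const a
  rw [laplace, withDensity_apply _ (hm hA), withDensity_apply _ hA, ← lintegral_indicator hA,
    ← lintegral_indicator (hm hA), ← lintegral_const_mul' _ _ ENNReal.ofReal_ne_top,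
    ← lintegral_add_right_eq_self (fun x => ENNReal.ofReal (Real.exp (|a| / b)) * A.indicator _ x) a]
  refine lintegral_mono fun x => ?_
  by_cases hx : x + a ∈ A
  · rw [Set.indicator_of_mem (show x ∈ (fun x => x + a) ⁻¹' A from hx), Set.indicator_of_mem hx,
      ← ENNReal.ofReal_mul (Real.exp_nonneg _)]
    refine ENNReal.ofReal_le_ofReal ?_
    rw [mul_left_comm, ← Real.exp_add]
    have : -|x| / b ≤ |a| / b + -|x + a| / b := by
      rw [← add_div]
      have := abs_add_le x a
      exact div_le_div_of_nonneg_right (by linarith) hb.le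
    gcongr
  · rw [Set.indicator_of_notMem (show x ∉ (fun x => x + a) ⁻¹' A from hx)]
    exact zero_le

/-- Fubini: a bound for a map of one factor holds on every slice. -/
theorem prod_preimage_map_id_le {α β : Type*} [MeasurableSpace α] [MeasurableSpace β]
    {μ : Measure α} {ν : Measure β} [SFinite μ] [SFinite ν] {f : α → α} (hf : Measurable f)
    {c : ENNReal} (hc : c ≠ ⊤) (h : ∀ A, MeasurableSet A → μ (f ⁻¹' A) ≤ c * μ A) {E : Set (α × β)}
    (hE : MeasurableSet E) : μ.prod ν (Prod.map f id ⁻¹' E) ≤ c * μ.prod ν E := by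
  rw [Measure.prod_apply_symm hE, Measure.prod_apply_symm ((hf.prodMap measurable_id) hE),
    ← lintegral_const_mul' _ _ hc]
  exact lintegral_mono fun y => h _ (measurable_prodMk_right hE)

theorem prod_preimage_id_map_le {α β : Type*} [MeasurableSpace α] [MeasurableSpace β]
    {μ : Measure α} {ν : Measure β} [SFinite μ] [SFinite ν] {f : β → β} (hf : Measurable f)
    {c : ENNReal} (hc : c ≠ ⊤) (h : ∀ A, MeasurableSet A → ν (f ⁻¹' A) ≤ c * ν A) {E : Set (α × β)}
    (hE : MeasurableSet E) : μ.prod ν (Prod.map id f ⁻¹' E) ≤ c * μ.prod ν E := by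
  rw [Measure.prod_apply hE, Measure.prod_apply ((measurable_id.prodMap hf) hE),
    ← lintegral_const_mul' _ _ hc]
  exact lintegral_mono fun y => h _ (measurable_prodMk_left hE)

theorem measurable_update_add {T : ℕ} (n : Fin T) (a : ℝ) :
    Measurable (fun z : Fin T → ℝ => Function.update z n (z n + a)) := by
  refine measurable_pi_lambda _ fun i => ?_
  by_cases h : i = n
  · subst h
    simpa using (measurable_pi_apply (X := fun _ : Fin T => ℝ) i).add_const a
  · simpa [Function.update_of_ne h] using measurable_pi_apply i

/-- Splitting off the coordinate `n` turns the translation of one coordinate into a translation of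
the first factor of a product. -/
theorem pi_laplace_preimage_update_le {b : ℝ} (hb : 0 < b) {T : ℕ} (n : Fin T) (a : ℝ)
    {E : Set (Fin T → ℝ)} (hE : MeasurableSet E) :
    Measure.pi (fun _ : Fin T => laplace b) ((fun z => Function.update z n (z n + a)) ⁻¹' E)
      ≤ ENNReal.ofReal (Real.exp (|a| / b)) * Measure.pi (fun _ : Fin T => laplace b) E := by
  have := isProbabilityMeasure_laplace hb
  obtain _ | m := T
  · exact n.elim0
  have hp := (measurePreserving_piFinSuccAbove (fun _ : Fin (m + 1) => laplace b) n).symm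
  set e := (MeasurableEquiv.piFinSuccAbove (fun _ : Fin (m + 1) => ℝ) n).symm
  rw [← hp.measure_preimage hE.nullMeasurableSet,
    ← hp.measure_preimage (measurable_update_add n a hE).nullMeasurableSet]
  have key : e ⁻¹' ((fun z : Fin (m + 1) → ℝ => Function.update z n (z n + a)) ⁻¹' E) =
      Prod.map (fun x => x + a) id ⁻¹' (e ⁻¹' E) := by
    ext ⟨x, y⟩
    simp only [Set.mem_preimage, Prod.map, id]
    have : Function.update (e (x, y)) n (e (x, y) n + a) = e (x + a, y) := by
      have h : ∀ p : ℝ × (Fin m → ℝ), e p = n.insertNth p.1 p.2 := fun p => rfl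
      rw [h, h]
      simp
    rw [this]
  rw [key]
  exact prod_preimage_map_id_le (measurable_add_const a) ENNReal.ofReal_ne_top
    (fun A hA => laplace_preimage_add_le hb a hA) (e.measurable hE)

/-! ## Sparse vector with cutoff one -/

theorem svtThresholdScale_pos {ε : ℝ} (hε : 0 < ε) : 0 < svtThresholdScale ε := by
  unfold svtThresholdScale; positivity

theorem svtQueryScale_pos {ε : ℝ} (hε : 0 < ε) : 0 < svtQueryScale 1 ε := by
  unfold svtQueryScale; positivity

theorem isProbabilityMeasure_svtNoise {ε : ℝ} (hε : 0 < ε) (T : ℕ) :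
    IsProbabilityMeasure (svtNoise 1 ε T) := by
  have := isProbabilityMeasure_laplace (svtThresholdScale_pos hε)
  have := isProbabilityMeasure_laplace (svtQueryScale_pos hε)
  unfold svtNoise
  infer_instance

theorem svtNoise_fst {ε : ℝ} (hε : 0 < ε) {T : ℕ} {A : Set ℝ} (hA : MeasurableSet A) :
    svtNoise 1 ε T {z | z.1 ∈ A} = laplace (svtThresholdScale ε) A := by
  have := isProbabilityMeasure_laplace (svtThresholdScale_pos hε)
  have := isProbabilityMeasure_laplace (svtQueryScale_pos hε)
  exact measurePreserving_fst.measure_preimage hA.nullMeasurableSet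

theorem svtNoise_snd {ε : ℝ} (hε : 0 < ε) {T : ℕ} (t : Fin T) {A : Set ℝ} (hA : MeasurableSet A) :
    svtNoise 1 ε T {z | z.2 t ∈ A} = laplace (svtQueryScale 1 ε) A := by
  have := isProbabilityMeasure_laplace (svtThresholdScale_pos hε)
  have := isProbabilityMeasure_laplace (svtQueryScale_pos hε)
  exact ((measurePreserving_eval (fun _ : Fin T => laplace (svtQueryScale 1 ε)) t).comp
    (measurePreserving_snd (μ := laplace (svtThresholdScale ε)))).measure_preimage
      hA.nullMeasurableSet

theorem svtNoise_shift_threshold {ε : ℝ} (hε : 0 < ε) {T : ℕ} {E : Set (ℝ × (Fin T → ℝ))}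
    (hE : MeasurableSet E) :
    svtNoise 1 ε T {z | (z.1 + 1, z.2) ∈ E} ≤
      ENNReal.ofReal (Real.exp (ε / 2)) * svtNoise 1 ε T E := by
  have := isProbabilityMeasure_laplace (svtThresholdScale_pos hε)
  have := isProbabilityMeasure_laplace (svtQueryScale_pos hε)
  have h : |(1 : ℝ)| / svtThresholdScale ε = ε / 2 := by
    rw [svtThresholdScale, abs_one, one_div_one_div]
  rw [← h]
  exact prod_preimage_map_id_le (measurable_add_const 1) ENNReal.ofReal_ne_top
    (fun A hA => laplace_preimage_add_le (svtThresholdScale_pos hε) 1 hA) hE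

/-- The threshold noise has scale `2 / ε` and is moved by `1`, the query noise has scale `4 / ε` and
is moved by `2`; each translation costs `ε / 2`. -/
theorem svtNoise_shift_both {ε : ℝ} (hε : 0 < ε) {T : ℕ} (n : Fin T)
    {E : Set (ℝ × (Fin T → ℝ))} (hE : MeasurableSet E) :
    svtNoise 1 ε T {z | (z.1 + 1, Function.update z.2 n (z.2 n + 2)) ∈ E} ≤
      ENNReal.ofReal (Real.exp ε) * svtNoise 1 ε T E := by
  have := isProbabilityMeasure_laplace (svtThresholdScale_pos hε)
  have := isProbabilityMeasure_laplace (svtQueryScale_pos hε)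
  have h : |(2 : ℝ)| / svtQueryScale 1 ε = ε / 2 := by
    rw [svtQueryScale, abs_two]
    field_simp
    norm_num
  have hm := measurable_update_add n 2
  have h1 : svtNoise 1 ε T (Prod.map id (fun z => Function.update z n (z n + 2)) ⁻¹' E) ≤
      ENNReal.ofReal (Real.exp (ε / 2)) * svtNoise 1 ε T E := by
    rw [← h]
    exact prod_preimage_id_map_le hm ENNReal.ofReal_ne_top
      (fun A hA => pi_laplace_preimage_update_le (svtQueryScale_pos hε) n 2 hA) hE
  refine (svtNoise_shift_threshold hε ((measurable_id.prodMap hm) hE)).trans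
    ((mul_le_mul_right h1 _).trans ?_)
  rw [← mul_assoc, ← ENNReal.ofReal_mul (Real.exp_nonneg _), ← Real.exp_add, add_halves]

/-- The noise for which the noisy query at `s` stays below the noisy threshold. -/
def svtBelow {T : ℕ} (τ : ℝ) (q : Fin T → ℝ) (z : ℝ × (Fin T → ℝ)) (s : Fin T) : Prop :=
  q s + z.2 s < τ + z.1

theorem measurableSet_svtBelow {T : ℕ} (τ : ℝ) (q : Fin T → ℝ) (s : Fin T) :
    MeasurableSet {z | svtBelow τ q z s} :=
  measurableSet_lt (((measurable_pi_apply s).comp measurable_snd).const_add _)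
    (measurable_fst.const_add _)

/-- The noise for which the first query not below the threshold, or `k` if that is earlier, comes
at time `n`. -/
def svtStop {T : ℕ} (τ : ℝ) (q : Fin T → ℝ) (k n : ℕ) : Set (ℝ × (Fin T → ℝ)) :=
  {z | (∀ s : Fin T, (s : ℕ) < n → svtBelow τ q z s) ∧
    ∀ s : Fin T, (s : ℕ) = n → n < k → ¬ svtBelow τ q z s}

theorem measurableSet_svtStop {T : ℕ} (τ : ℝ) (q : Fin T → ℝ) (k n : ℕ) :
    MeasurableSet (svtStop τ q k n) := by
  have h : svtStop τ q k n = (⋂ s : Fin T, ⋂ _ : (s : ℕ) < n, {z | svtBelow τ q z s}) ∩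
      ⋂ s : Fin T, ⋂ _ : (s : ℕ) = n, ⋂ _ : n < k, {z | svtBelow τ q z s}ᶜ := by
    ext z
    simp [svtStop]
  rw [h]
  exact (MeasurableSet.iInter fun s => MeasurableSet.iInter fun _ =>
    measurableSet_svtBelow τ q s).inter (MeasurableSet.iInter fun s => MeasurableSet.iInter fun _ =>
      MeasurableSet.iInter fun _ => (measurableSet_svtBelow τ q s).compl)

theorem svtStop_disjoint {T : ℕ} (τ : ℝ) (q : Fin T → ℝ) {k m n : ℕ} (hk : k ≤ T) (hmn : m < n)
    (hn : n ≤ k) : Disjoint (svtStop τ q k m) (svtStop τ q k n) := by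
  rw [Set.disjoint_left]
  intro z h1 h2
  exact h1.2 ⟨m, by omega⟩ rfl (by omega) (h2.1 ⟨m, by omega⟩ hmn)

theorem exists_mem_svtStop {T : ℕ} (τ : ℝ) (q : Fin T → ℝ) (k : ℕ) (z : ℝ × (Fin T → ℝ)) :
    ∃ n ≤ k, z ∈ svtStop τ q k n := by
  classical
  by_cases h : ∃ n, n < k ∧ ∃ s : Fin T, (s : ℕ) = n ∧ ¬ svtBelow τ q z s
  · obtain ⟨h1, s, hs, h2⟩ := Nat.find_spec h
    refine ⟨Nat.find h, h1.le, fun s' hs' => ?_, fun s' hs' _ => ?_⟩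
    · by_contra h'
      exact Nat.find_min h hs' ⟨hs'.trans h1, s', rfl, h'⟩
    · rwa [Fin.ext (hs'.trans hs.symm)]
  · push Not at h
    exact ⟨k, le_rfl, fun s hs => h s hs s rfl, fun s _ hk => absurd hk (lt_irrefl k)⟩

theorem sum_svtStop_le {T : ℕ} {ε : ℝ} (hε : 0 < ε) (τ : ℝ) (q : Fin T → ℝ) {k : ℕ} (hk : k ≤ T) :
    ∑ n ∈ Finset.range (k + 1), svtNoise 1 ε T (svtStop τ q k n) ≤ 1 := by
  have := isProbabilityMeasure_svtNoise hε T
  rw [← measure_biUnion_finset]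
  · exact prob_le_one
  · intro m hm n hn hmn
    simp only [Finset.coe_range, Set.mem_Iio] at hm hn
    rcases lt_or_gt_of_ne hmn with h | h
    · exact svtStop_disjoint τ q hk h (by omega)
    · exact (svtStop_disjoint τ q hk h (by omega)).symm
  · exact fun n _ => measurableSet_svtStop τ q k n

/-- Privacy of the stopping time of sparse vector. -/
theorem svtNoise_svtStop_le {T : ℕ} {ε : ℝ} (hε : 0 < ε) (τ : ℝ) {q q' : Fin T → ℝ}
    (hq : ∀ s, |q s - q' s| ≤ 1) (k n : ℕ) :
    svtNoise 1 ε T (svtStop τ q k n) ≤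
      ENNReal.ofReal (Real.exp ε) * svtNoise 1 ε T (svtStop τ q' k n) := by
  -- If stopping at `n` requires a query above the threshold, raising the threshold by `1` keeps the
  -- earlier queries below it for `q'`, and raising the noise at `n` by `2` makes up for this and
  -- for the change of the query. Otherwise only the earlier queries matter, and the threshold alone
  -- is raised.
  by_cases hn : n < k ∧ n < T
  · refine (measure_mono ?_).trans
      (svtNoise_shift_both hε ⟨n, hn.2⟩ (measurableSet_svtStop τ q' k n))
    rintro z ⟨h1, h2⟩
    refine ⟨fun s hs => ?_, fun s hs hk => ?_⟩
    · have h3 := h1 s hs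
      have h4 := abs_le.1 (hq s)
      have hne : s ≠ ⟨n, hn.2⟩ := fun h => by simp [h] at hs
      unfold svtBelow at h3 ⊢
      simp only [Function.update_of_ne hne]
      linarith
    · have h3 := h2 s hs hk
      have h4 := abs_le.1 (hq s)
      obtain rfl : s = ⟨n, hn.2⟩ := Fin.ext hs
      unfold svtBelow at h3 ⊢
      simp only [Function.update_self]
      linarith
  · refine (measure_mono ?_).trans ((svtNoise_shift_threshold hε
      (measurableSet_svtStop τ q' k n)).trans (mul_le_mul_left (ENNReal.ofReal_le_ofReal
        (Real.exp_le_exp.2 (by linarith))) _))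
    rintro z ⟨h1, h2⟩
    refine ⟨fun s hs => ?_, fun s hs hk => absurd ⟨hk, hs ▸ s.2⟩ hn⟩
    have h3 := h1 s hs
    have h4 := abs_le.1 (hq s)
    unfold svtBelow at h3 ⊢
    simp only
    linarith

/-- The radius `4 * L / ε` is that of the query tails, where it is exactly `L` scales. For the
threshold noise it is `2 * L` scales, so the bound is not sharp here, but both noises share one
form. -/
theorem svtNoise_threshold_tail {ε : ℝ} (hε : 0 < ε) {T : ℕ} {L : ℝ} (hL : 0 ≤ L) :
    svtNoise 1 ε T {z | z.1 ≤ -(4 * L / ε)} ≤ ENNReal.ofReal (Real.exp (-L) / 2) ∧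
    svtNoise 1 ε T {z | 4 * L / ε < z.1} ≤ ENNReal.ofReal (Real.exp (-L) / 2) := by
  have h4 : 0 ≤ 4 * L / ε := by positivity
  have h5 : -(4 * L / ε) / svtThresholdScale ε ≤ -L := by
    rw [svtThresholdScale, div_div_eq_mul_div, div_one]
    have : -(4 * L / ε) * (ε / 2) = -(2 * L) := by field_simp; ring
    linarith
  constructor
  · refine (svtNoise_fst hε measurableSet_Iic).le.trans ?_
    rw [laplace_Iic (svtThresholdScale_pos hε) (by linarith)]
    gcongr
  · refine (svtNoise_fst hε measurableSet_Ioi).le.trans ?_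
    rw [laplace_Ioi (svtThresholdScale_pos hε) h4]
    gcongr

theorem svtNoise_query_tail {ε : ℝ} (hε : 0 < ε) {T : ℕ} (t : Fin T) {L : ℝ} (hL : 0 ≤ L) :
    svtNoise 1 ε T {z | 4 * L / ε ≤ z.2 t} ≤ ENNReal.ofReal (Real.exp (-L) / 2) ∧
    svtNoise 1 ε T {z | z.2 t ≤ -(4 * L / ε)} ≤ ENNReal.ofReal (Real.exp (-L) / 2) := by
  have h4 : 0 ≤ 4 * L / ε := by positivity
  have h5 : -(4 * L / ε) / svtQueryScale 1 ε = -L := by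
    rw [svtQueryScale]
    field_simp
    norm_num
    ring
  constructor
  · refine (svtNoise_snd hε t measurableSet_Ici).le.trans ?_
    rw [laplace_Ici (svtQueryScale_pos hε) h4, h5]
  · refine (svtNoise_snd hε t measurableSet_Iic).le.trans ?_
    rw [laplace_Iic (svtQueryScale_pos hε) (by linarith), h5]

theorem exp_neg_log_one_div {x : ℝ} (hx : 0 < x) : Real.exp (-Real.log (1 / x)) = x := by
  rw [one_div, Real.log_inv, neg_neg, Real.exp_log hx]

/-- A query with value `0` is not below the threshold, except with probability `β`. -/
theorem svtNoise_below_le {T : ℕ} {ε β : ℝ} (hε : 0 < ε) (hβ : 0 < β) (hβ1 : β ≤ 1)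
    {q : Fin T → ℝ} {k : Fin T} (hq : q k = 0) :
    svtNoise 1 ε T {z | svtBelow (bbThreshold ε β) q z k} ≤ ENNReal.ofReal β := by
  set L := Real.log (1 / β) with hLdef
  have hL : 0 ≤ L := Real.log_nonneg (by rw [le_div_iff₀ hβ]; linarith)
  -- The threshold is `-8 * L / ε`. For a query `0` to stay below it, the threshold noise must
  -- exceed the query noise by more than `8 * L / ε`, so one of the two deviates by `4 * L / ε`.
  -- Each tail contributes at most `β / 2`.
  have hsub : {z | svtBelow (bbThreshold ε β) q z k} ⊆
      {z | 4 * L / ε < z.1} ∪ {z | z.2 k ≤ -(4 * L / ε)} := by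
    intro z hz
    by_contra h
    simp only [Set.mem_union, Set.mem_ofPred_eq, not_or, not_lt, not_le] at h hz
    unfold svtBelow bbThreshold at hz
    rw [hq, ← hLdef] at hz
    have : -8 * L / ε = -(4 * L / ε) - 4 * L / ε := by ring
    linarith [h.1, h.2]
  refine (measure_mono hsub).trans ((measure_union_le _ _).trans
    ((add_le_add (svtNoise_threshold_tail hε hL).2 (svtNoise_query_tail hε k hL).2).trans ?_))
  rw [← ENNReal.ofReal_add (by positivity) (by positivity), add_halves,
    exp_neg_log_one_div hβ]

/-- A query with value at least `-1` is not below the threshold, except with probability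
`exp ε * β`. -/
theorem svtNoise_below_le_exp {T : ℕ} {ε β : ℝ} (hε : 0 < ε) (hβ : 0 < β) (hβ1 : β ≤ 1)
    {q : Fin T → ℝ} {k : Fin T} (hq : -1 ≤ q k) :
    svtNoise 1 ε T {z | svtBelow (bbThreshold ε β) q z k} ≤ ENNReal.ofReal (Real.exp ε * β) := by
  have h0 := svtNoise_below_le (T := T) hε hβ hβ1 (q := fun _ => 0) (k := k) rfl
  -- A query lower by at most `1` is compensated by threshold noise higher by `1`, which reduces
  -- this to the query `0`. The translation costs only `exp (ε / 2)`.
  have hsub : {z | svtBelow (bbThreshold ε β) q z k} ⊆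
      {z | (z.1 + 1, z.2) ∈ {z | svtBelow (bbThreshold ε β) (fun _ : Fin T => (0 : ℝ)) z k}} := by
    intro z hz
    simp only [Set.mem_ofPred_eq, svtBelow] at hz ⊢
    linarith
  refine (measure_mono hsub).trans
    ((svtNoise_shift_threshold hε (measurableSet_svtBelow _ _ _)).trans ?_)
  rw [ENNReal.ofReal_mul (Real.exp_nonneg _)]
  refine mul_le_mul' (ENNReal.ofReal_le_ofReal (Real.exp_le_exp.2 (by linarith))) h0

/-- Queries with values at most `-a` stay below the threshold with probability `1 - β`, if `a` is
large enough. -/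
theorem le_svtNoise_below {T : ℕ} (hT : 1 ≤ T) {ε β βTest a : ℝ} (hε : 0 < ε) (hβ : 0 < β)
    (hβ1 : β ≤ 1) (hβT : 0 < βTest) (ha : 8 * Real.log (T / (β * βTest)) / ε ≤ a)
    {q : Fin T → ℝ} {t' : Fin T} (hq : ∀ s ≤ t', q s ≤ -a) :
    ENNReal.ofReal (1 - β) ≤
      svtNoise 1 ε T {z | ∀ s ≤ t', svtBelow (bbThreshold ε βTest) q z s} := by
  have := isProbabilityMeasure_svtNoise hε T
  have hT' : (1 : ℝ) ≤ T := by exact_mod_cast hT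
  set L := Real.log (T / β) with hLdef
  have hL : 0 ≤ L := Real.log_nonneg (by rw [le_div_iff₀ hβ]; linarith)
  have hexp : Real.exp (-L) = β / T := by
    rw [hLdef, ← Real.log_inv, Real.exp_log (by positivity), inv_div]
  -- The logarithm splits into `log (T / β)` and `log (1 / βTest)`. The second part offsets the
  -- negative threshold, and the first leaves a margin of `4 * L / ε` for each of the two noises.
  have hsum : 8 * L / ε ≤ a + bbThreshold ε βTest := by
    have : Real.log (T / (β * βTest)) = L + Real.log (1 / βTest) := by
      rw [hLdef, ← Real.log_mul (by positivity) (by positivity)]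
      congr 1
      field_simp
    rw [this] at ha
    unfold bbThreshold
    have h3 : 8 * (L + Real.log (1 / βTest)) / ε = 8 * L / ε - -8 * Real.log (1 / βTest) / ε := by
      ring
    linarith
  set bad : Set (ℝ × (Fin T → ℝ)) :=
    {z | z.1 ≤ -(4 * L / ε)} ∪ ⋃ s : Fin T, {z | 4 * L / ε ≤ z.2 s} with hbad
  have hmeas : MeasurableSet bad :=
    (measurable_fst measurableSet_Iic).union (MeasurableSet.iUnion fun s =>
      ((measurable_pi_apply s).comp measurable_snd) measurableSet_Ici)
  have hsub : badᶜ ⊆ {z | ∀ s ≤ t', svtBelow (bbThreshold ε βTest) q z s} := by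
    intro z hz s hs
    simp only [hbad, Set.mem_compl_iff, Set.mem_union, Set.mem_ofPred_eq, Set.mem_iUnion, not_or,
      not_le, not_exists] at hz
    have h1 := hz.2 s
    have h2 := hq s hs
    have : 8 * L / ε = 4 * L / ε + 4 * L / ε := by ring
    unfold svtBelow
    linarith [hz.1]
  have hP : svtNoise 1 ε T bad ≤ ENNReal.ofReal β := by
    refine (measure_union_le _ _).trans ((add_le_add (svtNoise_threshold_tail hε hL).1
      ((measure_iUnion_fintype_le _ _).trans
        (Finset.sum_le_sum fun s _ => (svtNoise_query_tail hε s hL).1))).trans ?_)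
    rw [Finset.sum_const, Finset.card_univ, Fintype.card_fin, nsmul_eq_mul, hexp,
      ← ENNReal.ofReal_natCast, ← ENNReal.ofReal_mul (by positivity),
      ← ENNReal.ofReal_add (by positivity) (by positivity)]
    -- The `T` queries contribute `β / 2` in total, and the threshold `β / T / 2`.
    refine ENNReal.ofReal_le_ofReal ?_
    have h6 : (T : ℝ) * (β / T / 2) = β / 2 := by field_simp
    have h7 : β / T ≤ β := div_le_self hβ.le hT'
    linarith
  refine le_trans ?_ (measure_mono hsub)
  rw [prob_compl_eq_one_sub hmeas, ENNReal.ofReal_sub _ hβ.le, ENNReal.ofReal_one]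
  exact tsub_le_tsub_left hP 1

theorem svtCount_eq_zero {T : ℕ} {c : ℕ} {τ : ℝ} {q : Fin T → ℝ} {z : ℝ × (Fin T → ℝ)} {t : ℕ}
    (h : ∀ s : Fin T, (s : ℕ) < t → svtBelow τ q z s) : svtCount c τ q z t = 0 := by
  induction t with
  | zero => rfl
  | succ t ih =>
    rw [svtCount, if_neg, ih fun s hs => h s (by omega)]
    rintro ⟨⟨ht, h'⟩, -⟩
    exact absurd (h ⟨t, ht⟩ (Nat.lt_succ_self t)) (not_lt.2 h')

/-- The test passes through time `t` exactly if all noisy queries stay below the threshold. -/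
theorem svt_forall_iff {T : ℕ} (τ : ℝ) (q : Fin T → ℝ) (z : ℝ × (Fin T → ℝ)) (t : Fin T) :
    (∀ s ≤ t, svt 1 τ q z s = true) ↔ ∀ s ≤ t, svtBelow τ q z s := by
  constructor
  · intro h s
    induction hs : (s : ℕ) using Nat.strong_induction_on generalizing s with
    | _ n ih =>
      subst hs
      intro hst
      have h1 := h s hst
      -- Before the first failure the counter is below the cutoff, so the verdict at `s` is the
      -- plain comparison.
      have h2 : svtCount 1 τ q z s = 0 := svtCount_eq_zero fun s' hs' =>
        ih s' hs' s' rfl (le_trans (le_of_lt hs') hst)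
      by_contra h3
      rw [svt, if_pos ⟨not_lt.1 h3, by rw [h2]; exact Nat.one_pos⟩] at h1
      exact Bool.false_ne_true h1
  · intro h s hs
    rw [svt, if_neg]
    exact fun h' => absurd (h s hs) (not_lt.2 h'.1)

/-! ## The projection, edge by edge -/

section EdgeOrder

variable {V : Type u} [LinearOrder V]

/-- The position of an edge in the order in which the edges of one time step are handled. -/
def edgeKey (e : Sym2 V) : V ×ₗ V := toLex (e.inf, e.sup)

theorem edgeKey_injective : Function.Injective (edgeKey (V := V)) := by
  intro e f h
  have h' := toLex.injective h
  exact Sym2.inf_eq_inf_and_sup_eq_sup.1 (Prod.ext_iff.1 h')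

theorem edgeKey_mk {p : V × V} (h : p.1 < p.2) : edgeKey s(p.1, p.2) = toLex p := by
  simp [edgeKey, h.le]

theorem sym2_mk_inf_sup (e : Sym2 V) : s(e.inf, e.sup) = e := by
  induction e with
  | _ a b =>
    rcases le_total a b with h | h
    · simp [h]
    · simp [h, Sym2.eq_swap]

theorem sym2_inf_lt_sup {e : Sym2 V} (h : ¬ e.IsDiag) : e.inf < e.sup := by
  refine lt_of_le_of_ne e.inf_le_sup fun h' => h ?_
  rw [← sym2_mk_inf_sup e, Sym2.mk_isDiag_iff]
  exact h'

/-- The set of edges in a list of pairs. -/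
def edgeSet (L : List (V × V)) : Finset (Sym2 V) := (L.map (fun p => s(p.1, p.2))).toFinset

theorem edgeSet_append (L L' : List (V × V)) : edgeSet (L ++ L') = edgeSet L ∪ edgeSet L' := by
  simp [edgeSet]

theorem mem_edgeSet {L : List (V × V)} {e : Sym2 V} :
    e ∈ edgeSet L ↔ ∃ p ∈ L, s(p.1, p.2) = e := by
  simp only [edgeSet, List.mem_toFinset, List.mem_map]

/-- Lists of edges as they are handed over: written with increasing endpoints, in increasing
lexicographic order. -/
def EdgeList (L : List (V × V)) : Prop :=
  (∀ p ∈ L, p.1 < p.2) ∧ L.Pairwise (fun p p' => toLex p < toLex p')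

theorem EdgeList.left {L L' : List (V × V)} (h : EdgeList (L ++ L')) : EdgeList L :=
  ⟨fun p hp => h.1 p (List.mem_append_left _ hp), (List.pairwise_append.1 h.2).1⟩

theorem edgeList_orderedEdges {E : Finset (Sym2 V)} (hE : ∀ e ∈ E, ¬ e.IsDiag) :
    EdgeList (orderedEdges E) := by
  constructor
  · intro p hp
    rw [orderedEdges, List.mem_map] at hp
    obtain ⟨q, hq, rfl⟩ := hp
    rw [Finset.mem_sort, Finset.mem_image] at hq
    obtain ⟨e, he, rfl⟩ := hq
    exact sym2_inf_lt_sup (hE e he)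
  · rw [orderedEdges, List.pairwise_map]
    exact (Finset.sortedLT_sort _).pairwise

theorem edgeSet_orderedEdges (E : Finset (Sym2 V)) : edgeSet (orderedEdges E) = E := by
  ext e
  rw [mem_edgeSet]
  simp only [orderedEdges, List.mem_map, Finset.mem_sort, Finset.mem_image]
  constructor
  · rintro ⟨p, ⟨q, ⟨f, hf, rfl⟩, rfl⟩, rfl⟩
    simpa [sym2_mk_inf_sup] using hf
  · intro he
    exact ⟨_, ⟨_, ⟨e, he, rfl⟩, rfl⟩, sym2_mk_inf_sup e⟩

theorem edgeList_new {L : List (V × V)} {p : V × V} (h : EdgeList (L ++ [p])) :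
    p.1 < p.2 ∧ ∀ f ∈ edgeSet L, edgeKey f < edgeKey s(p.1, p.2) := by
  have hp := h.1 p (by simp)
  refine ⟨hp, fun f hf => ?_⟩
  obtain ⟨q, hq, rfl⟩ := mem_edgeSet.1 hf
  rw [edgeKey_mk hp, edgeKey_mk (h.1 q (List.mem_append_left _ hq))]
  exact (List.pairwise_append.1 h.2).2.2 q hq p (by simp)

theorem edgeList_notMem {L : List (V × V)} {p : V × V} (h : EdgeList (L ++ [p])) :
    s(p.1, p.2) ∉ edgeSet L := fun h' => lt_irrefl _ ((edgeList_new h).2 _ h')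

theorem orderedEdges_length {E : Finset (Sym2 V)} : (orderedEdges E).length = E.card := by
  rw [orderedEdges, List.length_map, Finset.length_sort]
  exact Finset.card_image_of_injective E edgeKey_injective

open Classical in
/-- The projected edges of one time step with edges `E`, started with the counters `d`. -/
noncomputable def keptEdges (D : ℕ) (d : V → ℕ) (E : Finset (Sym2 V)) : Finset (Sym2 V) :=
  E.filter (fun e => ∀ y ∈ e, d y + (E.filter (fun f => edgeKey f < edgeKey e ∧ y ∈ f)).card < D)

-- The list is sorted by key, so the edges handled before `e` are those with a smaller key. This
-- replaces the sequential loop by a condition on each edge separately.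
open Classical in
theorem foldl_projEdge (D : ℕ) (d : V → ℕ) {L : List (V × V)} (hL : EdgeList L) :
    L.foldl (projEdge D) (d, ∅) =
      (fun y => d y + ((edgeSet L).filter (fun e => y ∈ e)).card, keptEdges D d (edgeSet L)) := by
  induction L using List.reverseRecOn with
  | nil => simp [edgeSet, keptEdges]
  | append_singleton L p ih =>
    obtain ⟨hp, hlt⟩ := edgeList_new hL
    have hnot := edgeList_notMem hL
    have hset : edgeSet (L ++ [p]) = insert s(p.1, p.2) (edgeSet L) := by
      rw [edgeSet_append, Finset.union_comm]
      simp [edgeSet]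
    rw [List.foldl_append, ih hL.left, List.foldl_cons, List.foldl_nil, projEdge, hset]
    refine Prod.ext (funext fun y => ?_) ?_
    · simp only [Finset.filter_insert]
      by_cases hy : y ∈ s(p.1, p.2)
      · rw [if_pos hy, if_pos (Sym2.mem_iff.1 hy),
          Finset.card_insert_of_notMem fun h => hnot (Finset.mem_filter.1 h).1, add_assoc]
      · rw [if_neg hy, if_neg fun h => hy (Sym2.mem_iff.2 h), add_zero]
    -- The new edge has the largest key: all old edges count for it, and it counts for none of them.
    · have hbefore : ∀ y, (insert s(p.1, p.2) (edgeSet L)).filter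
          (fun f => edgeKey f < edgeKey s(p.1, p.2) ∧ y ∈ f) =
          (edgeSet L).filter (fun f => y ∈ f) := by
        intro y
        ext f
        simp only [Finset.mem_filter, Finset.mem_insert]
        constructor
        · rintro ⟨rfl | h, h1, h2⟩
          · exact absurd h1 (lt_irrefl _)
          · exact ⟨h, h2⟩
        · rintro ⟨h, h2⟩
          exact ⟨Or.inr h, hlt f h, h2⟩
      have hold : ∀ e ∈ edgeSet L, ∀ y, (insert s(p.1, p.2) (edgeSet L)).filter
          (fun f => edgeKey f < edgeKey e ∧ y ∈ f) =
          (edgeSet L).filter (fun f => edgeKey f < edgeKey e ∧ y ∈ f) := by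
        intro e he y
        rw [Finset.filter_insert, if_neg fun h => lt_asymm h.1 (hlt e he)]
      have hk : (edgeSet L).filter (fun e => ∀ y ∈ e, d y + ((insert s(p.1, p.2)
          (edgeSet L)).filter (fun f => edgeKey f < edgeKey e ∧ y ∈ f)).card < D) =
          keptEdges D d (edgeSet L) := by
        refine Finset.filter_congr fun e he => ?_
        simp only [hold e he]
      have hr : keptEdges D d (insert s(p.1, p.2) (edgeSet L)) = if ∀ y ∈ s(p.1, p.2), d y +
          ((edgeSet L).filter (fun f => y ∈ f)).card < D then
            insert s(p.1, p.2) (keptEdges D d (edgeSet L)) else keptEdges D d (edgeSet L) := by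
        conv_lhs => rw [keptEdges, Finset.filter_insert, hk]
        simp only [hbefore]
      rw [hr]
      simp only [Sym2.mem_iff, forall_eq_or_imp, forall_eq]

/-- Resetting the counters of arriving nodes changes nothing, as these counters are still `0`. -/
theorem projArrival_eq (D : ℕ) (d : V → ℕ) {x : Arrival V} (hE : ∀ e ∈ x.2, ¬ e.IsDiag)
    (hd : ∀ y ∈ x.1, d y = 0) :
    projArrival D d x =
      (fun y => d y + (x.2.filter (fun e => y ∈ e)).card, keptEdges D d x.2) := by
  have : (fun y => if y ∈ x.1 then 0 else d y) = d := by
    funext y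
    split_ifs with h
    · exact (hd y h).symm
    · rfl
  rw [projArrival, this, foldl_projEdge D d (edgeList_orderedEdges hE), edgeSet_orderedEdges]

end EdgeOrder

/-! ### Prefix graphs of a stream. -/

namespace GraphStream

theorem length_toList {V : Type u} {T : ℕ} (S : GraphStream V T) : S.toList.length = T := by
  simp [toList]

theorem getElem_toList {V : Type u} {T : ℕ} (S : GraphStream V T) (t : Fin T)
    (h : (t : ℕ) < S.toList.length) : S.toList[(t : ℕ)] = (S.nodes t, S.edges t) := by
  simp [toList]

section Flat

variable {V : Type u} [DecidableEq V] {T : ℕ} (S : GraphStream V T)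

theorem mem_flat_edges {k : ℕ} {e : Sym2 V} :
    e ∈ (S.flat k).edges ↔ ∃ s : Fin T, (s : ℕ) < k ∧ e ∈ S.edges s := by
  simp [flat]

theorem mem_flat_verts {k : ℕ} {x : V} :
    x ∈ (S.flat k).verts ↔ ∃ s : Fin T, (s : ℕ) < k ∧ x ∈ S.nodes s := by
  simp [flat]

theorem flat_succ_edges (t : Fin T) :
    (S.flat (t + 1)).edges = (S.flat t).edges ∪ S.edges t := by
  ext e
  simp only [Finset.mem_union, mem_flat_edges]
  constructor
  · rintro ⟨s, hs, he⟩
    rcases Nat.lt_succ_iff_lt_or_eq.1 hs with h | h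
    · exact Or.inl ⟨s, h, he⟩
    · exact Or.inr (Fin.ext h ▸ he)
  · rintro (⟨s, hs, he⟩ | he)
    · exact ⟨s, by omega, he⟩
    · exact ⟨t, by omega, he⟩

theorem flat_succ_verts (t : Fin T) :
    (S.flat (t + 1)).verts = (S.flat t).verts ∪ S.nodes t := by
  ext e
  simp only [Finset.mem_union, mem_flat_verts]
  constructor
  · rintro ⟨s, hs, he⟩
    rcases Nat.lt_succ_iff_lt_or_eq.1 hs with h | h
    · exact Or.inl ⟨s, h, he⟩
    · exact Or.inr (Fin.ext h ▸ he)
  · rintro (⟨s, hs, he⟩ | he)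
    · exact ⟨s, by omega, he⟩
    · exact ⟨t, by omega, he⟩

theorem flat_edges_disjoint (t : Fin T) : Disjoint (S.flat t).edges (S.edges t) := by
  rw [Finset.disjoint_left]
  intro e he he'
  obtain ⟨s, hs, h⟩ := (S.mem_flat_edges).1 he
  exact Finset.disjoint_left.1 (S.edges_once s t fun h => by simp [h] at hs) h he'

theorem flat_verts_disjoint (t : Fin T) : Disjoint (S.flat t).verts (S.nodes t) := by
  rw [Finset.disjoint_left]
  intro e he he'
  obtain ⟨s, hs, h⟩ := (S.mem_flat_verts).1 he
  exact Finset.disjoint_left.1 (S.nodes_once s t fun h => by simp [h] at hs) h he'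

theorem degree_flat_succ (t : Fin T) (y : V) : (S.flat (t + 1)).degree y =
    (S.flat t).degree y + ((S.edges t).filter (fun e => y ∈ e)).card := by
  rw [FinGraph.degree, flat_succ_edges, Finset.filter_union, Finset.card_union_of_disjoint
    (Finset.disjoint_filter_filter (S.flat_edges_disjoint t))]
  rfl

theorem degree_eq_zero_of_notMem (G : FinGraph V) {y : V} (hy : y ∉ G.verts) :
    G.degree y = 0 := by
  rw [FinGraph.degree, Finset.card_eq_zero, Finset.filter_eq_empty_iff]
  exact fun e he hye => hy (G.endpoints e he y hye)

theorem flat_mono_edges {j k : ℕ} (h : j ≤ k) : (S.flat j).edges ⊆ (S.flat k).edges := by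
  intro e he
  obtain ⟨s, hs, h'⟩ := (S.mem_flat_edges).1 he
  exact (S.mem_flat_edges).2 ⟨s, by omega, h'⟩

theorem flat_mono_verts {j k : ℕ} (h : j ≤ k) : (S.flat j).verts ⊆ (S.flat k).verts := by
  intro e he
  obtain ⟨s, hs, h'⟩ := (S.mem_flat_verts).1 he
  exact (S.mem_flat_verts).2 ⟨s, by omega, h'⟩

theorem degree_flat_mono {j k : ℕ} (h : j ≤ k) (y : V) :
    (S.flat j).degree y ≤ (S.flat k).degree y :=
  Finset.card_le_card (Finset.filter_subset_filter _ (S.flat_mono_edges h))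

theorem flat_removeNode (x : V) (k : ℕ) : (S.removeNode x).flat k = (S.flat k).removeNode x := by
  ext y
  · simp only [mem_flat_verts, FinGraph.removeNode, removeNode, Finset.mem_erase]
    tauto
  · simp only [mem_flat_edges, FinGraph.removeNode, removeNode, Finset.mem_filter]
    tauto

theorem bounded_flat_mono {D ℓ j k : ℕ} (h : j ≤ k) (hb : (S.flat k).Bounded D ℓ) :
    (S.flat j).Bounded D ℓ := by
  refine (Finset.card_le_card fun y hy => ?_).trans hb
  rw [FinGraph.highDegree, Finset.mem_filter] at hy ⊢
  exact ⟨S.flat_mono_verts h hy.1, hy.2.trans_le (S.degree_flat_mono h y)⟩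

end Flat

/-! ### The projected stream, and how it changes when a node is removed. -/

section Projection

variable {V : Type u} [LinearOrder V] {T : ℕ} (S : GraphStream V T)

/-- The edges passed on by the projection at time `t`. -/
noncomputable def kept (D : ℕ) (t : Fin T) : Finset (Sym2 V) :=
  keptEdges D (S.flat t).degree (S.edges t)

/-- Edges that are not passed on are counted as well, so the counters are the degrees in the
original prefix graph. -/
theorem projArrival_flat (D : ℕ) (t : Fin T) :
    projArrival D (S.flat t).degree (S.nodes t, S.edges t) =
      ((S.flat (t + 1)).degree, S.kept D t) := by
  rw [projArrival_eq D _ (S.no_loops t) fun y hy => degree_eq_zero_of_notMem _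
    (Finset.disjoint_right.1 (S.flat_verts_disjoint t) hy)]
  refine Prod.ext (funext fun y => (S.degree_flat_succ t y).symm) rfl

theorem proj_toList (D : ℕ) :
    proj D S.toList = List.ofFn (fun t => (S.nodes t, S.kept D t)) := by
  -- `projFrom` consumes the list from the front with changing counters, hence the induction on the
  -- length `j` of the remaining suffix.
  have key : ∀ j ≤ T, projFrom D (S.flat (T - j)).degree (S.toList.drop (T - j)) =
      (List.ofFn (fun t => (S.nodes t, S.kept D t))).drop (T - j) := by
    intro j
    induction j with
    | zero =>
      intro _
      rw [Nat.sub_zero, List.drop_of_length_le (by simp [toList]),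
        List.drop_of_length_le (by simp), projFrom]
    | succ j ih =>
      intro hj
      have hlt : T - (j + 1) < T := by omega
      set t : Fin T := ⟨T - (j + 1), hlt⟩ with ht
      have hsucc : T - j = (t : ℕ) + 1 := by simp only [ht]; omega
      have ih' := ih (by omega)
      rw [hsucc] at ih'
      have h1 : S.toList.drop t = (S.nodes t, S.edges t) :: S.toList.drop (t + 1) := by
        rw [List.drop_eq_getElem_cons (by rw [length_toList]; exact t.2), getElem_toList]
      have h2 : (List.ofFn (fun t => (S.nodes t, S.kept D t))).drop t =
          (S.nodes t, S.kept D t) ::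
            (List.ofFn (fun t => (S.nodes t, S.kept D t))).drop (t + 1) := by
        rw [List.drop_eq_getElem_cons (by simp)]
        simp
      change projFrom D (S.flat t).degree (S.toList.drop t) = List.drop t _
      rw [h1, h2, projFrom, projArrival_flat, ih']
  have h := key T le_rfl
  simp only [Nat.sub_self, List.drop_zero] at h
  rw [← h, proj]
  congr 1
  funext y
  simp [flat, FinGraph.degree]

open Classical in
/-- The edges handled before `e` at time `t`. -/
noncomputable def before (t : Fin T) (e : Sym2 V) : Finset (Sym2 V) :=
  (S.flat t).edges ∪ (S.edges t).filter (fun f => edgeKey f < edgeKey e)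

/-- The number of edges at `y` that were handled before `e` at time `t`. -/
noncomputable def seen (t : Fin T) (e : Sym2 V) (y : V) : ℕ :=
  ((S.before t e).filter (fun f => y ∈ f)).card

theorem seen_eq (t : Fin T) (e : Sym2 V) (y : V) : S.seen t e y = (S.flat t).degree y +
    ((S.edges t).filter (fun f => edgeKey f < edgeKey e ∧ y ∈ f)).card := by
  rw [seen, before, Finset.filter_union, Finset.card_union_of_disjoint]
  · rw [Finset.filter_filter]
    rfl
  · exact Finset.disjoint_filter_filter
      ((S.flat_edges_disjoint t).mono_right (Finset.filter_subset _ _))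

theorem mem_kept {D : ℕ} {t : Fin T} {e : Sym2 V} :
    e ∈ S.kept D t ↔ e ∈ S.edges t ∧ ∀ y ∈ e, S.seen t e y < D := by
  simp only [kept, keptEdges, Finset.mem_filter, seen_eq]

theorem kept_subset (D : ℕ) (t : Fin T) : S.kept D t ⊆ S.edges t :=
  fun _ he => (S.mem_kept.1 he).1

theorem notMem_before {t : Fin T} {e : Sym2 V} (he : e ∈ S.edges t) : e ∉ S.before t e := by
  intro h
  rcases Finset.mem_union.1 h with h | h
  · exact Finset.disjoint_left.1 (S.flat_edges_disjoint t) h he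
  · exact lt_irrefl _ (Finset.mem_filter.1 h).2

/-- The edges are handled one after the other. -/
theorem before_trichotomy {t t' : Fin T} {e e' : Sym2 V} (he : e ∈ S.edges t)
    (he' : e' ∈ S.edges t') : e = e' ∨ insert e (S.before t e) ⊆ S.before t' e' ∨
      insert e' (S.before t' e') ⊆ S.before t e := by
  have key : ∀ {t t' : Fin T} {e e' : Sym2 V}, e ∈ S.edges t → t < t' →
      insert e (S.before t e) ⊆ S.before t' e' := by
    intro t t' e e' he htt f hf
    refine Finset.mem_union_left _ ((S.mem_flat_edges).2 ?_)
    rcases Finset.mem_insert.1 hf with rfl | hf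
    · exact ⟨t, htt, he⟩
    rcases Finset.mem_union.1 hf with hf | hf
    · obtain ⟨s, hs, h⟩ := (S.mem_flat_edges).1 hf
      exact ⟨s, hs.trans htt, h⟩
    · exact ⟨t, htt, (Finset.mem_filter.1 hf).1⟩
  have key' : ∀ {t : Fin T} {e e' : Sym2 V}, e ∈ S.edges t → edgeKey e < edgeKey e' →
      insert e (S.before t e) ⊆ S.before t e' := by
    intro t e e' he hlt f hf
    rcases Finset.mem_insert.1 hf with rfl | hf
    · exact Finset.mem_union_right _ (Finset.mem_filter.2 ⟨he, hlt⟩)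
    rcases Finset.mem_union.1 hf with hf | hf
    · exact Finset.mem_union_left _ hf
    · rw [Finset.mem_filter] at hf
      exact Finset.mem_union_right _ (Finset.mem_filter.2 ⟨hf.1, hf.2.trans hlt⟩)
  rcases lt_trichotomy t t' with h | rfl | h
  · exact Or.inr (Or.inl (key he h))
  · rcases lt_trichotomy (edgeKey e) (edgeKey e') with h | h | h
    · exact Or.inr (Or.inl (key' he h))
    · exact Or.inl (edgeKey_injective h)
    · exact Or.inr (Or.inr (key' he' h))
  · exact Or.inr (Or.inr (key he' h))

theorem seen_lt_of_subset {t t' : Fin T} {e e' : Sym2 V} {y : V} (he : e ∈ S.edges t) (hy : y ∈ e)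
    (h : insert e (S.before t e) ⊆ S.before t' e') : S.seen t e y < S.seen t' e' y := by
  have h1 := Finset.card_le_card (Finset.filter_subset_filter (fun f => y ∈ f) h)
  rw [Finset.filter_insert, if_pos hy, Finset.card_insert_of_notMem
    fun h => S.notMem_before he (Finset.mem_filter.1 h).1] at h1
  exact h1

/-- Edges at `y` are determined by the number of edges at `y` handled before. -/
theorem eq_of_seen_eq {t t' : Fin T} {e e' : Sym2 V} {y : V} (he : e ∈ S.edges t)
    (he' : e' ∈ S.edges t') (hy : y ∈ e) (hy' : y ∈ e') (h : S.seen t e y = S.seen t' e' y) :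
    e = e' := by
  rcases S.before_trichotomy he he' with h1 | h1 | h1
  · exact h1
  · exact absurd h (S.seen_lt_of_subset he hy h1).ne
  · exact absurd h (S.seen_lt_of_subset he' hy' h1).ne'

/-- The projected stream up to time `k`, followed by nothing. -/
noncomputable def projStream (D k : ℕ) : GraphStream V T where
  nodes := fun t => if (t : ℕ) < k then S.nodes t else ∅
  edges := fun t => if (t : ℕ) < k then S.kept D t else ∅
  nodes_once := by
    intro s t hst
    split_ifs <;> simp [S.nodes_once s t hst]
  edges_once := by
    intro s t hst
    have := (S.edges_once s t hst).mono (S.kept_subset D s) (S.kept_subset D t)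
    split_ifs <;> simp [this]
  no_loops := by
    intro t e he
    split_ifs at he
    · exact S.no_loops t e (S.kept_subset D t he)
    · simp at he
  endpoints := by
    intro t e he x hx
    split_ifs at he with ht
    · obtain ⟨s, hs, h⟩ := S.endpoints t e (S.kept_subset D t he) x hx
      exact ⟨s, hs, by rwa [if_pos (lt_of_le_of_lt (Fin.le_def.1 hs) ht)]⟩
    · simp at he

theorem mem_projStream_edges {D k : ℕ} {t : Fin T} {e : Sym2 V} :
    e ∈ (S.projStream D k).edges t ↔ (t : ℕ) < k ∧ e ∈ S.kept D t := by
  simp only [projStream]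
  split_ifs with h <;> simp [h]

/-- Answers through time `k` do not see the truncation. Privacy can thus be applied to a stream of
full length whose projection is only controlled through time `k`. -/
theorem take_projStream (D : ℕ) {j k : ℕ} (h : j ≤ k) :
    (S.projStream D k).toList.take j = (proj D S.toList).take j := by
  rw [proj_toList, toList]
  refine List.ext_getElem (by simp) fun i h1 h2 => ?_
  have hi : i < k := by simp at h1; omega
  simp [projStream, hi]

/-- The edges kept at `y` have different values of `seen` at `y`, all of them less than `D`. -/
theorem maxDegreeLE_projStream (D k : ℕ) : (S.projStream D k).MaxDegreeLE D := by
  intro y _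
  refine le_of_le_of_eq (Finset.card_le_card_of_forall_subsingleton
    (t := Finset.range D) (fun e j => ∃ t, e ∈ S.kept D t ∧ S.seen t e y = j) ?_ ?_)
    (Finset.card_range D)
  · intro e he
    rw [Finset.mem_filter, mem_flat_edges] at he
    obtain ⟨⟨t, -, ht⟩, hy⟩ := he
    rw [mem_projStream_edges] at ht
    exact ⟨_, Finset.mem_range.2 ((S.mem_kept.1 ht.2).2 y hy), t, ht.2, rfl⟩
  · rintro j - e ⟨he, t, ht, h⟩ e' ⟨he', t', ht', h'⟩
    exact S.eq_of_seen_eq (S.kept_subset D t ht) (S.kept_subset D t' ht')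
      (Finset.mem_filter.1 he).2 (Finset.mem_filter.1 he').2 (h.trans h'.symm)

theorem before_removeNode (x : V) (t : Fin T) (e : Sym2 V) :
    (S.removeNode x).before t e = (S.before t e).filter (fun f => x ∉ f) := by
  ext f
  rw [before, before, flat_removeNode]
  simp only [FinGraph.removeNode, removeNode, Finset.mem_union, Finset.mem_filter]
  tauto

theorem seen_removeNode_le (x : V) (t : Fin T) (e : Sym2 V) (y : V) :
    (S.removeNode x).seen t e y ≤ S.seen t e y := by
  rw [seen, seen, before_removeNode]
  exact Finset.card_le_card (Finset.filter_subset_filter _ (Finset.filter_subset _ _))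

/-- Of the edges at `y`, only the one joining it to `x` can disappear. -/
theorem seen_le_removeNode (x : V) (t : Fin T) (e : Sym2 V) {y : V} (hy : y ≠ x) :
    S.seen t e y ≤ (S.removeNode x).seen t e y + 1 := by
  rw [seen, seen, before_removeNode]
  refine (Finset.card_le_card (t := insert s(x, y)
    (((S.before t e).filter (fun f => x ∉ f)).filter (fun f => y ∈ f))) fun f hf => ?_).trans
    (Finset.card_insert_le _ _)
  rw [Finset.mem_filter] at hf
  by_cases hx : x ∈ f
  · exact Finset.mem_insert.2 (Or.inl ((Sym2.mem_and_mem_iff hy.symm).1 ⟨hx, hf.2⟩))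
  · exact Finset.mem_insert_of_mem (Finset.mem_filter.2 ⟨Finset.mem_filter.2 ⟨hf.1, hx⟩, hf.2⟩)

theorem projStream_removeNode_nodes (x : V) (D k : ℕ) :
    ((S.projStream D k).removeNode x).nodes = ((S.removeNode x).projStream D k).nodes := by
  funext t
  simp only [removeNode, projStream]
  split_ifs <;> simp

/-- Removing `x` only lowers counters, so every kept edge that avoids `x` is still kept. -/
theorem projStream_removeNode_edges_subset (x : V) (D k : ℕ) (t : Fin T) :
    ((S.projStream D k).removeNode x).edges t ⊆ ((S.removeNode x).projStream D k).edges t := by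
  intro e he
  have he' := Finset.mem_filter.1 he
  rw [mem_projStream_edges] at he' ⊢
  obtain ⟨⟨hk, hkept⟩, hx⟩ := he'
  rw [mem_kept] at hkept ⊢
  exact ⟨hk, Finset.mem_filter.2 ⟨hkept.1, hx⟩, fun y hy =>
    (S.seen_removeNode_le x t e y).trans_lt (hkept.2 y hy)⟩

theorem seen_lt_degree {t : Fin T} {e : Sym2 V} (he : e ∈ S.edges t) {y : V} (hy : y ∈ e) {k : ℕ}
    (hk : (t : ℕ) < k) : S.seen t e y < (S.flat k).degree y := by
  rw [seen, Nat.lt_iff_add_one_le, ← Finset.card_insert_of_notMem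
    (fun h => S.notMem_before he (Finset.mem_filter.1 h).1)]
  refine Finset.card_le_card fun f hf => ?_
  rw [Finset.mem_filter, mem_flat_edges]
  rcases Finset.mem_insert.1 hf with rfl | hf
  · exact ⟨⟨t, hk, he⟩, hy⟩
  · rw [Finset.mem_filter] at hf
    refine ⟨?_, hf.2⟩
    rcases Finset.mem_union.1 hf.1 with h | h
    · obtain ⟨s, hs, h⟩ := (S.mem_flat_edges).1 h
      exact ⟨s, by omega, h⟩
    · exact ⟨t, hk, (Finset.mem_filter.1 h).1⟩

/-- Every edge that is passed on only after the removal of `x` is charged to a node of high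
degree. -/
theorem card_new_edges_le (x : V) (D k : ℕ) :
    ((((S.removeNode x).projStream D k).flat T).edges \
      (((S.projStream D k).removeNode x).flat T).edges).card ≤
        ((S.flat k).highDegree D).card := by
  -- A new edge is charged to an endpoint `y` that blocked it in `S`. There the counter was at least
  -- `D`, is now less than `D`, and fell by at most one, so it is now `D - 1`. This value determines
  -- the edge, so `y` is charged once; and the edge itself brings the degree of `y` in `S` above
  -- `D`.
  refine Finset.card_le_card_of_forall_subsingleton (fun e y => y ∈ e ∧ ∃ t : Fin T,
    e ∈ (S.removeNode x).edges t ∧ (S.removeNode x).seen t e y + 1 = D) ?_ ?_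
  · intro e he
    rw [Finset.mem_sdiff, mem_flat_edges, mem_flat_edges] at he
    obtain ⟨⟨t, htT, ht⟩, hn⟩ := he
    rw [mem_projStream_edges, mem_kept] at ht
    obtain ⟨hk, heS', hlt⟩ := ht
    have heS := Finset.mem_filter.1 heS'
    obtain ⟨y, hy, hD⟩ : ∃ y ∈ e, D ≤ S.seen t e y := by
      by_contra! hcon
      refine hn ⟨t, htT, Finset.mem_filter.2 ⟨?_, heS.2⟩⟩
      rw [mem_projStream_edges, mem_kept]
      exact ⟨hk, heS.1, hcon⟩
    have hyx : y ≠ x := fun h => heS.2 (h ▸ hy)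
    have h1 := S.seen_le_removeNode x t e hyx
    have h2 := hlt y hy
    refine ⟨y, Finset.mem_filter.2 ⟨?_, hD.trans_lt (S.seen_lt_degree heS.1 hy hk)⟩, hy, t, heS',
      by omega⟩
    exact (S.flat k).endpoints e ((S.mem_flat_edges).2 ⟨t, hk, heS.1⟩) y hy
  · rintro y - e ⟨-, hy, t, he, h⟩ e' ⟨-, hy', t', he', h'⟩
    exact (S.removeNode x).eq_of_seen_eq he he' hy hy' (by omega)

end Projection

end GraphStream

/-! ## Group privacy -/

theorem Indist.symm {Ω : Type v} {Z : Type w} [MeasurableSpace Ω] [MeasurableSpace Z]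
    {P : Measure Ω} {ε δ : ℝ} {X X' : Ω → Z} (h : Indist P ε δ X X') : Indist P ε δ X' X :=
  fun B hB => (h B hB).symm

theorem Indist.mono {Ω : Type v} {Z : Type w} [MeasurableSpace Ω] [MeasurableSpace Z]
    {P : Measure Ω} {ε δ ε₁ δ₁ : ℝ} {X X' : Ω → Z} (h : Indist P ε δ X X') (hε : ε ≤ ε₁)
    (hδ : δ ≤ δ₁) : Indist P ε₁ δ₁ X X' := fun B hB =>
  ⟨(h B hB).1.trans (add_le_add (mul_le_mul_left (ENNReal.ofReal_le_ofReal
      (Real.exp_le_exp.2 hε)) _) (ENNReal.ofReal_le_ofReal hδ)),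
    (h B hB).2.trans (add_le_add (mul_le_mul_left (ENNReal.ofReal_le_ofReal
      (Real.exp_le_exp.2 hε)) _) (ENNReal.ofReal_le_ofReal hδ))⟩

/-- The guarantee of `(ε, δ)`-indistinguishability for `k` successive steps. -/
def GroupIndist {Ω : Type v} {Z : Type w} [MeasurableSpace Ω] [MeasurableSpace Z] (P : Measure Ω)
    (ε δ : ℝ) (k : ℕ) (X X' : Ω → Z) : Prop :=
  Indist P (ε * k) (δ * Real.exp (ε * k) * k) X X'

section GroupIndist

variable {Ω : Type v} {Z : Type w} [MeasurableSpace Ω] [MeasurableSpace Z] {P : Measure Ω}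
  {ε δ : ℝ}

theorem GroupIndist.refl (X : Ω → Z) : GroupIndist P ε δ 0 X X := by
  intro B _
  simp

theorem GroupIndist.symm {k : ℕ} {X X' : Ω → Z} (h : GroupIndist P ε δ k X X') :
    GroupIndist P ε δ k X' X := Indist.symm h

theorem GroupIndist.mono (hε : 0 ≤ ε) (hδ : 0 ≤ δ) {j k : ℕ} (hjk : j ≤ k) {X X' : Ω → Z}
    (h : GroupIndist P ε δ j X X') : GroupIndist P ε δ k X X' := by
  have hjk' : (j : ℝ) ≤ k := by exact_mod_cast hjk
  refine Indist.mono h (by gcongr) (by gcongr)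

theorem Indist.group (hε : 0 ≤ ε) (hδ : 0 ≤ δ) {X X' : Ω → Z} (h : Indist P ε δ X X') :
    GroupIndist P ε δ 1 X X' := by
  refine Indist.mono h (by simp) ?_
  have : 1 ≤ Real.exp ε := Real.one_le_exp hε
  simp only [Nat.cast_one, mul_one]
  nlinarith

/-- The additive term `δ * exp (ε * k) * k` is not the sharp one, but its form is preserved under
concatenation: the first chain multiplies the loss of the second by `exp (ε * j)`, and its own loss
is enlarged by `exp (ε * k) ≥ 1`. -/
theorem group_step (hε : 0 ≤ ε) (hδ : 0 ≤ δ) (j k : ℕ) {a b c : ENNReal}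
    (h1 : a ≤ ENNReal.ofReal (Real.exp (ε * j)) * b
      + ENNReal.ofReal (δ * Real.exp (ε * j) * j))
    (h2 : b ≤ ENNReal.ofReal (Real.exp (ε * k)) * c
      + ENNReal.ofReal (δ * Real.exp (ε * k) * k)) :
    a ≤ ENNReal.ofReal (Real.exp (ε * (j + k : ℕ))) * c
      + ENNReal.ofReal (δ * Real.exp (ε * (j + k : ℕ)) * (j + k : ℕ)) := by
  refine h1.trans ((add_le_add (mul_le_mul_right h2 _) le_rfl).trans ?_)
  have he : Real.exp (ε * (j + k : ℕ)) = Real.exp (ε * j) * Real.exp (ε * k) := by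
    rw [← Real.exp_add]
    push_cast
    ring_nf
  rw [mul_add, ← mul_assoc, ← ENNReal.ofReal_mul (Real.exp_nonneg _), ← he, add_assoc]
  refine add_le_add le_rfl ?_
  rw [← ENNReal.ofReal_mul (Real.exp_nonneg _),
    ← ENNReal.ofReal_add (by positivity) (by positivity)]
  refine ENNReal.ofReal_le_ofReal ?_
  rw [he]
  push_cast
  have h3 : 1 ≤ Real.exp (ε * k) := Real.one_le_exp (by positivity)
  have h4 : 0 ≤ δ * Real.exp (ε * j) * j := by positivity
  nlinarith

theorem GroupIndist.trans (hε : 0 ≤ ε) (hδ : 0 ≤ δ) {j k : ℕ} {X X' X'' : Ω → Z}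
    (h : GroupIndist P ε δ j X X') (h' : GroupIndist P ε δ k X' X'') :
    GroupIndist P ε δ (j + k) X X'' := by
  intro B hB
  refine ⟨group_step hε hδ j k (h B hB).1 (h' B hB).1, ?_⟩
  rw [add_comm j k]
  exact group_step hε hδ k j (h' B hB).2 (h B hB).2

end GroupIndist

/-! ### Chains of neighboring streams of bounded degree. -/

namespace GraphStream

section Chains

variable {V : Type u} [DecidableEq V] {T : ℕ}

theorem MaxDegreeLE.of_subset {S S' : GraphStream V T} {D : ℕ} (h : S.MaxDegreeLE D)
    (hE : ∀ t, S'.edges t ⊆ S.edges t) : S'.MaxDegreeLE D := by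
  intro y _
  have hsub : (S'.flat T).edges ⊆ (S.flat T).edges := by
    intro e he
    obtain ⟨s, hs, h'⟩ := (S'.mem_flat_edges).1 he
    exact (S.mem_flat_edges).2 ⟨s, hs, hE s h'⟩
  have hle : (S'.flat T).degree y ≤ (S.flat T).degree y :=
    Finset.card_le_card (Finset.filter_subset_filter _ hsub)
  by_cases hy : y ∈ (S.flat T).verts
  · exact hle.trans (h y hy)
  · rw [degree_eq_zero_of_notMem _ hy] at hle
    exact hle.trans (Nat.zero_le D)

theorem removeNode_removeEdge (S : GraphStream V T) {e : Sym2 V} {x : V} (hx : x ∈ e) :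
    (S.removeEdge e).removeNode x = S.removeNode x := by
  ext t f
  · rfl
  · simp only [removeNode, removeEdge, Finset.mem_filter, Finset.mem_erase]
    constructor
    · rintro ⟨⟨-, h⟩, h'⟩
      exact ⟨h, h'⟩
    · rintro ⟨h, h'⟩
      exact ⟨⟨fun hfe => h' (hfe ▸ hx), h⟩, h'⟩

theorem removeNode_of_notMem (S : GraphStream V T) {x : V} (hx : x ∉ (S.flat T).verts) :
    S.removeNode x = S := by
  have hx' : ∀ s, x ∉ S.nodes s := fun s hs => hx ((S.mem_flat_verts).2 ⟨s, s.2, hs⟩)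
  ext t f
  · simp only [removeNode, Finset.mem_erase]
    exact ⟨fun h => h.2, fun h => ⟨fun h' => hx' t (h' ▸ h), h⟩⟩
  · simp only [removeNode, Finset.mem_filter]
    refine ⟨fun h => h.1, fun h => ⟨h, fun hxf => ?_⟩⟩
    obtain ⟨s, -, hs⟩ := S.endpoints t f h x hxf
    exact hx' s hs

theorem flat_removeEdge_edges (S : GraphStream V T) (e : Sym2 V) (k : ℕ) :
    ((S.removeEdge e).flat k).edges = ((S.flat k).edges).erase e := by
  ext f
  simp only [mem_flat_edges, removeEdge, Finset.mem_erase]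
  tauto

variable {Ω : Type v} {Z : Type w} [MeasurableSpace Ω] [MeasurableSpace Z] {P : Measure Ω}
  {ε δ : ℝ} {M : GraphStream V T → Ω → Z} {D : ℕ}

/-- Streams that differ in few edges, if a single edge costs `c` steps. -/
theorem groupIndist_of_edges (hε : 0 ≤ ε) (hδ : 0 ≤ δ) {c : ℕ}
    (hM : ∀ (S : GraphStream V T) (e : Sym2 V), S.MaxDegreeLE D → e ∈ (S.flat T).edges →
      GroupIndist P ε δ c (M S) (M (S.removeEdge e))) (n : ℕ) {Q S : GraphStream V T}
    (hS : S.MaxDegreeLE D) (hnodes : Q.nodes = S.nodes) (hedges : ∀ t, Q.edges t ⊆ S.edges t)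
    (hn : ((S.flat T).edges \ (Q.flat T).edges).card ≤ n) :
    GroupIndist P ε δ (c * n) (M S) (M Q) := by
  induction n generalizing S with
  | zero =>
    have h0 := Finset.sdiff_eq_empty_iff_subset.1 (Finset.card_eq_zero.1 (Nat.le_zero.1 hn))
    have : Q = S := by
      refine GraphStream.ext hnodes (funext fun t => (hedges t).antisymm fun e he => ?_)
      obtain ⟨s, -, hs⟩ := (Q.mem_flat_edges).1 (h0 ((S.mem_flat_edges).2 ⟨t, t.2, he⟩))
      by_cases hst : s = t
      · exact hst ▸ hs
      · exact absurd he (Finset.disjoint_left.1 (S.edges_once s t hst) (hedges s hs))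
    rw [this]
    exact GroupIndist.refl _
  | succ n ih =>
    by_cases hex : ∃ e, e ∈ (S.flat T).edges \ (Q.flat T).edges
    · obtain ⟨e, he⟩ := hex
      have he' := Finset.mem_sdiff.1 he
      have hQ : ∀ t, Q.edges t ⊆ (S.removeEdge e).edges t := fun t f hf =>
        Finset.mem_erase.2 ⟨fun hfe => he'.2 (hfe ▸ (Q.mem_flat_edges).2 ⟨t, t.2, hf⟩),
          hedges t hf⟩
      have h1 := ih (S := S.removeEdge e) (hS.of_subset fun t => Finset.erase_subset _ _) hnodes
        hQ (by
          rw [flat_removeEdge_edges, Finset.erase_sdiff_comm, Finset.card_erase_of_mem he]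
          omega)
      rw [Nat.mul_succ, add_comm]
      exact (hM S e hS he'.1).trans hε hδ h1
    · push Not at hex
      refine (ih hS hnodes hedges ?_).mono hε hδ (Nat.mul_le_mul_left c (Nat.le_succ n))
      rw [Finset.eq_empty_of_forall_notMem hex]
      simp

theorem edge_removeEdge (hε : 0 ≤ ε) (hδ : 0 ≤ δ) (hM : RestrictedEdgeDP D P M ε δ)
    (S : GraphStream V T) (e : Sym2 V) (hS : S.MaxDegreeLE D) (he : e ∈ (S.flat T).edges) :
    GroupIndist P ε δ 1 (M S) (M (S.removeEdge e)) :=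
  (hM S _ hS (hS.of_subset fun _ => Finset.erase_subset _ _)
    (Or.inl (Or.inl ⟨e, he, rfl⟩))).group hε hδ

theorem node_removeNode (hε : 0 ≤ ε) (hδ : 0 ≤ δ) (hM : RestrictedNodeDP D P M ε δ)
    (S : GraphStream V T) (x : V) (hS : S.MaxDegreeLE D) :
    GroupIndist P ε δ 1 (M S) (M (S.removeNode x)) := by
  by_cases hx : x ∈ (S.flat T).verts
  · exact (hM S _ hS (hS.of_subset fun _ => Finset.filter_subset _ _)
      (Or.inl ⟨x, hx, rfl⟩)).group hε hδ
  · rw [S.removeNode_of_notMem hx]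
    exact (GroupIndist.refl _).mono hε hδ (Nat.zero_le 1)

/-- An edge can be removed by removing one of its endpoints and adding it again. -/
theorem node_removeEdge (hε : 0 ≤ ε) (hδ : 0 ≤ δ) (hM : RestrictedNodeDP D P M ε δ)
    (S : GraphStream V T) (e : Sym2 V) (hS : S.MaxDegreeLE D) :
    GroupIndist P ε δ 2 (M S) (M (S.removeEdge e)) := by
  obtain ⟨x, hx⟩ : ∃ x, x ∈ e := ⟨_, Sym2.out_fst_mem e⟩
  have h1 := node_removeNode hε hδ hM S x hS
  have h2 := node_removeNode hε hδ hM (S.removeEdge e) x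
    (hS.of_subset fun _ => Finset.erase_subset _ _)
  rw [S.removeNode_removeEdge hx] at h2
  rw [← one_add_one_eq_two]
  exact h1.trans hε hδ h2.symm

/-- A node can be removed by removing its edges one by one. -/
theorem edge_removeNode (hε : 0 ≤ ε) (hδ : 0 ≤ δ) (hM : RestrictedEdgeDP D P M ε δ) (hD : 1 ≤ D)
    (S : GraphStream V T) (x : V) (hS : S.MaxDegreeLE D) :
    GroupIndist P ε δ D (M S) (M (S.removeNode x)) := by
  by_cases hx : x ∈ (S.flat T).verts
  -- The last edge leaves together with the node in a single step, so `n + 1` steps suffice for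
  -- degree `n + 1`. An isolated node also costs one step, which is why `D` must be positive.
  · have key : ∀ (n : ℕ) (S : GraphStream V T), S.MaxDegreeLE D → x ∈ (S.flat T).verts →
        (S.flat T).degree x ≤ n + 1 → GroupIndist P ε δ (n + 1) (M S) (M (S.removeNode x)) := by
      intro n
      induction n with
      | zero =>
        intro S hS hx hd
        refine (hM S _ hS (hS.of_subset fun _ => Finset.filter_subset _ _) (Or.inl (Or.inr ?_))).group
          hε hδ
        rcases Nat.le_one_iff_eq_zero_or_eq_one.1 hd with h | h
        · exact Or.inl ⟨x, hx, h, rfl⟩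
        · exact Or.inr ⟨x, hx, h, rfl⟩
      | succ n ih =>
        intro S hS hx hd
        by_cases hd' : (S.flat T).degree x ≤ n + 1
        · exact (ih S hS hx hd').mono hε hδ (Nat.le_succ _)
        · obtain ⟨e, he⟩ : ((S.flat T).edges.filter (fun e => x ∈ e)).Nonempty :=
            Finset.card_pos.1 (by unfold FinGraph.degree at hd'; omega)
          have he' := Finset.mem_filter.1 he
          have h1 := edge_removeEdge hε hδ hM S e hS he'.1
          have h2 := ih (S.removeEdge e) (hS.of_subset fun _ => Finset.erase_subset _ _) hx (by
            rw [FinGraph.degree, flat_removeEdge_edges, Finset.filter_erase,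
              Finset.card_erase_of_mem he]
            unfold FinGraph.degree at hd
            omega)
          rw [S.removeNode_removeEdge he'.2] at h2
          rw [add_comm]
          exact h1.trans hε hδ h2
    have h := key (D - 1) S hS hx (by have := hS x hx; omega)
    rwa [Nat.sub_add_cancel hD] at h
  · rw [S.removeNode_of_notMem hx]
    exact (GroupIndist.refl _).mono hε hδ (Nat.zero_le D)

end Chains

section ProjectionPrivacy

variable {V : Type u} [LinearOrder V] {T : ℕ} {Ω : Type v} {Z : Type w} [MeasurableSpace Ω]
  [MeasurableSpace Z] {P : Measure Ω} {ε δ : ℝ} {M : GraphStream V T → Ω → Z} {D ℓ k : ℕ}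

/-- The chain passes through the projection of `S` with `x` deleted afterwards: at most `D` steps
down to it, then at most `ℓ` edges up to the projection of `S.removeNode x`. -/
theorem edge_projStream (hε : 0 ≤ ε) (hδ : 0 ≤ δ) (hM : RestrictedEdgeDP D P M ε δ) (hD : 1 ≤ D)
    (S : GraphStream V T) (x : V) (hk : ((S.flat k).highDegree D).card ≤ ℓ) :
    GroupIndist P ε δ (D + ℓ) (M (S.projStream D k)) (M ((S.removeNode x).projStream D k)) := by
  have h1 := edge_removeNode hε hδ hM hD _ x (S.maxDegreeLE_projStream D k)
  have h2 := groupIndist_of_edges hε hδ (edge_removeEdge hε hδ hM) ℓ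
    ((S.removeNode x).maxDegreeLE_projStream D k) (S.projStream_removeNode_nodes x D k)
    (S.projStream_removeNode_edges_subset x D k) ((S.card_new_edges_le x D k).trans hk)
  rw [one_mul] at h2
  exact h1.trans hε hδ h2.symm

/-- The same chain, now with one step for the node `x` and two for each of the `ℓ` edges. -/
theorem node_projStream (hε : 0 ≤ ε) (hδ : 0 ≤ δ) (hM : RestrictedNodeDP D P M ε δ)
    (S : GraphStream V T) (x : V) (hk : ((S.flat k).highDegree D).card ≤ ℓ) :
    GroupIndist P ε δ (2 * ℓ + 1) (M (S.projStream D k))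
      (M ((S.removeNode x).projStream D k)) := by
  have h1 := node_removeNode hε hδ hM _ x (S.maxDegreeLE_projStream D k)
  have h2 := groupIndist_of_edges hε hδ (fun S e hS _ => node_removeEdge hε hδ hM S e hS) ℓ
    ((S.removeNode x).maxDegreeLE_projStream D k) (S.projStream_removeNode_nodes x D k)
    (S.projStream_removeNode_edges_subset x D k) ((S.card_new_edges_le x D k).trans hk)
  rw [add_comm]
  exact h1.trans hε hδ h2.symm

end ProjectionPrivacy

end GraphStream

/-! ## Releasing the answers up to a private stopping time -/

section Mask

variable {Y : Type v} {T : ℕ}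

/-- The answers before time `n`, followed by `⊥`. -/
def mask (n : ℕ) (y : Fin T → Y) (t : Fin T) : Y ⊕ Unit :=
  if (t : ℕ) < n then Sum.inl (y t) else Sum.inr ()

theorem mask_congr {n : ℕ} {y y' : Fin T → Y} (h : ∀ t : Fin T, (t : ℕ) < n → y t = y' t) :
    mask n y = mask n y' := by
  funext t
  unfold mask
  split_ifs with ht
  · rw [h t ht]
  · rfl

variable {C : Type w} {ε : ℝ} {τ : ℝ} {q : Fin T → ℝ} {k : ℕ}

open Classical in
/-- The answers `X`, released as long as the noisy queries stay below the noisy threshold. -/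
noncomputable def gated (τ : ℝ) (q : Fin T → ℝ) (X : C → Fin T → Y)
    (p : C × (ℝ × (Fin T → ℝ))) (t : Fin T) : Y ⊕ Unit :=
  if ∀ s ≤ t, svtBelow τ q p.2 s then Sum.inl (X p.1 t) else Sum.inr ()

/-- If the query at `k` does not stay below the threshold, or `k = T`, capping the stopping time at
`k` does not alter it. -/
theorem gated_eq_mask {X : C → Fin T → Y} {p : C × (ℝ × (Fin T → ℝ))} {n : ℕ} (hk : k ≤ T)
    (hp : p.2 ∈ svtStop τ q k n) (hn : n ≤ k)
    (hnext : ∀ h : k < T, ¬ svtBelow τ q p.2 ⟨k, h⟩) : gated τ q X p = mask n (X p.1) := by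
  funext t
  unfold gated mask
  by_cases ht : (t : ℕ) < n
  · rw [if_pos ht, if_pos]
    exact fun s hs => hp.1 s (lt_of_le_of_lt (Fin.le_def.1 hs) ht)
  · rw [if_neg ht, if_neg]
    intro h
    have hnT : n < T := by omega
    have hbelow := h ⟨n, hnT⟩ (by rw [Fin.le_def]; simpa using ht)
    rcases hn.lt_or_eq with h1 | rfl
    · exact hp.2 ⟨n, hnT⟩ rfl h1 hbelow
    · exact hnext hnT hbelow

/-- The noise for which the query at time `k` stays below the threshold. -/
def svtMiss (τ : ℝ) (q : Fin T → ℝ) (k : ℕ) : Set (ℝ × (Fin T → ℝ)) :=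
  {z | ∃ h : k < T, svtBelow τ q z ⟨k, h⟩}

variable [MeasurableSpace C] {α : Measure C} [IsProbabilityMeasure α]

-- The capped stopping time depends only on the noise of sparse vector, which is independent of the
-- coins, so each of its values contributes a product. Only noise in `svtMiss` escapes this
-- decomposition.
variable (α) in
theorem gated_le (hε : 0 < ε) (hk : k ≤ T) (X : C → Fin T → Y) (B : Set (Fin T → Y ⊕ Unit)) :
    (α.prod (svtNoise 1 ε T)) (gated τ q X ⁻¹' B) ≤
      (∑ n ∈ Finset.range (k + 1), α ((fun ω => mask n (X ω)) ⁻¹' B)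
          * svtNoise 1 ε T (svtStop τ q k n))
        + svtNoise 1 ε T (svtMiss τ q k) := by
  have := isProbabilityMeasure_svtNoise hε T
  have hsub : gated τ q X ⁻¹' B ⊆
      (⋃ n ∈ Finset.range (k + 1), ((fun ω => mask n (X ω)) ⁻¹' B) ×ˢ svtStop τ q k n) ∪
        Set.univ ×ˢ svtMiss τ q k := by
    intro p hp
    by_cases hm : p.2 ∈ svtMiss τ q k
    · exact Or.inr ⟨Set.mem_univ _, hm⟩
    · obtain ⟨n, hn, hz⟩ := exists_mem_svtStop τ q k p.2
      refine Or.inl (Set.mem_biUnion (Finset.mem_coe.2 (Finset.mem_range.2 (by omega))) ⟨?_, hz⟩)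
      rw [Set.mem_preimage, ← gated_eq_mask hk hz hn fun h h' => hm ⟨h, h'⟩]
      exact hp
  refine (measure_mono hsub).trans ((measure_union_le _ _).trans (add_le_add
    ((measure_biUnion_finset_le _ _).trans (Finset.sum_le_sum fun n _ => ?_)) ?_))
  · rw [Measure.prod_prod]
  · rw [Measure.prod_prod, measure_univ, one_mul]

variable [MeasurableSpace Y]

theorem measurable_mask (n : ℕ) : Measurable (mask (T := T) (Y := Y) n) := by
  refine measurable_pi_lambda _ fun t => ?_
  unfold mask
  split_ifs
  · exact measurable_inl.comp (measurable_pi_apply t)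
  · exact measurable_const

-- The converse bound. Here the stopping events must be disjoint, so that the sum is the probability
-- of their union.
variable (α) in
theorem le_gated (hε : 0 < ε) (hk : k ≤ T) {X : C → Fin T → Y} (hX : Measurable X)
    {B : Set (Fin T → Y ⊕ Unit)} (hB : MeasurableSet B) :
    (∑ n ∈ Finset.range (k + 1), α ((fun ω => mask n (X ω)) ⁻¹' B)
          * svtNoise 1 ε T (svtStop τ q k n)) ≤
      (α.prod (svtNoise 1 ε T)) (gated τ q X ⁻¹' B) + svtNoise 1 ε T (svtMiss τ q k) := by
  have := isProbabilityMeasure_svtNoise hε T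
  have hunion : (∑ n ∈ Finset.range (k + 1), α ((fun ω => mask n (X ω)) ⁻¹' B)
      * svtNoise 1 ε T (svtStop τ q k n)) = (α.prod (svtNoise 1 ε T))
        (⋃ n ∈ Finset.range (k + 1), ((fun ω => mask n (X ω)) ⁻¹' B) ×ˢ svtStop τ q k n) := by
    rw [measure_biUnion_finset]
    · exact Finset.sum_congr rfl fun n _ => (Measure.prod_prod _ _).symm
    · intro m hm n hn hmn
      simp only [Finset.coe_range, Set.mem_Iio] at hm hn
      refine Set.disjoint_prod.2 (Or.inr ?_)
      rcases lt_or_gt_of_ne hmn with h | h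
      · exact svtStop_disjoint τ q hk h (by omega)
      · exact (svtStop_disjoint τ q hk h (by omega)).symm
    · exact fun n _ => (((measurable_mask n).comp hX) hB).prod (measurableSet_svtStop τ q k n)
  rw [hunion]
  have hsub : (⋃ n ∈ Finset.range (k + 1), ((fun ω => mask n (X ω)) ⁻¹' B) ×ˢ svtStop τ q k n) ⊆
      gated τ q X ⁻¹' B ∪ Set.univ ×ˢ svtMiss τ q k := by
    intro p hp
    by_cases hm : p.2 ∈ svtMiss τ q k
    · exact Or.inr ⟨Set.mem_univ _, hm⟩
    · simp only [Set.mem_iUnion] at hp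
      obtain ⟨n, hn, h1, h2⟩ := hp
      rw [Finset.mem_range] at hn
      left
      rw [Set.mem_preimage, gated_eq_mask hk h2 (by omega) fun h h' => hm ⟨h, h'⟩]
      exact h1
  refine (measure_mono hsub).trans ((measure_union_le _ _).trans (add_le_add le_rfl ?_))
  rw [Measure.prod_prod, measure_univ, one_mul]

/-- For each stopping time the masked answers cost `e₁` and `δ₁`, and its probability costs `exp ε`.
The stopping probabilities add up to at most `1`, so `δ₁` enters once. The miss under `q` is added
as it is; the one under `q'` is multiplied by both factors. -/
theorem gated_one_sided (hε : 0 < ε) (hk : k ≤ T) {X X' : C → Fin T → Y}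
    (hX' : Measurable X') {q' : Fin T → ℝ} (hq : ∀ s, |q s - q' s| ≤ 1)
    {e₁ δ₁ p p' : ENNReal}
    (hXX' : ∀ n ≤ k, ∀ B : Set (Fin T → Y ⊕ Unit), MeasurableSet B →
      α ((fun ω => mask n (X ω)) ⁻¹' B) ≤ e₁ * α ((fun ω => mask n (X' ω)) ⁻¹' B) + δ₁)
    (hp : svtNoise 1 ε T (svtMiss τ q k) ≤ p) (hp' : svtNoise 1 ε T (svtMiss τ q' k) ≤ p')
    {B : Set (Fin T → Y ⊕ Unit)} (hB : MeasurableSet B) :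
    (α.prod (svtNoise 1 ε T)) (gated τ q X ⁻¹' B) ≤
      e₁ * ENNReal.ofReal (Real.exp ε) * (α.prod (svtNoise 1 ε T)) (gated τ q' X' ⁻¹' B)
        + (e₁ * ENNReal.ofReal (Real.exp ε) * p' + δ₁ + p) := by
  have h1 := gated_le α (τ := τ) (q := q) hε hk X B
  have h2 := le_gated α (τ := τ) (q := q') hε hk hX' hB
  have h3 : (∑ n ∈ Finset.range (k + 1), α ((fun ω => mask n (X ω)) ⁻¹' B)
      * svtNoise 1 ε T (svtStop τ q k n)) ≤ e₁ * ENNReal.ofReal (Real.exp ε) *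
        (∑ n ∈ Finset.range (k + 1), α ((fun ω => mask n (X' ω)) ⁻¹' B)
          * svtNoise 1 ε T (svtStop τ q' k n)) + δ₁ := by
    have h4 : ∀ n ∈ Finset.range (k + 1), α ((fun ω => mask n (X ω)) ⁻¹' B)
        * svtNoise 1 ε T (svtStop τ q k n) ≤ e₁ * ENNReal.ofReal (Real.exp ε) *
          (α ((fun ω => mask n (X' ω)) ⁻¹' B) * svtNoise 1 ε T (svtStop τ q' k n))
            + δ₁ * svtNoise 1 ε T (svtStop τ q k n) := by
      intro n hn
      rw [Finset.mem_range] at hn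
      refine (mul_le_mul_left (hXX' n (by omega) B hB) _).trans ?_
      rw [add_mul]
      refine add_le_add ?_ le_rfl
      refine (mul_le_mul_right (svtNoise_svtStop_le hε τ hq k n) _).trans (le_of_eq ?_)
      ring
    refine (Finset.sum_le_sum h4).trans ?_
    rw [Finset.sum_add_distrib, ← Finset.mul_sum, ← Finset.mul_sum]
    refine add_le_add le_rfl ?_
    exact (mul_le_mul_right (sum_svtStop_le hε τ q hk) _).trans (mul_one _).le
  calc (α.prod (svtNoise 1 ε T)) (gated τ q X ⁻¹' B)
      ≤ e₁ * ENNReal.ofReal (Real.exp ε) *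
        ((α.prod (svtNoise 1 ε T)) (gated τ q' X' ⁻¹' B) + p') + δ₁ + p :=
        h1.trans (add_le_add (h3.trans (add_le_add
          (mul_le_mul_right (h2.trans (add_le_add le_rfl hp')) _) le_rfl)) hp)
    _ = _ := by ring

end Mask

/-! ## Privacy and accuracy of the black-box transformation -/

theorem Indist.of_one_le {Ω : Type v} {Z : Type w} [MeasurableSpace Ω] [MeasurableSpace Z]
    {P : Measure Ω} [IsProbabilityMeasure P] {ε δ : ℝ} (hδ : 1 ≤ δ) (X X' : Ω → Z) :
    Indist P ε δ X X' := by
  intro B _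
  have h : (1 : ENNReal) ≤ ENNReal.ofReal δ := ENNReal.one_le_ofReal.2 hδ
  exact ⟨(prob_le_one.trans h).trans le_add_self, (prob_le_one.trans h).trans le_add_self⟩

section BlackBox

variable {V : Type u} {Y : Type v} [MeasurableSpace Y] (A : StreamAlg.{u, v, w} V Y)
  {εTest βTest β : ℝ} {D T : ℕ}

theorem isProbabilityMeasure_bbLaw (hε : 0 < εTest) (T : ℕ) :
    IsProbabilityMeasure (bbLaw A εTest T) := by
  have := isProbabilityMeasure_svtNoise hε T
  unfold bbLaw
  infer_instance

theorem measurable_outputOn (xs : List (Arrival V)) : Measurable (A.outputOn T xs) :=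
  measurable_pi_lambda _ fun _ => A.measurable_out _

variable [LinearOrder V]

/-- The query values of the test. -/
noncomputable def bbQuery (D' ℓ : ℕ) (S : GraphStream V T) (t : Fin T) : ℝ :=
  -((S.flat (t + 1)).distToGraph D' ℓ : ℝ)

theorem bbOutput_eq_gated (S : GraphStream V T) :
    bbOutput A εTest βTest β D S = gated (bbThreshold εTest βTest)
      (bbQuery (bbDegree εTest βTest β D T) (bbSlack εTest βTest β T) S)
      (bbBase A εTest βTest β D S) := by
  funext p t
  by_cases h : ∀ s ≤ t, svtBelow (bbThreshold εTest βTest)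
      (bbQuery (bbDegree εTest βTest β D T) (bbSlack εTest βTest β T) S) p.2 s
  · rw [gated, if_pos h]
    exact if_pos ((svt_forall_iff _ _ _ _).2 h)
  · rw [gated, if_neg h]
    exact if_neg fun h' => h ((svt_forall_iff _ _ _ _).1 h')

theorem bbQuery_sub_le [Infinite V] (D' ℓ : ℕ) (S : GraphStream V T) (x : V) (t : Fin T) :
    |bbQuery D' ℓ S t - bbQuery D' ℓ (S.removeNode x) t| ≤ 1 := by
  have h := FinGraph.distToGraph_removeNode D' ℓ (S.flat (t + 1)) x
  rw [← S.flat_removeNode] at h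
  have h1 : ((S.flat (t + 1)).distToGraph D' ℓ : ℝ) ≤
      ((S.removeNode x).flat (t + 1)).distToGraph D' ℓ + 1 := by exact_mod_cast h.1
  have h2 : (((S.removeNode x).flat (t + 1)).distToGraph D' ℓ : ℝ) ≤
      (S.flat (t + 1)).distToGraph D' ℓ + 1 := by exact_mod_cast h.2
  unfold bbQuery
  rw [abs_le]
  constructor <;> linarith

/-- The first time at which `ℓ` nodes have degree greater than `D'`. -/
theorem exists_crossing [Infinite V] (D' ℓ : ℕ) (S : GraphStream V T) :
    ∃ k ≤ T, ((S.flat k).highDegree D').card ≤ ℓ ∧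
      ∀ h : k < T, bbQuery D' ℓ S ⟨k, h⟩ = 0 := by
  classical
  have h0 : ((S.flat 0).highDegree D').card ≤ ℓ := by
    have : (S.flat 0).highDegree D' = ∅ := by simp [FinGraph.highDegree, GraphStream.flat]
    simp [this]
  -- The bound is `≤ ℓ` and not `< ℓ` because of `k = 0` and `ℓ = 0`, where the prefix is empty.
  have hpred : ∀ k, (∀ j < k, ¬ ℓ ≤ ((S.flat (j + 1)).highDegree D').card) →
      ((S.flat k).highDegree D').card ≤ ℓ := by
    intro k hk
    cases k with
    | zero => exact h0
    | succ k => exact (not_le.1 (hk k (Nat.lt_succ_self k))).le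
  by_cases hex : ∃ t, t < T ∧ ℓ ≤ ((S.flat (t + 1)).highDegree D').card
  · obtain ⟨h1, h2⟩ := Nat.find_spec hex
    refine ⟨Nat.find hex, h1.le, hpred _ fun j hj h => Nat.find_min hex hj ⟨hj.trans h1, h⟩,
      fun h => ?_⟩
    simp only [bbQuery]
    rw [FinGraph.distToGraph_eq_zero h2]
    simp
  · push Not at hex
    exact ⟨T, le_rfl, hpred _ fun j hj => not_le.2 (hex j hj), fun h => absurd h (lt_irrefl T)⟩

theorem svtNoise_svtMiss_le {ε β : ℝ} {q : Fin T → ℝ} {k : ℕ} {p : ENNReal}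
    (h : ∀ h : k < T, svtNoise 1 ε T {z | svtBelow (bbThreshold ε β) q z ⟨k, h⟩} ≤ p) :
    svtNoise 1 ε T (svtMiss (bbThreshold ε β) q k) ≤ p := by
  by_cases hk : k < T
  · exact (measure_mono fun z hz => hz.2).trans (h hk)
  · have : svtMiss (bbThreshold ε β) q k = ∅ :=
      Set.eq_empty_of_forall_notMem fun z hz => hk hz.1
    rw [this, measure_empty]
    exact zero_le

/-- Privacy of the black-box transformation, if the base algorithm satisfies the guarantee of
`m` steps on projections of neighboring streams. -/
theorem nodeDP_bbOutput [Infinite V] (hε : 0 < εTest) (hβ : 0 < βTest) (hβ1 : βTest ≤ 1)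
    {ε' δ' : ℝ} (hε' : 0 ≤ ε') (hδ' : 0 ≤ δ') (m : ℕ)
    (hA : ∀ (S : GraphStream V T) (x : V) (k : ℕ),
      ((S.flat k).highDegree (bbDegree εTest βTest β D T)).card ≤ bbSlack εTest βTest β T →
      GroupIndist A.coinLaw ε' δ' m
        (A.output (S.projStream (bbDegree εTest βTest β D T) k))
        (A.output ((S.removeNode x).projStream (bbDegree εTest βTest β D T) k))) :
    NodeDP (T := T) (bbLaw A εTest T) (fun S => bbOutput A εTest βTest β D S)
      (εTest + ε' * m) ((1 + Real.exp εTest) * Real.exp (εTest + ε' * m) * βTest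
        + δ' * Real.exp (ε' * m) * m) := by
  set D' := bbDegree εTest βTest β D T with hD'
  set ℓ := bbSlack εTest βTest β T with hℓ
  have key : ∀ (S : GraphStream V T) (x : V), Indist (bbLaw A εTest T) (εTest + ε' * m)
      ((1 + Real.exp εTest) * Real.exp (εTest + ε' * m) * βTest + δ' * Real.exp (ε' * m) * m)
      (bbOutput A εTest βTest β D S) (bbOutput A εTest βTest β D (S.removeNode x)) := by
    intro S x B hB
    -- The crossing time of the larger stream `S` serves both streams and both directions.
    obtain ⟨k, hk, hhigh, hzero⟩ := exists_crossing D' ℓ S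
    have hbase : ∀ (S : GraphStream V T) (n : ℕ), n ≤ k → ∀ ω,
        mask n (bbBase A εTest βTest β D S ω) = mask n (A.output (S.projStream D' k) ω) := by
      intro S n hn ω
      refine mask_congr fun t ht => ?_
      unfold bbBase StreamAlg.output StreamAlg.outputOn
      rw [S.take_projStream D' (j := t + 1) (by omega)]
    have hgroup := hA S x k hhigh
    have hmask : ∀ n ≤ k, ∀ B : Set (Fin T → Y ⊕ Unit), MeasurableSet B →
        A.coinLaw ((fun ω => mask n (bbBase A εTest βTest β D S ω)) ⁻¹' B) ≤
          ENNReal.ofReal (Real.exp (ε' * m)) * A.coinLaw ((fun ω =>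
            mask n (bbBase A εTest βTest β D (S.removeNode x) ω)) ⁻¹' B)
            + ENNReal.ofReal (δ' * Real.exp (ε' * m) * m) ∧
        A.coinLaw ((fun ω => mask n (bbBase A εTest βTest β D (S.removeNode x) ω)) ⁻¹' B) ≤
          ENNReal.ofReal (Real.exp (ε' * m)) * A.coinLaw ((fun ω =>
            mask n (bbBase A εTest βTest β D S ω)) ⁻¹' B)
            + ENNReal.ofReal (δ' * Real.exp (ε' * m) * m) := by
      intro n hn B hB
      simp only [hbase _ n hn]
      exact hgroup _ (measurable_mask n hB)
    have hq := bbQuery_sub_le D' ℓ S x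
    have hp : svtNoise 1 εTest T (svtMiss (bbThreshold εTest βTest) (bbQuery D' ℓ S) k) ≤
        ENNReal.ofReal βTest :=
      svtNoise_svtMiss_le fun h => svtNoise_below_le hε hβ hβ1 (hzero h)
    -- At the crossing the query of `S` is `0`, so the neighboring one is at least `-1`.
    have hp' : svtNoise 1 εTest T (svtMiss (bbThreshold εTest βTest)
        (bbQuery D' ℓ (S.removeNode x)) k) ≤ ENNReal.ofReal (Real.exp εTest * βTest) := by
      refine svtNoise_svtMiss_le fun h => svtNoise_below_le_exp hε hβ hβ1 ?_
      have h1 := abs_le.1 (hq ⟨k, h⟩)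
      rw [hzero h] at h1
      linarith [h1.2]
    have hexp : ENNReal.ofReal (Real.exp (ε' * m)) * ENNReal.ofReal (Real.exp εTest) =
        ENNReal.ofReal (Real.exp (εTest + ε' * m)) := by
      rw [← ENNReal.ofReal_mul (Real.exp_nonneg _), ← Real.exp_add, add_comm]
    have hE1 : 1 ≤ Real.exp (εTest + ε' * m) := Real.one_le_exp (by positivity)
    have hET : 1 ≤ Real.exp εTest := Real.one_le_exp hε.le
    rw [bbOutput_eq_gated, bbOutput_eq_gated, ← hD', ← hℓ]
    -- With `E` the total exponential factor, the misses cost `E * exp εTest * βTest + βTest` in one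
    -- direction and `E * βTest + exp εTest * βTest` in the other. Both are at most `(1 + exp εTest)
    -- * E * βTest`.
    constructor
    · refine (gated_one_sided hε hk (measurable_outputOn A _) hq
        (fun n hn B hB => (hmask n hn B hB).1) hp hp' hB).trans ?_
      rw [hexp]
      refine add_le_add le_rfl ?_
      rw [← ENNReal.ofReal_mul (by positivity), ← ENNReal.ofReal_add (by positivity)
        (by positivity), ← ENNReal.ofReal_add (by positivity) (by positivity)]
      refine ENNReal.ofReal_le_ofReal ?_
      nlinarith
    · refine (gated_one_sided hε hk (measurable_outputOn A _)
        (fun s => by rw [abs_sub_comm]; exact hq s)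
        (fun n hn B hB => (hmask n hn B hB).2) hp' hp hB).trans ?_
      rw [hexp]
      refine add_le_add le_rfl ?_
      rw [← ENNReal.ofReal_mul (by positivity), ← ENNReal.ofReal_add (by positivity)
        (by positivity), ← ENNReal.ofReal_add (by positivity) (by positivity)]
      refine ENNReal.ofReal_le_ofReal ?_
      have : Real.exp εTest * βTest ≤
          Real.exp εTest * Real.exp (εTest + ε' * m) * βTest := by
        have : 0 ≤ Real.exp εTest * βTest := by positivity
        nlinarith
      linarith
  rintro S S' (⟨x, -, rfl⟩ | ⟨x, -, rfl⟩)
  · exact key S x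
  · exact (key S' x).symm

/-- If there is no slack, then the test has no privacy to offer. -/
theorem one_le_of_bbSlack_eq_zero (hε : 0 < εTest) (hβ : 0 < β) (hβ1 : β ≤ 1) (hβT : 0 < βTest)
    (hT : 1 ≤ T) (h : bbSlack εTest βTest β T = 0) : 1 ≤ βTest := by
  have hT' : (1 : ℝ) ≤ T := by exact_mod_cast hT
  have h1 : 8 * Real.log (T / (β * βTest)) / εTest ≤ 0 := Nat.ceil_eq_zero.1 h
  have h2 : Real.log (T / (β * βTest)) ≤ 0 := by
    by_contra! h'
    have : 0 < 8 * Real.log (T / (β * βTest)) / εTest := by positivity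
    linarith
  have h3 : T / (β * βTest) ≤ 1 := by
    by_contra! h'
    exact absurd (Real.log_pos h') (not_lt.2 h2)
  rw [div_le_one (by positivity)] at h3
  nlinarith

theorem nodeDP_of_one_le (hε : 0 < εTest) {ε δ : ℝ} (hδ : 1 ≤ δ) :
    NodeDP (T := T) (bbLaw A εTest T) (fun S => bbOutput A εTest βTest β D S) ε δ := by
  have := isProbabilityMeasure_bbLaw A hε T
  exact fun S S' _ => Indist.of_one_le hδ _ _

theorem one_le_privacy_loss {ε a : ℝ} (hε : 0 < εTest) (hε0 : 0 ≤ ε) (ha : 0 ≤ a)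
    (hβ : 1 ≤ βTest) : 1 ≤ (1 + Real.exp εTest) * Real.exp ε * βTest + a := by
  have h1 : 1 ≤ Real.exp εTest := Real.one_le_exp hε.le
  have h2 : 1 ≤ Real.exp ε := Real.one_le_exp hε0
  have h3 : 1 ≤ (1 + Real.exp εTest) * Real.exp ε := by nlinarith
  nlinarith

theorem nodeDP_of_restrictedEdgeDP [Infinite V] (hε : 0 < εTest) (hβT : 0 < βTest)
    (hβT1 : βTest ≤ 1) (hβ : 0 < β) (hβ1 : β ≤ 1) (hT : 1 ≤ T) {ℓ D' : ℕ}
    (hℓ : ℓ = bbSlack εTest βTest β T) (hD' : D' = D + ℓ) {ε' δ' ε δ : ℝ} (hε' : 0 ≤ ε')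
    (hδ' : 0 ≤ δ') (hεeq : ε = εTest + ε' * (D' + ℓ))
    (hδeq : δ = (1 + Real.exp εTest) * Real.exp ε * βTest
      + δ' * Real.exp (ε' * (D' + ℓ)) * (D' + ℓ))
    (hA : RestrictedEdgeDP (T := T) D' A.coinLaw (fun S => A.output S) ε' δ') :
    NodeDP (T := T) (bbLaw A εTest T) (fun S => bbOutput A εTest βTest β D S) ε δ := by
  -- Without slack `D'` may be `0`, and removing an isolated node would not fit into `D' + ℓ` steps.
  -- But then `βTest ≥ 1`, so `δ ≥ 1` and there is nothing to prove.
  by_cases h0 : ℓ = 0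
  · refine nodeDP_of_one_le A hε ?_
    rw [hδeq]
    exact one_le_privacy_loss hε (by rw [hεeq]; positivity) (by positivity)
      (one_le_of_bbSlack_eq_zero hε hβ hβ1 hβT hT (hℓ ▸ h0))
  · have hdeg : bbDegree εTest βTest β D T = D' := by rw [bbDegree, ← hℓ, hD']
    have h := nodeDP_bbOutput A (T := T) (D := D) (β := β) hε hβT hβT1 hε' hδ' (D' + ℓ) (by
      intro S x k hk
      rw [hdeg, ← hℓ] at hk
      rw [hdeg]
      exact GraphStream.edge_projStream hε' hδ' hA (by omega) S x hk)
    push_cast at h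
    rwa [← hεeq, ← hδeq] at h

theorem nodeDP_of_restrictedNodeDP [Infinite V] (hε : 0 < εTest) (hβT : 0 < βTest)
    (hβT1 : βTest ≤ 1) {ℓ D' : ℕ} (hℓ : ℓ = bbSlack εTest βTest β T) (hD' : D' = D + ℓ)
    {ε' δ' ε δ : ℝ} (hε' : 0 ≤ ε') (hδ' : 0 ≤ δ') (hεeq : ε = εTest + ε' * (2 * ℓ + 1))
    (hδeq : δ = (1 + Real.exp εTest) * Real.exp ε * βTest
      + δ' * Real.exp (ε' * (2 * ℓ + 1)) * (2 * ℓ + 1))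
    (hA : RestrictedNodeDP (T := T) D' A.coinLaw (fun S => A.output S) ε' δ') :
    NodeDP (T := T) (bbLaw A εTest T) (fun S => bbOutput A εTest βTest β D S) ε δ := by
  have hdeg : bbDegree εTest βTest β D T = D' := by rw [bbDegree, ← hℓ, hD']
  have h := nodeDP_bbOutput A (T := T) (D := D) (β := β) hε hβT hβT1 hε' hδ' (2 * ℓ + 1) (by
    intro S x k hk
    rw [hdeg, ← hℓ] at hk
    rw [hdeg]
    exact GraphStream.node_projStream hε' hδ' hA S x hk)
  push_cast at h
  rwa [← hεeq, ← hδeq] at h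

/-- Boundedness passes to all earlier prefixes, so every query through `t'` is at most `-ℓ`, and `ℓ`
was chosen as the margin that `le_svtNoise_below` needs. -/
theorem bbOutput_accuracy [Infinite V] (hε : 0 < εTest) (hβT : 0 < βTest) (hβ : 0 < β)
    (hβ1 : β ≤ 1) (hT : 1 ≤ T) {ℓ D' : ℕ} (hℓ : ℓ = bbSlack εTest βTest β T) (hD' : D' = D + ℓ)
    (S : GraphStream V T) (t' : Fin T) (hS : (S.flat (t' + 1)).Bounded D 0) :
    ENNReal.ofReal (1 - β) ≤ bbLaw A εTest T
      {p | ∀ t ≤ t', bbOutput A εTest βTest β D S p t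
        = Sum.inl (A.outputOn T (proj D' S.toList) p.1 t)} := by
  have := isProbabilityMeasure_svtNoise hε T
  have hdeg : bbDegree εTest βTest β D T = D' := by rw [bbDegree, ← hℓ, hD']
  have h1 := le_svtNoise_below (T := T) hT (ε := εTest) (βTest := βTest) (a := ℓ) hε hβ hβ1 hβT
    (by rw [hℓ]; exact Nat.le_ceil _) (q := bbQuery D' ℓ S) (t' := t') (by
      intro s hs
      have hb := S.bounded_flat_mono (j := s + 1) (Nat.succ_le_succ hs) hS
      have := FinGraph.le_distToGraph_of_bounded (ℓ := ℓ) hb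
      rw [← hD'] at this
      have h2 : (ℓ : ℝ) ≤ (S.flat (s + 1)).distToGraph D' ℓ := by exact_mod_cast this
      unfold bbQuery
      linarith)
  refine h1.trans ?_
  have h2 : bbLaw A εTest T (Set.univ ×ˢ
      {z | ∀ s ≤ t', svtBelow (bbThreshold εTest βTest) (bbQuery D' ℓ S) z s}) =
      svtNoise 1 εTest T
        {z | ∀ s ≤ t', svtBelow (bbThreshold εTest βTest) (bbQuery D' ℓ S) z s} := by
    rw [bbLaw, Measure.prod_prod, measure_univ, one_mul]
  rw [← h2]
  refine measure_mono ?_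
  rintro p ⟨-, hp⟩ t ht
  rw [bbOutput_eq_gated, hdeg, ← hℓ, gated, if_pos fun s hs => hp s (hs.trans ht), bbBase, hdeg]

end BlackBox

/-! ## The program -/

namespace StreamRAM

/-- Straight-line code. -/
def block : List Instr → Code
  | [] => Code.skip
  | i :: is => Code.seq (Code.instr i) (block is)

/-- Registers `2`, `3`, `8`, `9` hold `0`, `1`, `D' + 2`, `D' + 1`, register `7` holds an upper
bound on the distance, and register `11` whether the test has failed. Real registers `5` and `6`
hold the scale of the query noise and the noisy threshold. -/
def bbStart : Code :=
  Code.seq (block [.iconst 3 1, .iadd 9 0 3, .iadd 8 9 3])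
    -- The bound starts at `D' + 2`: that many mutually joined nodes all have degree greater than
    -- `D'`, and `ℓ ≤ D'`. For `ℓ = 0` the distance is `0`, and the register keeps its default value
    -- `0`.
    (Code.seq (Code.ite (.ile 1 2) Code.skip (Code.instr (.iadd 7 8 2)))
      -- Real register `5` first holds the threshold scale, for the draw that is added to `τ`, and
      -- then the query scale, which is twice as large.
      (block [.rofint 2 3, .radd 3 2 2, .rdiv 4 0 3, .rdiv 5 2 4, .draw 6 5, .radd 6 1 6,
        .rdiv 5 3 4]))

/-- Count the node in entry `0` of the table, and pass it on. -/
def bbNode : Code := block [.iload 4 0 2, .iadd 4 4 3, .istore 0 2 4, .sendNode]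

/-- Increment the degree of an endpoint, and entry `j` of the table for the new degree `j`. -/
def bbBump (snd : Bool) : Code :=
  block [.nload 5 0 snd, .iadd 5 5 3, .iload 6 0 5, .iadd 6 6 3, .nstore 0 snd 5, .istore 0 5 6]

/-- Pass the edge on if both degrees are less than `D'`, and increment the degrees of its
endpoints. -/
def bbEdge : Code :=
  Code.seq (block [.nload 4 0 false, .nload 5 0 true])
    (Code.seq (Code.ite (.ile 0 4) Code.skip
      (Code.ite (.ile 0 5) Code.skip (Code.instr .sendEdge)))
      (Code.seq (bbBump false) (bbBump true)))

/-- Set register `10` to `1` if the distance is less than register `7`, and to `0` otherwise. -/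
def bbCheck : Code :=
  Code.seq (block [.iconst 10 0])
    (Code.ite (.ile 3 7)
      -- With `k` in register `7`, register `12` holds `k - 1`. Entry `0` of the table is the number
      -- of nodes; the entry read later, `D' + 1 - (k - 1)`, counts the nodes that `k - 1` new
      -- neighbors lift above `D'`.
      (Code.seq (block [.isub 12 7 3, .iload 4 0 2, .iadd 4 4 12])
        (Code.ite (.ile 8 4)
          (Code.seq (block [.isub 4 9 12, .iload 4 0 4, .iadd 4 4 12])
            (Code.ite (.ile 1 4) (block [.iconst 10 1]) Code.skip))
          Code.skip))
      Code.skip)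

/-- Decrease register `7` to the distance. -/
def bbSearch : Code :=
  Code.seq bbCheck (Code.loop (.ile 3 10) (Code.seq (Code.instr (.isub 7 7 3)) bbCheck))

/-- The noisy comparison and the output. -/
def bbAnswer : Code :=
  Code.seq (block [.rofint 7 7, .draw 8 5, .rsub 8 8 7])
    (Code.seq (Code.ite (.rle 6 8) (Code.instr (.iconst 11 1)) Code.skip)
      (Code.ite (.ile 3 11) (Code.instr .emitBot) (Code.instr .emitBase)))

/-- The black-box transformation. -/
def bbProgram : Program where
  start := bbStart
  onNode := bbNode
  onEdge := bbEdge
  onEnd := Code.seq bbSearch bbAnswer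

/-! ### The memory invariant of the program. -/

section Memory

variable {V : Type u} {Y : Type v}

/-- No noise was drawn, and nothing was output. -/
def Quiet (s s' : Config V Y) : Prop :=
  s'.draws = s.draws ∧ s'.history = s.history ∧ s'.out = s.out ∧ s'.baseSpace = s.baseSpace

theorem Quiet.trans {s s' s'' : Config V Y} (h : Quiet s s') (h' : Quiet s' s'') :
    Quiet s s'' :=
  ⟨h'.1.trans h.1, h'.2.1.trans h.2.1, h'.2.2.1.trans h.2.2.1, h'.2.2.2.trans h.2.2.2⟩

/-- Everything but the memory and the time is the same in `s` and `s'`. -/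
def SameState (s s' : Config V Y) : Prop :=
  s'.item = s.item ∧ s'.pending = s.pending ∧ Quiet s s'

theorem SameState.trans {s s' s'' : Config V Y} (h : SameState s s') (h' : SameState s' s'') :
    SameState s s'' :=
  ⟨h'.1.trans h.1, h'.2.1.trans h.2.1, h.2.2.trans h'.2.2⟩

/-- The cells that the program may have written, when the nodes in `W` have degrees `d`. -/
def AllowedCell (W : Finset V) (d : V → ℕ) : Cell V → Prop
  | .ireg i => i < 13
  | .rreg i => i < 9
  | .itab tab j => tab = 0 ∧ ∃ y ∈ W, j ≤ d y
  | .ntab tab y => tab = 0 ∧ y ∈ W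

/-- The memory of the program between its blocks. -/
structure Memory (D' ℓ : ℕ) (scale thr : ℝ) (W : Finset V) (d : V → ℕ) (k f : ℕ)
    (s : Config V Y) : Prop where
  i0 : s.ireg 0 = D'
  i1 : s.ireg 1 = ℓ
  i2 : s.ireg 2 = 0
  i3 : s.ireg 3 = 1
  i7 : s.ireg 7 = k
  i8 : s.ireg 8 = D' + 2
  i9 : s.ireg 9 = D' + 1
  i11 : s.ireg 11 = f
  r5 : s.rreg 5 = scale
  r6 : s.rreg 6 = thr
  deg : s.ntab 0 = d
  cnt : ∀ j, s.itab 0 j = (W.filter (fun y => j ≤ d y)).card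
  cells : ∀ c ∈ s.written, AllowedCell W d c

variable {D' ℓ : ℕ} {scale thr : ℝ} {W : Finset V} {d : V → ℕ} {k f : ℕ}

namespace Memory

theorem congr {s s' : Config V Y} (h : Memory D' ℓ scale thr W d k f s) (hi : s'.ireg = s.ireg)
    (hr : s'.rreg = s.rreg) (ht : s'.itab = s.itab) (hn : s'.ntab = s.ntab)
    (hw : s'.written = s.written) : Memory D' ℓ scale thr W d k f s' := by
  obtain ⟨h0, h1, h2, h3, h7, h8, h9, h11, hr5, hr6, hdeg, hcnt, hcells⟩ := h
  rw [← hi] at h0 h1 h2 h3 h7 h8 h9 h11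
  rw [← hr] at hr5 hr6
  rw [← hn] at hdeg
  rw [← ht] at hcnt
  rw [← hw] at hcells
  exact ⟨h0, h1, h2, h3, h7, h8, h9, h11, hr5, hr6, hdeg, hcnt, hcells⟩

theorem wait {s : Config V Y} (h : Memory D' ℓ scale thr W d k f s) (n : ℕ) :
    Memory D' ℓ scale thr W d k f (s.wait n) := h.congr rfl rfl rfl rfl rfl

theorem setI {s : Config V Y} (h : Memory D' ℓ scale thr W d k f s) {i : ℕ} (n : ℕ)
    (hi : i ∈ [4, 5, 6, 10, 12]) : Memory D' ℓ scale thr W d k f (s.setI i n) := by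
  obtain ⟨h0, h1, h2, h3, h7, h8, h9, h11, hr5, hr6, hdeg, hcnt, hcells⟩ := h
  simp only [List.mem_cons, List.not_mem_nil, or_false] at hi
  have hu : ∀ j, j ≠ i → (s.setI i n).ireg j = s.ireg j := fun j hj =>
    Function.update_of_ne hj _ _
  refine ⟨?_, ?_, ?_, ?_, ?_, ?_, ?_, ?_, hr5, hr6, hdeg, hcnt, ?_⟩
  case refine_9 =>
    rintro c (rfl | hc)
    · change i < 13
      omega
    · exact hcells c hc
  all_goals rw [hu _ (by omega)]; assumption

theorem setR {s : Config V Y} (h : Memory D' ℓ scale thr W d k f s) {i : ℕ} (x : ℝ)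
    (hi : i ∈ [7, 8]) : Memory D' ℓ scale thr W d k f (s.setR i x) := by
  obtain ⟨h0, h1, h2, h3, h7, h8, h9, h11, hr5, hr6, hdeg, hcnt, hcells⟩ := h
  simp only [List.mem_cons, List.not_mem_nil, or_false] at hi
  have hu : ∀ j, j ≠ i → (s.setR i x).rreg j = s.rreg j := fun j hj =>
    Function.update_of_ne hj _ _
  refine ⟨h0, h1, h2, h3, h7, h8, h9, h11, ?_, ?_, hdeg, hcnt, ?_⟩
  case refine_3 =>
    rintro c (rfl | hc)
    · change i < 9
      omega
    · exact hcells c hc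
  all_goals rw [hu _ (by omega)]; assumption

theorem setBound {s : Config V Y} (h : Memory D' ℓ scale thr W d k f s) (k' : ℕ) :
    Memory D' ℓ scale thr W d k' f (s.setI 7 k') := by
  obtain ⟨h0, h1, h2, h3, h7, h8, h9, h11, hr5, hr6, hdeg, hcnt, hcells⟩ := h
  have hu : ∀ j, j ≠ 7 → (s.setI 7 k').ireg j = s.ireg j := fun j hj =>
    Function.update_of_ne hj _ _
  have hs : (s.setI 7 k').ireg 7 = k' := by simp [Config.setI]
  refine ⟨?_, ?_, ?_, ?_, hs, ?_, ?_, ?_, hr5, hr6, hdeg, hcnt, ?_⟩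
  case refine_8 =>
    rintro c (rfl | hc)
    · change 7 < 13
      omega
    · exact hcells c hc
  all_goals rw [hu _ (by omega)]; assumption

theorem setFlag {s : Config V Y} (h : Memory D' ℓ scale thr W d k f s) (f' : ℕ) :
    Memory D' ℓ scale thr W d k f' (s.setI 11 f') := by
  obtain ⟨h0, h1, h2, h3, h7, h8, h9, h11, hr5, hr6, hdeg, hcnt, hcells⟩ := h
  have hu : ∀ j, j ≠ 11 → (s.setI 11 f').ireg j = s.ireg j := fun j hj =>
    Function.update_of_ne hj _ _
  have hs : (s.setI 11 f').ireg 11 = f' := by simp [Config.setI]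
  refine ⟨?_, ?_, ?_, ?_, ?_, ?_, ?_, hs, hr5, hr6, hdeg, hcnt, ?_⟩
  case refine_8 =>
    rintro c (rfl | hc)
    · change 11 < 13
      omega
    · exact hcells c hc
  all_goals rw [hu _ (by omega)]; assumption

variable [DecidableEq V]

/-- A new node has degree `0`, so it is counted in entry `0` only. -/
theorem addNode {s : Config V Y} (h : Memory D' ℓ scale thr W d k f s) {y : V} (hy : y ∉ W)
    (hd : d y = 0) {a b : ℕ} (ha : a = 0) (hb : b = s.itab 0 0 + 1) :
    Memory D' ℓ scale thr (insert y W) d k f (s.setItab 0 a b) := by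
  subst ha hb
  obtain ⟨h0, h1, h2, h3, h7, h8, h9, h11, hr5, hr6, hdeg, hcnt, hcells⟩ := h
  refine ⟨h0, h1, h2, h3, h7, h8, h9, h11, hr5, hr6, hdeg, fun j => ?_, ?_⟩
  · change Function.update s.itab 0 (Function.update (s.itab 0) 0 (s.itab 0 0 + 1)) 0 j = _
    rw [Function.update_self, Finset.filter_insert, hd]
    by_cases hj : j = 0
    · subst hj
      rw [Function.update_self, if_pos le_rfl,
        Finset.card_insert_of_notMem fun h => hy (Finset.mem_filter.1 h).1, hcnt]
    · rw [Function.update_of_ne hj, if_neg (by omega), hcnt]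
  · rintro c (rfl | hc)
    · exact ⟨rfl, y, Finset.mem_insert_self _ _, Nat.zero_le _⟩
    · have := hcells c hc
      cases c with
      | ireg i => exact this
      | rreg i => exact this
      | itab tab j =>
        obtain ⟨ht, z, hz, hj⟩ := this
        exact ⟨ht, z, Finset.mem_insert_of_mem hz, hj⟩
      | ntab tab z => exact ⟨this.1, Finset.mem_insert_of_mem this.2⟩

/-- When one degree rises from `j` to `j + 1`, the only threshold newly reached is `j + 1`, so a
single table entry changes. -/
theorem bump {s : Config V Y} (h : Memory D' ℓ scale thr W d k f s) {x : V} (hx : x ∈ W)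
    {a a' b : ℕ} (ha : a = d x + 1) (ha' : a' = d x + 1) (hb : b = s.itab 0 (d x + 1) + 1) :
    Memory D' ℓ scale thr W (Function.update d x (d x + 1)) k f
      (((s.setNtab 0 x a).wait 1).setItab 0 a' b) := by
  subst ha ha' hb
  obtain ⟨h0, h1, h2, h3, h7, h8, h9, h11, hr5, hr6, hdeg, hcnt, hcells⟩ := h
  refine ⟨h0, h1, h2, h3, h7, h8, h9, h11, hr5, hr6, ?_, fun j => ?_, ?_⟩
  · change Function.update s.ntab 0 (Function.update (s.ntab 0) x (d x + 1)) 0 = _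
    rw [Function.update_self, hdeg]
  · change Function.update s.itab 0 (Function.update (s.itab 0) (d x + 1)
      (s.itab 0 (d x + 1) + 1)) 0 j = _
    rw [Function.update_self]
    by_cases hj : j = d x + 1
    · subst hj
      have hset : W.filter (fun y => d x + 1 ≤ Function.update d x (d x + 1) y) =
          insert x (W.filter (fun y => d x + 1 ≤ d y)) := by
        ext y
        by_cases hyx : y = x
        · subst hyx
          simp [hx]
        · simp [hyx]
      rw [Function.update_self, hcnt, hset, Finset.card_insert_of_notMem]
      simp
    · rw [Function.update_of_ne hj, hcnt]
      congr 1
      refine Finset.filter_congr fun y _ => ?_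
      by_cases hyx : y = x
      · subst hyx
        rw [Function.update_self]
        omega
      · rw [Function.update_of_ne hyx]
  · have hle : ∀ y, d y ≤ Function.update d x (d x + 1) y := by
      intro y
      by_cases hyx : y = x
      · subst hyx
        simp
      · simp [hyx]
    rintro c (rfl | rfl | hc)
    · exact ⟨rfl, x, hx, by simp⟩
    · exact ⟨rfl, hx⟩
    · have := hcells c hc
      cases c with
      | ireg i => exact this
      | rreg i => exact this
      | itab tab j =>
        obtain ⟨ht, z, hz, hj⟩ := this
        exact ⟨ht, z, hz, hj.trans (hle z)⟩
      | ntab tab z => exact this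

end Memory

end Memory

/-! ### Execution of the code blocks, with their costs. -/

section Semantics

variable {V : Type u} [DecidableEq V] {Y : Type v} [MeasurableSpace Y]
  {A : StreamAlg.{u, v, w} V Y} {ω : A.Coins} {ξ : ℕ → ℝ}

variable (A ω ξ) in
/-- The code `c`, started in `s`, terminates in a configuration that satisfies `Q`. -/
def Exec (c : Code) (s : Config V Y) (Q : Config V Y → Prop) : Prop :=
  ∃ s', Run A ω ξ c s s' ∧ Q s'

theorem exec_skip {s : Config V Y} {Q : Config V Y → Prop} (h : Q s) :
    Exec A ω ξ Code.skip s Q := ⟨s, Run.skip s, h⟩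

theorem exec_instr {i : Instr} {s : Config V Y} {Q : Config V Y → Prop}
    (h : Q ((i.effect A ω ξ s).wait 1)) : Exec A ω ξ (Code.instr i) s Q :=
  ⟨_, Run.instr i s, h⟩

theorem exec_seq {c c' : Code} {s : Config V Y} {Q : Config V Y → Prop}
    (h : Exec A ω ξ c s (fun s' => Exec A ω ξ c' s' Q)) : Exec A ω ξ (Code.seq c c') s Q := by
  obtain ⟨s', h1, s'', h2, h3⟩ := h
  exact ⟨s'', Run.seq h1 h2, h3⟩

theorem exec_block_nil {s : Config V Y} {Q : Config V Y → Prop} (h : Q s) :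
    Exec A ω ξ (block []) s Q := exec_skip h

theorem exec_block_cons {i : Instr} {is : List Instr} {s : Config V Y} {Q : Config V Y → Prop}
    (h : Exec A ω ξ (block is) ((i.effect A ω ξ s).wait 1) Q) :
    Exec A ω ξ (block (i :: is)) s Q := exec_seq (exec_instr h)

theorem exec_ite {b : Test} {c c' : Code} {s : Config V Y} {Q : Config V Y → Prop}
    (h : b.Holds s → Exec A ω ξ c (s.wait 1) Q) (h' : ¬ b.Holds s → Exec A ω ξ c' (s.wait 1) Q) :
    Exec A ω ξ (Code.ite b c c') s Q := by
  by_cases hb : b.Holds s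
  · obtain ⟨s', h1, h2⟩ := h hb
    exact ⟨s', Run.ite_true hb h1, h2⟩
  · obtain ⟨s', h1, h2⟩ := h' hb
    exact ⟨s', Run.ite_false hb h1, h2⟩

theorem Exec.mono {c : Code} {s : Config V Y} {Q Q' : Config V Y → Prop}
    (h : Exec A ω ξ c s Q) (hQ : ∀ s', Q s' → Q' s') : Exec A ω ξ c s Q' := by
  obtain ⟨s', h1, h2⟩ := h
  exact ⟨s', h1, hQ s' h2⟩

variable {D' ℓ : ℕ} {scale thr : ℝ} {W : Finset V} {d : V → ℕ} {k f : ℕ}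

theorem exec_bbNode {s : Config V Y} (h : Memory D' ℓ scale thr W d k f s) {y : V} (hy : y ∉ W)
    (hd : d y = 0) :
    Exec A ω ξ bbNode (Config.wait { s with item := some (y, y) } 1) (fun s' =>
      Memory D' ℓ scale thr (insert y W) d k f s' ∧
      s'.pending = (insert y s.pending.1, s.pending.2) ∧ Quiet s s' ∧
      s'.time = s.time + 5) := by
  refine exec_block_cons (exec_block_cons (exec_block_cons (exec_block_cons (exec_block_nil ?_))))
  refine ⟨?_, rfl, ⟨rfl, rfl, rfl, rfl⟩, rfl⟩
  have h1 : Memory D' ℓ scale thr W d k f (Config.wait { s with item := some (y, y) } 1) :=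
    h.congr rfl rfl rfl rfl rfl
  have h2 := (((h1.setI (i := 4) (s.itab 0 (s.ireg 2)) (by decide)).wait 1).setI (i := 4)
    (s.itab 0 (s.ireg 2) + s.ireg 3) (by decide)).wait 1
  refine (h2.addNode hy hd (a := s.ireg 2) (b := s.itab 0 (s.ireg 2) + s.ireg 3) h.i2
    (by rw [h.i2, h.i3]; rfl)).congr ?_ ?_ ?_ ?_ ?_ <;>
  simp [Instr.effect, Config.setI, Config.setItab, Config.wait]

theorem exec_bbBump {s : Config V Y} (h : Memory D' ℓ scale thr W d k f s) {snd : Bool} {p : V × V}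
    {x : V} (hs : s.item = some p) (hp : (if snd then p.2 else p.1) = x) (hx : x ∈ W) :
    Exec A ω ξ (bbBump snd) s (fun s' =>
      Memory D' ℓ scale thr W (Function.update d x (d x + 1)) k f s' ∧ SameState s s' ∧
      s'.time = s.time + 6) := by
  refine exec_block_cons (exec_block_cons (exec_block_cons (exec_block_cons (exec_block_cons
    (exec_block_cons (exec_block_nil ?_))))))
  have hdx : s.ntab 0 x = d x := congrFun h.deg x
  have h2 := (((((((h.setI (i := 5) (d x) (by decide)).wait 1).setI (i := 5)
    (d x + 1) (by decide)).wait 1).setI (i := 6) (s.itab 0 (d x + 1)) (by decide)).wait 1).setI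
      (i := 6) (s.itab 0 (d x + 1) + 1) (by decide)).wait 1
  have h3 := (h2.bump hx rfl rfl rfl).wait 1
  refine ⟨h3.congr ?_ ?_ ?_ ?_ ?_, ⟨?_, ?_, ⟨?_, ?_, ?_, ?_⟩⟩, ?_⟩ <;>
  simp [Instr.effect, Config.setI, Config.setItab, Config.setNtab, Config.wait, Config.node,
    hs, hp, hdx, h.i3]

theorem exec_bbEdge {s : Config V Y} (h : Memory D' ℓ scale thr W d k f s) {p : V × V}
    (hp : p.1 ≠ p.2) (h1 : p.1 ∈ W) (h2 : p.2 ∈ W) :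
    Exec A ω ξ bbEdge (Config.wait { s with item := some p } 1) (fun s' =>
      Memory D' ℓ scale thr W (projEdge D' (d, s.pending.2) p).1 k f s' ∧
      s'.pending = (s.pending.1, (projEdge D' (d, s.pending.2) p).2) ∧ Quiet s s' ∧ s'.time ≤ s.time + 18) := by
  -- The endpoints are distinct, so two successive increments agree with the simultaneous one of
  -- `projEdge`.
  have hd : (projEdge D' (d, s.pending.2) p).1 =
      Function.update (Function.update d p.1 (d p.1 + 1)) p.2
        (Function.update d p.1 (d p.1 + 1) p.2 + 1) := by
    funext y
    simp only [projEdge]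
    by_cases hy2 : y = p.2
    · subst hy2
      simp [hp.symm]
    · by_cases hy1 : y = p.1
      · subst hy1
        simp [hp]
      · simp [hy1, hy2]
  rw [hd]
  set E := (projEdge D' (d, s.pending.2) p).2 with hE
  have hdx : s.ntab 0 = d := h.deg
  have key : ∀ s₁ : Config V Y, Memory D' ℓ scale thr W d k f s₁ → s₁.item = some p →
      s₁.pending = (s.pending.1, E) → Quiet s s₁ → s₁.time ≤ s.time + 6 →
      Exec A ω ξ (Code.seq (bbBump false) (bbBump true)) s₁ (fun s' =>
        Memory D' ℓ scale thr W (Function.update (Function.update d p.1 (d p.1 + 1)) p.2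
          (Function.update d p.1 (d p.1 + 1) p.2 + 1)) k f s' ∧
        s'.pending = (s.pending.1, E) ∧ Quiet s s' ∧ s'.time ≤ s.time + 18) := by
    intro s₁ hm hi hpend hq ht
    refine exec_seq ((exec_bbBump (snd := false) hm hi rfl h1).mono ?_)
    rintro s₂ ⟨hm₂, hio₂, ht₂⟩
    refine (exec_bbBump (snd := true) hm₂ (hio₂.1.trans hi) rfl h2).mono ?_
    rintro s₃ ⟨hm₃, hio₃, ht₃⟩
    obtain ⟨-, e1, e2⟩ := hio₂.trans hio₃
    exact ⟨hm₃, e1.trans hpend, hq.trans e2, by omega⟩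
  have hm : Memory D' ℓ scale thr W d k f (Config.wait { s with item := some p } 1) :=
    h.congr rfl rfl rfl rfl rfl
  have hm' := ((((hm.setI (i := 4) (s.ntab 0 p.1) (by decide)).wait 1).setI (i := 5)
    (s.ntab 0 p.2) (by decide)).wait 1).wait 1
  refine exec_seq (exec_block_cons (exec_block_cons (exec_block_nil (exec_seq
    (exec_ite (fun hle => exec_skip ?_) (fun hle => exec_ite (fun hle' => exec_skip ?_)
      (fun hle' => exec_instr ?_)))))))
  all_goals
    simp [Test.Holds, Instr.effect, Config.setI, Config.wait, Config.node, h.i0, hdx] at hle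
  · refine key _ (hm'.congr ?_ ?_ ?_ ?_ ?_) ?_ ?_ ⟨?_, ?_, ?_, ?_⟩ ?_ <;>
    simp [Instr.effect, Config.setI, Config.wait, Config.node, hE, projEdge, hle.not_gt]
  · simp [Test.Holds, Instr.effect, Config.setI, Config.wait, Config.node, h.i0, hdx] at hle'
    refine key _ ((hm'.wait 1).congr ?_ ?_ ?_ ?_ ?_) ?_ ?_ ⟨?_, ?_, ?_, ?_⟩ ?_ <;>
    simp [Instr.effect, Config.setI, Config.wait, Config.node, hE, projEdge, hle'.not_gt]
  · simp [Test.Holds, Instr.effect, Config.setI, Config.wait, Config.node, h.i0, hdx] at hle'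
    refine key _ ((hm'.wait 1).congr ?_ ?_ ?_ ?_ ?_) ?_ ?_ ⟨?_, ?_, ?_, ?_⟩ ?_ <;>
    simp [Instr.effect, Config.setI, Config.wait, Config.node, hE, projEdge, hle, hle']

/-- The condition that `bbCheck` evaluates. -/
def CanDecrease (D' ℓ : ℕ) (W : Finset V) (d : V → ℕ) (k : ℕ) : Prop :=
  1 ≤ k ∧ D' + 2 ≤ W.card + (k - 1) ∧
    ℓ ≤ (W.filter (fun y => D' + 1 - (k - 1) ≤ d y)).card + (k - 1)

theorem exec_bbCheck {s : Config V Y} (h : Memory D' ℓ scale thr W d k f s) :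
    Exec A ω ξ bbCheck s (fun s' => Memory D' ℓ scale thr W d k f s' ∧ SameState s s' ∧
      (1 ≤ s'.ireg 10 ↔ CanDecrease D' ℓ W d k) ∧ s'.time ≤ s.time + 11) := by
  have hn : s.itab 0 0 = W.card := by rw [h.cnt]; simp
  have m1 := ((h.setI (i := 10) 0 (by decide)).wait 1).wait 1
  have m2 := (((((m1.setI (i := 12) (k - 1) (by decide)).wait 1).setI (i := 4) W.card
    (by decide)).wait 1).setI (i := 4) (W.card + (k - 1)) (by decide)).wait 1
  have m3 := ((((((m2.wait 1).setI (i := 4) (D' + 1 - (k - 1)) (by decide)).wait 1).setI (i := 4)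
    (s.itab 0 (D' + 1 - (k - 1))) (by decide)).wait 1).setI (i := 4)
      (s.itab 0 (D' + 1 - (k - 1)) + (k - 1)) (by decide)).wait 1
  refine exec_seq (exec_block_cons (exec_block_nil (exec_ite (fun c1 => exec_seq
    (exec_block_cons (exec_block_cons (exec_block_cons (exec_block_nil (exec_ite (fun c2 =>
      exec_seq (exec_block_cons (exec_block_cons (exec_block_cons (exec_block_nil (exec_ite
        (fun c3 => exec_block_cons (exec_block_nil ?_)) (fun c3 => exec_skip ?_)))))))
      (fun c2 => exec_skip ?_)))))))
    (fun c1 => exec_skip ?_))))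
  · simp [Test.Holds, Instr.effect, Config.setI, Config.wait, h.i1, h.i2, h.i3, h.i7, h.i8, h.i9,
      hn] at c1 c2 c3
    refine ⟨(((m3.wait 1).setI (i := 10) 1 (by decide)).wait 1).congr ?_ ?_ ?_ ?_ ?_,
      ⟨?_, ?_, ⟨?_, ?_, ?_, ?_⟩⟩, iff_of_true (by
        simp [Instr.effect, Config.setI, Config.wait]) ⟨c1, c2, h.cnt _ ▸ c3⟩, ?_⟩
    all_goals simp [Instr.effect, Config.setI, Config.wait, h.i2, h.i3, h.i7, h.i9, hn]
  · simp [Test.Holds, Instr.effect, Config.setI, Config.wait, h.i1, h.i2, h.i3, h.i7, h.i8, h.i9,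
      hn] at c1 c2 c3
    refine ⟨(m3.wait 1).congr ?_ ?_ ?_ ?_ ?_,
      ⟨?_, ?_, ⟨?_, ?_, ?_, ?_⟩⟩, iff_of_false (by
        simp [Instr.effect, Config.setI, Config.wait]) fun hd => not_le.2 c3 (h.cnt _ ▸ hd.2.2), ?_⟩
    all_goals simp [Instr.effect, Config.setI, Config.wait, h.i2, h.i3, h.i7, h.i9, hn]
  · simp [Test.Holds, Instr.effect, Config.setI, Config.wait, h.i2, h.i3, h.i7, h.i8, hn] at c1 c2
    refine ⟨(m2.wait 1).congr ?_ ?_ ?_ ?_ ?_,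
      ⟨?_, ?_, ⟨?_, ?_, ?_, ?_⟩⟩, iff_of_false (by
        simp [Instr.effect, Config.setI, Config.wait]) fun hd => not_le.2 c2 hd.2.1, ?_⟩
    all_goals simp [Instr.effect, Config.setI, Config.wait, h.i2, h.i3, h.i7, hn]
  · simp [Test.Holds, Instr.effect, Config.setI, Config.wait, h.i3, h.i7] at c1
    refine ⟨m1.congr ?_ ?_ ?_ ?_ ?_,
      ⟨?_, ?_, ⟨?_, ?_, ?_, ?_⟩⟩, iff_of_false (by
        simp [Instr.effect, Config.setI, Config.wait]) fun hd => absurd hd.1 (by omega), ?_⟩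
    all_goals simp [Instr.effect, Config.setI, Config.wait]

/-- Each round lowers the bound by one, and a round costs one step for the loop test, one for the
subtraction and at most `11` for the check. The cost is charged to the decrease of the bound. -/
theorem exec_loop (k₀ : ℕ) (n : ℕ) {s : Config V Y}
    (hc : ∀ j ≤ k, CanDecrease D' ℓ W d j ↔ k₀ < j) (hk : k = k₀ + n)
    (h : Memory D' ℓ scale thr W d k f s) (hs : 1 ≤ s.ireg 10 ↔ CanDecrease D' ℓ W d k) :
    Exec A ω ξ (Code.loop (.ile 3 10) (Code.seq (Code.instr (.isub 7 7 3)) bbCheck)) s (fun s' =>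
      Memory D' ℓ scale thr W d k₀ f s' ∧ SameState s s' ∧ s'.time ≤ s.time + 1 + 13 * n) := by
  induction n generalizing s k with
  | zero =>
    subst hk
    refine ⟨_, Run.loop_false ?_, h.wait 1, ⟨rfl, rfl, ⟨rfl, rfl, rfl, rfl⟩⟩, le_rfl⟩
    simp only [Test.Holds]
    rw [h.i3, hs, hc _ le_rfl]
    omega
  | succ n ih =>
    have hb : Test.Holds s (.ile 3 10) := by
      simp only [Test.Holds]
      rw [h.i3, hs, hc _ le_rfl]
      omega
    have h1 : Memory D' ℓ scale thr W d (k - 1) f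
        ((Instr.effect A ω ξ (s.wait 1) (.isub 7 7 3)).wait 1) := by
      have e : Instr.effect A ω ξ (s.wait 1) (.isub 7 7 3) = (s.wait 1).setI 7 (k - 1) := by
        simp [Instr.effect, Config.wait, h.i3, h.i7]
      rw [e]
      exact ((h.wait 1).setBound (k - 1)).wait 1
    obtain ⟨s₁, r1, m1, io1, c1, t1⟩ := exec_bbCheck (A := A) (ω := ω) (ξ := ξ) h1
    obtain ⟨s₂, r2, m2, io2, t2⟩ := ih (k := k - 1)
      (fun j hj => hc j (hj.trans (Nat.sub_le _ _))) (by omega) m1 c1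
    refine ⟨s₂, Run.loop_true hb (Run.seq (Run.instr _ _) r1) r2, m2, SameState.trans ?_ io2, ?_⟩
    · exact SameState.trans ⟨rfl, rfl, ⟨rfl, rfl, rfl, rfl⟩⟩ io1
    · have : ((Instr.effect A ω ξ (s.wait 1) (.isub 7 7 3)).wait 1).time = s.time + 2 := rfl
      omega

theorem exec_bbSearch (k₀ : ℕ) {s : Config V Y}
    (hc : ∀ j ≤ k, CanDecrease D' ℓ W d j ↔ k₀ < j) (hk : k₀ ≤ k) (h : Memory D' ℓ scale thr W d k f s) :
    Exec A ω ξ bbSearch s (fun s' => Memory D' ℓ scale thr W d k₀ f s' ∧ SameState s s' ∧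
      s'.time ≤ s.time + 12 + 13 * (k - k₀)) := by
  refine exec_seq ((exec_bbCheck h).mono ?_)
  rintro s₁ ⟨m1, io1, c1, t1⟩
  refine (exec_loop k₀ (k - k₀) hc (by omega) m1 c1).mono ?_
  rintro s₂ ⟨m2, io2, t2⟩
  exact ⟨m2, io1.trans io2, by omega⟩

theorem exec_bbAnswer {s : Config V Y} (h : Memory D' ℓ scale thr W d k f s) {F : Prop}
    (hF : F ↔ thr ≤ scale * ξ s.draws - k ∨ 1 ≤ f) :
    Exec A ω ξ bbAnswer s (fun s' => (∃ f', Memory D' ℓ scale thr W d k f' s' ∧ (1 ≤ f' ↔ F)) ∧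
      s'.draws = s.draws + 1 ∧
      (F → s'.out = s.out ++ [Sum.inr ()] ∧ s'.baseSpace = s.baseSpace ∧ s'.time ≤ s.time + 7) ∧
      (¬ F → s'.out = s.out ++ [Sum.inl (A.out ω (s.history ++ [s.pending]))] ∧
        s'.history = s.history ++ [s.pending] ∧
        s'.baseSpace = max s.baseSpace (A.stepSpace ω (s.history ++ [s.pending])) ∧
        s'.time ≤ s.time + A.stepTime ω (s.history ++ [s.pending]) + 7)) := by
  have m1 : Memory D' ℓ scale thr W d k f
      (Instr.effect A ω ξ (Config.wait (Instr.effect A ω ξ (Config.wait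
        (Instr.effect A ω ξ s (.rofint 7 7)) 1) (.draw 8 5)) 1) (.rsub 8 8 7)) := by
    have m := ((((h.setR (i := 7) k (by decide)).wait 1).setR (i := 8) (scale * ξ s.draws)
      (by decide)).wait 1).setR (i := 8) (scale * ξ s.draws - k) (by decide)
    refine m.congr ?_ ?_ ?_ ?_ ?_ <;>
    simp [Instr.effect, Config.setR, Config.wait, h.i7, h.r5]
  set s₁ := Instr.effect A ω ξ (Config.wait (Instr.effect A ω ξ (Config.wait
        (Instr.effect A ω ξ s (.rofint 7 7)) 1) (.draw 8 5)) 1) (.rsub 8 8 7) with hs₁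
  have r8 : s₁.rreg 8 = scale * ξ s.draws - k := by
    simp [hs₁, Instr.effect, Config.setR, Config.wait, h.i7, h.r5]
  have e1 : s₁.draws = s.draws + 1 := rfl
  have e2 : s₁.out = s.out := rfl
  have e3 : s₁.history = s.history := rfl
  have e4 : s₁.pending = s.pending := rfl
  have e5 : s₁.baseSpace = s.baseSpace := rfl
  have e6 : s₁.time = s.time + 2 := rfl
  clear_value s₁
  have key : ∀ (s₂ : Config V Y) (f' : ℕ), Memory D' ℓ scale thr W d k f' s₂ → (1 ≤ f' ↔ F) →
      SameState s₁ s₂ → s₂.time ≤ s₁.time + 3 →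
      Exec A ω ξ (Code.ite (.ile 3 11) (Code.instr .emitBot) (Code.instr .emitBase)) s₂
        (fun s' => (∃ f', Memory D' ℓ scale thr W d k f' s' ∧ (1 ≤ f' ↔ F)) ∧
      s'.draws = s.draws + 1 ∧
      (F → s'.out = s.out ++ [Sum.inr ()] ∧ s'.baseSpace = s.baseSpace ∧ s'.time ≤ s.time + 7) ∧
      (¬ F → s'.out = s.out ++ [Sum.inl (A.out ω (s.history ++ [s.pending]))] ∧
        s'.history = s.history ++ [s.pending] ∧
        s'.baseSpace = max s.baseSpace (A.stepSpace ω (s.history ++ [s.pending])) ∧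
        s'.time ≤ s.time + A.stepTime ω (s.history ++ [s.pending]) + 7)) := by
    intro s₂ f' m2 hf' ⟨_, b1, b2, b3, b4, b5⟩ ht
    rw [e4] at b1
    rw [e1] at b2
    rw [e3] at b3
    rw [e2] at b4
    rw [e5] at b5
    refine exec_ite (fun hb => exec_instr ?_) (fun hb => exec_instr ?_)
    all_goals
      simp only [Test.Holds, m2.i3, m2.i11, hf'] at hb
    · refine ⟨⟨f', m2.congr rfl rfl rfl rfl rfl, hf'⟩, b2, fun _ => ⟨?_, b5, ?_⟩,
        fun h => absurd hb h⟩
      · simp [Instr.effect, Config.wait, b4]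
      · simp only [Instr.effect, Config.wait]
        omega
    · refine ⟨⟨f', m2.congr rfl rfl rfl rfl rfl, hf'⟩, b2, fun h => absurd h hb,
        fun _ => ⟨?_, ?_, ?_, ?_⟩⟩
      · simp [Instr.effect, Config.wait, b1, b3, b4]
      · simp [Instr.effect, Config.wait, b1, b3]
      · simp [Instr.effect, Config.wait, b1, b3, b5]
      · simp only [Instr.effect, Config.wait, b1, b3]
        omega
  refine exec_seq (exec_block_cons (exec_block_cons (exec_block_cons (exec_block_nil
    (exec_seq ?_)))))
  rw [← hs₁]
  refine exec_ite (fun hb => exec_instr ?_) (fun hb => exec_skip ?_)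
  all_goals
    replace hb : _ := hb
    simp only [Test.Holds, Config.wait, m1.r6, r8] at hb
  · exact key _ 1 ((((m1.wait 1).wait 1).setFlag 1).wait 1) (by simp [hF, hb])
      ⟨rfl, rfl, ⟨rfl, rfl, rfl, rfl⟩⟩ le_rfl
  · exact key _ f ((m1.wait 1).wait 1) (by simp [hF, hb]) ⟨rfl, rfl, ⟨rfl, rfl, rfl, rfl⟩⟩
      (Nat.le_succ _)

theorem exec_bbStart {ε τ : ℝ} :
    Exec A ω ξ bbStart (initial V Y D' ℓ ε τ) (fun s =>
      Memory D' ℓ (svtQueryScale 1 ε) (τ + svtThresholdScale ε * ξ 0) ∅ (fun _ => 0)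
        (if ℓ = 0 then 0 else D' + 2) 0 s ∧ s.draws = 1 ∧ s.history = [] ∧ s.out = [] ∧
      s.baseSpace = 0 ∧ s.time ≤ 12) := by
  refine exec_seq (exec_block_cons (exec_block_cons (exec_block_cons (exec_block_nil (exec_seq
    (exec_ite (fun hb => exec_skip ?_) (fun hb => exec_instr ?_)))))))
  all_goals
    simp [Test.Holds, Instr.effect, Config.wait, Config.setI, initial] at hb
    refine exec_block_cons (exec_block_cons (exec_block_cons (exec_block_cons (exec_block_cons
      (exec_block_cons (exec_block_cons (exec_block_nil ?_)))))))
    refine ⟨⟨?_, ?_, ?_, ?_, ?_, ?_, ?_, ?_, ?_, ?_, ?_, ?_, ?_⟩, ?_, ?_, ?_, ?_, ?_⟩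
  all_goals
    simp [Instr.effect, Config.wait, Config.setI, Config.setR, initial, hb, svtQueryScale,
      svtThresholdScale, AllowedCell, one_add_one_eq_two]

end Semantics

end StreamRAM

namespace StreamRAM

/-! ### Lists of input items, and the space bound. -/

section Items

variable {V : Type u} [DecidableEq V] {Y : Type v} [MeasurableSpace Y]
  {A : StreamAlg.{u, v, w} V Y} {ω : A.Coins} {ξ : ℕ → ℝ} {D' ℓ : ℕ} {scale thr : ℝ}
  {k f : ℕ}

theorem runItems_bbNode {d : V → ℕ} (ys : List V) (hys : ys.Nodup) {W : Finset V}
    (hW : ∀ y ∈ ys, y ∉ W) (hd : ∀ y ∈ ys, d y = 0) {s : Config V Y}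
    (h : Memory D' ℓ scale thr W d k f s) :
    ∃ s', RunItems A ω ξ bbNode (ys.map (fun y => (y, y))) s s' ∧
      Memory D' ℓ scale thr (W ∪ ys.toFinset) d k f s' ∧
      s'.pending = (s.pending.1 ∪ ys.toFinset, s.pending.2) ∧ Quiet s s' ∧
      s'.time = s.time + 5 * ys.length := by
  induction ys generalizing W s with
  | nil =>
    refine ⟨s, RunItems.nil s, ?_, ?_, ⟨rfl, rfl, rfl, rfl⟩, rfl⟩
    · simpa using h
    · simp
  | cons y ys ih =>
    rw [List.nodup_cons] at hys
    obtain ⟨s₁, r1, m1, p1, q1, t1⟩ := exec_bbNode (A := A) (ω := ω) (ξ := ξ) h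
      (hW y (by simp)) (hd y (by simp))
    obtain ⟨s₂, r2, m2, p2, q2, t2⟩ := ih hys.2 (W := insert y W) (s := s₁) (by
      intro z hz
      rw [Finset.mem_insert, not_or]
      exact ⟨fun h => hys.1 (h ▸ hz), hW z (List.mem_cons_of_mem _ hz)⟩)
      (fun z hz => hd z (List.mem_cons_of_mem _ hz)) m1
    refine ⟨s₂, RunItems.cons r1 r2, ?_, ?_, q1.trans q2, ?_⟩
    · rwa [List.toFinset_cons, Finset.union_insert, ← Finset.insert_union]
    · rw [p2, p1, List.toFinset_cons, Finset.union_insert, Finset.insert_union]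
    · rw [t2, t1, List.length_cons]
      ring

theorem runItems_bbEdge (L : List (V × V)) {W : Finset V} (hne : ∀ p ∈ L, p.1 ≠ p.2)
    (hW : ∀ p ∈ L, p.1 ∈ W ∧ p.2 ∈ W) {d : V → ℕ} {s : Config V Y}
    (h : Memory D' ℓ scale thr W d k f s) :
    ∃ s', RunItems A ω ξ bbEdge L s s' ∧
      Memory D' ℓ scale thr W (L.foldl (projEdge D') (d, s.pending.2)).1 k f s' ∧
      s'.pending = (s.pending.1, (L.foldl (projEdge D') (d, s.pending.2)).2) ∧ Quiet s s' ∧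
      s'.time ≤ s.time + 18 * L.length := by
  induction L generalizing d s with
  | nil => exact ⟨s, RunItems.nil s, h, rfl, ⟨rfl, rfl, rfl, rfl⟩, le_rfl⟩
  | cons p L ih =>
    obtain ⟨s₁, r1, m1, p1, q1, t1⟩ := exec_bbEdge (A := A) (ω := ω) (ξ := ξ) h
      (hne p (by simp)) (hW p (by simp)).1 (hW p (by simp)).2
    obtain ⟨s₂, r2, m2, p2, q2, t2⟩ := ih (fun z hz => hne z (List.mem_cons_of_mem _ hz))
      (fun z hz => hW z (List.mem_cons_of_mem _ hz)) m1
    rw [p1] at m2 p2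
    refine ⟨s₂, RunItems.cons r1 r2, m2, p2, q1.trans q2, ?_⟩
    rw [List.length_cons]
    omega

end Items

theorem RunStream.concat {V : Type u} [LinearOrder V] {Y : Type v} [MeasurableSpace Y]
    {A : StreamAlg.{u, v, w} V Y} {ω : A.Coins} {ξ : ℕ → ℝ} {P : Program}
    {xs : List (Arrival V)} {x : Arrival V} {s s' s'' : Config V Y}
    (h : RunStream A ω ξ P xs s s') (h' : RunArrival A ω ξ P x s' s'') :
    RunStream A ω ξ P (xs ++ [x]) s s'' := by
  induction h with
  | nil s => exact RunStream.cons h' (RunStream.nil _)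
  | cons r _ ih => exact RunStream.cons r (ih h')

/-- Degrees are less than the number of nodes, so the table keyed by degrees is no larger than the
one keyed by nodes. The registers are `13 + 9 = 22` cells. -/
theorem ncard_le_of_allowedCell {V : Type u} {G : FinGraph V} [DecidableEq V] {w : Set (Cell V)}
    (h : ∀ c ∈ w, AllowedCell G.verts G.degree c) : w.ncard ≤ 22 * (G.verts.card + 1) := by
  classical
  set F : Finset (Cell V) := (Finset.range 13).image Cell.ireg ∪ (Finset.range 9).image Cell.rreg ∪
    (Finset.range G.verts.card).image (Cell.itab 0) ∪ G.verts.image (Cell.ntab 0)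
  have hsub : w ⊆ F := by
    intro c hc
    have := h c hc
    cases c with
    | ireg i =>
      have : i < 13 := this
      simp [F, this]
    | rreg i =>
      have : i < 9 := this
      simp [F, this]
    | itab tab j =>
      obtain ⟨rfl, y, hy, hj⟩ := this
      have : j < G.verts.card := hj.trans_lt (G.degree_lt_card hy)
      simp [F, this]
    | ntab tab y =>
      obtain ⟨rfl, hy⟩ := this
      simp [F, hy]
  have h1 := Set.ncard_le_ncard hsub F.finite_toSet
  rw [Set.ncard_coe_finset] at h1
  have h2 : F.card ≤ 13 + 9 + G.verts.card + G.verts.card := by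
    refine (Finset.card_union_le _ _).trans (add_le_add ((Finset.card_union_le _ _).trans
      (add_le_add ((Finset.card_union_le _ _).trans (add_le_add ?_ ?_)) ?_)) Finset.card_image_le)
    · exact Finset.card_image_le.trans (Finset.card_range 13).le
    · exact Finset.card_image_le.trans (Finset.card_range 9).le
    · exact Finset.card_image_le.trans (Finset.card_range _).le
  omega

end StreamRAM

/-! ### The distance as the search finds it. -/

namespace FinGraph

variable {V : Type u} [DecidableEq V]

theorem reach_eq_zero {D k : ℕ} {G : FinGraph V} (h : G.verts.card + k < D + 2) :
    reach D G k = 0 := by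
  unfold reach
  rw [if_neg (by omega), add_zero, Finset.card_eq_zero, Finset.filter_eq_empty_iff]
  intro x hx
  have := G.degree_lt_card hx
  omega

theorem reach_eq {D k : ℕ} {G : FinGraph V} (h : D + 2 ≤ G.verts.card + k) :
    reach D G k = (G.verts.filter (fun x => D + 1 - k ≤ G.degree x)).card + k := by
  unfold reach
  rw [if_pos (by omega)]
  congr 2
  refine Finset.filter_congr fun x _ => ?_
  omega

/-- The search evaluates whether the distance is less than `k`. -/
theorem canDecrease_iff [Infinite V] {D ℓ k : ℕ} (G : FinGraph V) (h : ℓ ≠ 0 ∨ k = 0) :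
    StreamRAM.CanDecrease D ℓ G.verts G.degree k ↔ distToGraph D ℓ G < k := by
  unfold StreamRAM.CanDecrease
  cases k with
  | zero => simp
  | succ k =>
    rw [Nat.add_sub_cancel, Nat.lt_succ_iff, distToGraph_le_iff]
    by_cases hn : D + 2 ≤ G.verts.card + k
    · rw [reach_eq hn]
      exact ⟨fun h => h.2.2, fun h => ⟨by omega, hn, h⟩⟩
    · rw [reach_eq_zero (by omega)]
      constructor
      · exact fun h => absurd h.2.1 hn
      · intro h'
        omega

theorem le_card_add_distToGraph [Infinite V] {D ℓ : ℕ} (G : FinGraph V) (hℓ : ℓ ≠ 0) :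
    D + 2 ≤ G.verts.card + distToGraph D ℓ G := by
  by_contra! h
  have h1 := (distToGraph_le_iff (D := D) (ℓ := ℓ) G _).1 le_rfl
  rw [reach_eq_zero h] at h1
  omega

theorem distToGraph_anti [Infinite V] {D ℓ : ℕ} {G G' : FinGraph V} (hv : G.verts ⊆ G'.verts)
    (hd : ∀ x, G.degree x ≤ G'.degree x) : distToGraph D ℓ G' ≤ distToGraph D ℓ G := by
  rw [distToGraph_le_iff]
  refine ((distToGraph_le_iff (D := D) (ℓ := ℓ) G _).1 le_rfl).trans (add_le_add ?_ ?_)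
  · refine Finset.card_le_card fun x hx => ?_
    rw [Finset.mem_filter] at hx ⊢
    have := hd x
    exact ⟨hv hx.1, by omega⟩
  · have := Finset.card_le_card hv
    split_ifs <;> omega

end FinGraph

namespace StreamAlg

variable {V : Type u} {Y : Type v} [MeasurableSpace Y] (A : StreamAlg.{u, v, w} V Y)
  (ω : A.Coins)

theorem runtime_take_succ {xs : List (Arrival V)} {t : ℕ} (h : t < xs.length) :
    A.runtime ω (xs.take (t + 1)) = A.runtime ω (xs.take t) + A.stepTime ω (xs.take (t + 1)) := by
  unfold runtime
  rw [List.length_take, List.length_take, Nat.min_eq_left h, Nat.min_eq_left h.le,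
    Finset.sum_range_succ, List.take_take, Nat.min_self]
  congr 1
  refine Finset.sum_congr rfl fun i hi => ?_
  rw [Finset.mem_range] at hi
  rw [List.take_take, List.take_take, Nat.min_eq_left (by omega), Nat.min_eq_left (by omega)]

theorem space_take_succ {xs : List (Arrival V)} {t : ℕ} (h : t < xs.length) :
    A.space ω (xs.take (t + 1)) =
      max (A.space ω (xs.take t)) (A.stepSpace ω (xs.take (t + 1))) := by
  unfold space
  rw [List.length_take, List.length_take, Nat.min_eq_left h, Nat.min_eq_left h.le,
    Finset.range_add_one, Finset.sup_insert, List.take_take, Nat.min_self, sup_comm]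
  congr 1
  refine Finset.sup_congr rfl fun i hi => ?_
  rw [Finset.mem_range] at hi
  rw [List.take_take, List.take_take, Nat.min_eq_left (by omega), Nat.min_eq_left (by omega)]

end StreamAlg

namespace StreamRAM

section Invariant

variable {V : Type u} [LinearOrder V] {Y : Type v} [MeasurableSpace Y] {T : ℕ}

/-- The noise that the program draws. -/
noncomputable def noise (T : ℕ) (ε : ℝ) (ξ : ℕ → ℝ) : ℝ × (Fin T → ℝ) :=
  (svtThresholdScale ε * ξ 0, fun i => svtQueryScale 1 ε * ξ (i + 1))

/-- The initial upper bound on the distance. -/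
def initialBound (D' ℓ : ℕ) : ℕ := if ℓ = 0 then 0 else D' + 2

/-- What holds after `t` time steps. -/
structure Invariant (A : StreamAlg.{u, v, w} V Y) (ω : A.Coins) (ξ : ℕ → ℝ) (D' ℓ : ℕ)
    (ε τ : ℝ) (S : GraphStream V T) (t k f : ℕ) (s : Config V Y) : Prop where
  mem : Memory D' ℓ (svtQueryScale 1 ε) (τ + svtThresholdScale ε * ξ 0) (S.flat t).verts
    (S.flat t).degree k f s
  dist_le : (S.flat t).distToGraph D' ℓ ≤ k
  le_bound : k ≤ initialBound D' ℓ
  bound_le : initialBound D' ℓ ≤ (S.flat t).verts.card + k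
  failed : 1 ≤ f ↔ ¬ ∀ r : Fin T, (r : ℕ) < t → svtBelow τ (bbQuery D' ℓ S) (noise T ε ξ) r
  draws : s.draws = t + 1
  out : s.out = (List.ofFn (gated τ (bbQuery D' ℓ S) (A.outputOn T (proj D' S.toList))
    (ω, noise T ε ξ))).take t
  history : ¬ 1 ≤ f → s.history = (proj D' S.toList).take t
  space : s.baseSpace ≤ A.space ω ((proj D' S.toList).take t)
  time : s.time ≤ A.runtime ω ((proj D' S.toList).take t) + 12
    + 20 * ((S.flat t).verts.card + (S.flat t).edges.card + t) + 13 * (initialBound D' ℓ - k)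

variable {A : StreamAlg.{u, v, w} V Y} {ω : A.Coins} {ξ : ℕ → ℝ} {D' ℓ : ℕ} {ε τ : ℝ}
  {S : GraphStream V T}

theorem invariant_start [Infinite V] (hℓ : ℓ ≤ D') :
    ∃ s, Run A ω ξ bbProgram.start (initial V Y D' ℓ ε τ) s ∧
      Invariant A ω ξ D' ℓ ε τ S 0 (initialBound D' ℓ) 0 s := by
  obtain ⟨s, r, m, h1, h2, h3, h4, h5⟩ := exec_bbStart (A := A) (ω := ω) (ξ := ξ) (D' := D')
    (ℓ := ℓ) (ε := ε) (τ := τ)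
  have hv : (S.flat 0).verts = ∅ := by simp [GraphStream.flat]
  have hd : (S.flat 0).degree = fun _ => 0 := by
    funext y
    simp [GraphStream.flat, FinGraph.degree]
  refine ⟨s, r, ⟨?_, ?_, le_rfl, Nat.le_add_left _ _, ?_, h1, ?_, ?_, ?_, ?_⟩⟩
  · rw [hv, hd]
    exact m
  · rw [FinGraph.distToGraph_le_iff]
    unfold initialBound
    split_ifs with h
    · omega
    · rw [FinGraph.reach, if_pos (by omega)]
      omega
  · simp
  · simp [h3]
  · simp [h2]
  · rw [h4]
    exact Nat.zero_le _
  · omega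

theorem invariant_step [Infinite V] {k f : ℕ} {t : Fin T} {s : Config V Y}
    (h : Invariant A ω ξ D' ℓ ε τ S t k f s) :
    ∃ s' k' f', RunArrival A ω ξ bbProgram (S.nodes t, S.edges t) s s' ∧
      Invariant A ω ξ D' ℓ ε τ S (t + 1) k' f' s' := by
  set G := S.flat (t + 1) with hG
  have hV := S.flat_succ_verts t
  have hE := S.flat_succ_edges t
  obtain ⟨s₁, r1, m1, p1, q1, t1⟩ := runItems_bbNode (A := A) (ω := ω) (ξ := ξ)
    (S.nodes t).sort (Finset.sort_nodup _ _) (W := (S.flat t).verts) (d := (S.flat t).degree)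
    (s := { s with pending := (∅, ∅) })
    (fun y hy => Finset.disjoint_right.1 (S.flat_verts_disjoint t) ((Finset.mem_sort _).1 hy))
    (fun y hy => GraphStream.degree_eq_zero_of_notMem _
      (Finset.disjoint_right.1 (S.flat_verts_disjoint t) ((Finset.mem_sort _).1 hy)))
    (h.mem.congr rfl rfl rfl rfl rfl)
  rw [Finset.sort_toFinset] at m1 p1
  rw [← hV] at m1
  rw [Finset.length_sort] at t1
  simp only [Finset.empty_union] at p1
  have hlist := edgeList_orderedEdges (S.no_loops t)
  obtain ⟨s₂, r2, m2, p2, q2, t2⟩ := runItems_bbEdge (A := A) (ω := ω) (ξ := ξ)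
    (orderedEdges (S.edges t)) (fun p hp => (hlist.1 p hp).ne) (by
      intro p hp
      have he : s(p.1, p.2) ∈ S.edges t := by
        rw [← edgeSet_orderedEdges (S.edges t)]
        exact mem_edgeSet.2 ⟨p, hp, rfl⟩
      have he' : s(p.1, p.2) ∈ (S.flat (t + 1)).edges := by
        rw [hE]
        exact Finset.mem_union_right _ he
      exact ⟨(S.flat (t + 1)).endpoints _ he' _ (Sym2.mem_mk_left _ _),
        (S.flat (t + 1)).endpoints _ he' _ (Sym2.mem_mk_right _ _)⟩) m1
  have hfold : (orderedEdges (S.edges t)).foldl (projEdge D') ((S.flat t).degree, ∅) =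
      (G.degree, S.kept D' t) := by
    rw [foldl_projEdge _ _ hlist, edgeSet_orderedEdges]
    exact Prod.ext (funext fun y => (S.degree_flat_succ t y).symm) rfl
  rw [p1] at m2 p2
  simp only at m2 p2
  rw [hfold] at m2 p2
  rw [orderedEdges_length] at t2
  set k₀ := G.distToGraph D' ℓ with hk₀
  have hk₀k : k₀ ≤ k := (FinGraph.distToGraph_anti (S.flat_mono_verts (Nat.le_succ _))
    (S.degree_flat_mono (Nat.le_succ _))).trans h.dist_le
  have m3 : Memory D' ℓ (svtQueryScale 1 ε) (τ + svtThresholdScale ε * ξ 0) G.verts G.degree k f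
      (Config.wait { s₂ with item := none } 1) := m2.congr rfl rfl rfl rfl rfl
  obtain ⟨s₃, r3, m3, io3, t3⟩ := exec_bbSearch (A := A) (ω := ω) (ξ := ξ) k₀ (by
    intro j hj
    refine G.canDecrease_iff ?_
    -- The size condition in `CanDecrease` may fail for `ℓ = 0` although the distance is `0`; in
    -- that case the bound is `0` from the start.
    by_cases hℓ : ℓ = 0
    · right
      have := h.le_bound
      simp only [initialBound, hℓ, if_true] at this
      omega
    · exact Or.inl hℓ) hk₀k m3
  obtain ⟨-, p3, q3⟩ := io3
  have hq : Quiet s s₃ := by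
    have q0 : Quiet s s₂ := Quiet.trans (s' := { s with pending := (∅, ∅) })
      ⟨rfl, rfl, rfl, rfl⟩ (q1.trans q2)
    exact q0.trans (Quiet.trans ⟨rfl, rfl, rfl, rfl⟩ q3)
  obtain ⟨d3, h3, o3, b3⟩ := hq
  have hpend : s₃.pending = (S.nodes t, S.kept D' t) := by
    rw [p3]
    exact p2
  set F : Prop := ¬ ∀ r : Fin T, (r : ℕ) < (t : ℕ) + 1 →
    svtBelow τ (bbQuery D' ℓ S) (noise T ε ξ) r with hF
  have hbelow : svtBelow τ (bbQuery D' ℓ S) (noise T ε ξ) t ↔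
      ¬ τ + svtThresholdScale ε * ξ 0 ≤ svtQueryScale 1 ε * ξ s₃.draws - k₀ := by
    rw [d3, h.draws]
    simp only [svtBelow, noise, bbQuery, not_le]
    rw [← hG, ← hk₀, neg_add_eq_sub]
  have hFiff : F ↔ τ + svtThresholdScale ε * ξ 0 ≤ svtQueryScale 1 ε * ξ s₃.draws - k₀ ∨
      1 ≤ f := by
    rw [h.failed, ← not_iff_not, not_or, not_not, ← hbelow, not_not]
    constructor
    · exact fun h => ⟨h t (Nat.lt_succ_self _), fun r hr => h r (by omega)⟩
    · rintro ⟨h1, h2⟩ r hr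
      rcases Nat.lt_succ_iff_lt_or_eq.1 hr with h | h
      · exact h2 r h
      · rwa [Fin.ext h]
  obtain ⟨s₄, r4, ⟨f', m4, hf'⟩, d4, hfail, hpass⟩ := exec_bbAnswer (A := A) (ω := ω) (ξ := ξ)
    m3 hFiff
  have hlen : (t : ℕ) < (proj D' S.toList).length := by
    rw [S.proj_toList, List.length_ofFn]
    exact t.2
  have htake : (proj D' S.toList).take (t + 1) =
      (proj D' S.toList).take t ++ [(S.nodes t, S.kept D' t)] := by
    rw [List.take_add_one, S.proj_toList, List.getElem?_eq_getElem (by simp)]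
    simp
  have hout : (List.ofFn (gated τ (bbQuery D' ℓ S) (A.outputOn T (proj D' S.toList))
      (ω, noise T ε ξ))).take (t + 1) = (List.ofFn (gated τ (bbQuery D' ℓ S)
        (A.outputOn T (proj D' S.toList)) (ω, noise T ε ξ))).take t ++
      [gated τ (bbQuery D' ℓ S) (A.outputOn T (proj D' S.toList)) (ω, noise T ε ξ) t] := by
    rw [List.take_add_one, List.getElem?_eq_getElem (by simp)]
    simp
  have hforall : (∀ r ≤ t, svtBelow τ (bbQuery D' ℓ S) (noise T ε ξ) r) ↔ ¬ F := by
    rw [hF, not_not]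
    exact forall_congr' fun r => by rw [Fin.le_def, Nat.lt_succ_iff]
  have hrt := A.runtime_take_succ ω hlen
  have hsp := A.space_take_succ ω hlen
  have hhist : ¬ F → s₃.history ++ [s₃.pending] = (proj D' S.toList).take (t + 1) := by
    intro hnF
    rw [h3, hpend, htake, h.history fun hf => hnF (hFiff.2 (Or.inr hf))]
  have hVcard : G.verts.card = (S.flat t).verts.card + (S.nodes t).card := by
    rw [hG, hV, Finset.card_union_of_disjoint (S.flat_verts_disjoint t)]
  have hEcard : G.edges.card = (S.flat t).edges.card + (S.edges t).card := by
    rw [hG, hE, Finset.card_union_of_disjoint (S.flat_edges_disjoint t)]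
  -- Nodes cost `5` and edges at most `18`. Entering the end code costs `1` and the search `12`,
  -- apart from `13` for each decrease of the bound, which the last term pays for.
  have htime₃ : s₃.time ≤ A.runtime ω ((proj D' S.toList).take t) + 12
      + 20 * (G.verts.card + G.edges.card + t) + 13 * (initialBound D' ℓ - k₀) + 13 := by
    have e0 := h.time
    have e1 := h.le_bound
    have e2 : (Config.wait { s₂ with item := none } 1).time = s₂.time + 1 := rfl
    have e3 : ({ s with pending := (∅, ∅) } : Config V Y).time = s.time := rfl
    omega
  refine ⟨s₄, k₀, f', ⟨s₁, s₂, r1, r2, Run.seq r3 r4⟩, ⟨m4, le_rfl, hk₀k.trans h.le_bound, ?_,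
    hf', by rw [d4, d3, h.draws], ?_, ?_, ?_, ?_⟩⟩
  · unfold initialBound
    split_ifs with h0
    · exact Nat.zero_le _
    · exact G.le_card_add_distToGraph h0
  · rw [hout, gated]
    by_cases hFt : F
    · rw [(hfail hFt).1, if_neg fun h => hforall.1 h hFt, o3, h.out]
    · rw [(hpass hFt).1, if_pos (hforall.2 hFt), o3, h.out, hhist hFt]
      rfl
  · intro hnf
    have hFt : ¬ F := fun h => hnf (hf'.2 h)
    rw [(hpass hFt).2.1, hhist hFt]
  · rw [hsp]
    by_cases hFt : F
    · rw [(hfail hFt).2.1, b3]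
      exact h.space.trans (le_max_left _ _)
    · rw [(hpass hFt).2.2.1, b3, hhist hFt]
      exact max_le_max h.space le_rfl
  · rw [hrt, ← hG]
    by_cases hFt : F
    · have := (hfail hFt).2.2
      omega
    · have := (hpass hFt).2.2.2
      rw [hhist hFt] at this
      omega

theorem invariant_run [Infinite V] (hℓ : ℓ ≤ D') (t : ℕ) (ht : t ≤ T) :
    ∃ s k f, RunProgram A ω ξ bbProgram D' ℓ ε τ (S.toList.take t) s ∧
      Invariant A ω ξ D' ℓ ε τ S t k f s := by
  induction t with
  | zero =>
    obtain ⟨s, r, h⟩ := invariant_start (A := A) (ω := ω) (ξ := ξ) (ε := ε) (τ := τ) (S := S) hℓ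
    exact ⟨s, _, _, ⟨s, r, RunStream.nil s⟩, h⟩
  | succ t ih =>
    obtain ⟨s, k, f, ⟨s₀, r0, r⟩, h⟩ := ih (by omega)
    obtain ⟨s', k', f', r', h'⟩ := invariant_step (t := ⟨t, ht⟩) h
    refine ⟨s', k', f', ⟨s₀, r0, ?_⟩, h'⟩
    have : S.toList.take (t + 1) = S.toList.take t ++
        [(S.nodes ⟨t, ht⟩, S.edges ⟨t, ht⟩)] := by
      rw [List.take_add_one, List.getElem?_eq_getElem (by rw [S.length_toList]; exact ht),
        S.getElem_toList ⟨t, ht⟩]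
      rfl
    rw [this]
    exact r.concat r'

end Invariant

/-- The program implements the black-box transformation in the stated time and space. -/
theorem bbProgram_correct {V : Type u} [LinearOrder V] [Infinite V] {Y : Type v}
    [MeasurableSpace Y] {T D ℓ D' : ℕ} {εTest βTest β : ℝ} (hℓ : ℓ = bbSlack εTest βTest β T)
    (hD' : D' = D + ℓ) (A : StreamAlg.{u, v, w} V Y) (S : GraphStream V T) (ω : A.Coins)
    (ξ : ℕ → ℝ) (t : Fin T) :
    ∃ s : Config V Y,
      RunProgram A ω ξ bbProgram D' ℓ εTest (bbThreshold εTest βTest) (S.toList.take (t + 1)) s ∧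
      s.out = (List.ofFn (bbOutput A εTest βTest β D S
        (ω, (svtThresholdScale εTest * ξ 0,
          fun i => svtQueryScale 1 εTest * ξ (i + 1))))).take (t + 1) ∧
      s.time ≤ A.runtime ω ((proj D' S.toList).take (t + 1))
        + 50 * ((S.flat (t + 1)).verts.card + (S.flat (t + 1)).edges.card + (t + 1)) ∧
      s.space ≤ A.space ω ((proj D' S.toList).take (t + 1))
        + 50 * ((S.flat (t + 1)).verts.card + 1) := by
  obtain ⟨s, k, f, r, h⟩ := invariant_run (A := A) (ω := ω) (ξ := ξ) (ε := εTest)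
    (τ := bbThreshold εTest βTest) (S := S) (show ℓ ≤ D' by omega) (t + 1) t.2
  have hdeg : bbDegree εTest βTest β D T = D' := by rw [bbDegree, ← hℓ, hD']
  refine ⟨s, r, ?_, ?_, ?_⟩
  · rw [h.out, bbOutput_eq_gated, hdeg, ← hℓ]
    unfold bbBase
    rw [hdeg]
    rfl
  -- By `bound_le` the bound has dropped by at most the number of nodes, so the term for the
  -- decreases is linear in it.
  · have h1 := h.time
    have h2 := h.bound_le
    omega
  · have h1 := ncard_le_of_allowedCell h.mem.cells
    have h2 := h.space
    unfold Config.space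
    omega

end StreamRAM

/-! ## Choice of parameters -/

/-- With `βTest = δ / 30` this makes the test consume at most half of `δ`. -/
theorem exp_mul_le {a b : ℝ} (ha : a ≤ 1 / 2) (hb : b ≤ 1) :
    (1 + Real.exp a) * Real.exp b ≤ 15 := by
  have h1 := Real.exp_one_lt_d9
  have h2 : Real.exp a ≤ 2.72 := (Real.exp_le_exp.2 (by linarith : a ≤ 1)).trans (by linarith)
  have h3 : Real.exp b ≤ 2.72 := (Real.exp_le_exp.2 hb).trans (by linarith)
  nlinarith [Real.exp_pos a, Real.exp_pos b]

/-- `M` is the quantity inside `O(·)`. The factor `3` in `hM` allows for passing from `D + 2 * ℓ` to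
`D + ℓ` and from `2 * ℓ + 1` to `ℓ`; another factor `3` bounds `exp η`. -/
theorem privacy_loss_le {εTest βTest ε δ' η m M : ℝ} (hεT : εTest ≤ ε) (hβ : 0 ≤ βTest)
    (hε : ε ≤ 1) (hη : η ≤ 1) (hδ' : 0 ≤ δ') (hm : 0 ≤ m) (hM : δ' * m ≤ 3 * M) :
    (1 + Real.exp εTest) * Real.exp ε * βTest + δ' * Real.exp η * m ≤ 15 * βTest + 9 * M := by
  have h1 := Real.exp_one_lt_d9
  have h2 : Real.exp εTest ≤ 2.72 :=
    (Real.exp_le_exp.2 (by linarith : εTest ≤ 1)).trans (by linarith)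
  have h3 : Real.exp ε ≤ 2.72 := (Real.exp_le_exp.2 hε).trans (by linarith)
  have h4 : Real.exp η ≤ 3 := (Real.exp_le_exp.2 hη).trans (by linarith)
  have h5 : (1 + Real.exp εTest) * Real.exp ε ≤ 15 := by
    nlinarith [Real.exp_pos εTest, Real.exp_pos ε]
  have h6 : δ' * Real.exp η * m ≤ 3 * (δ' * m) := by
    have : 0 ≤ δ' * m := by positivity
    nlinarith
  nlinarith

/-- Parameters for a base algorithm to which `m` steps of group privacy are applied. -/
theorem exists_parameters {ε δ m B : ℝ} (hε : 0 < ε) (hε1 : ε ≤ 1) (hδ : 0 < δ) (hB : 0 < B)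
    (hBm : B ≤ m) (hmB : m ≤ 400 * B) :
    ∃ ε' δ' : ℝ, 0 ≤ ε' ∧ 0 ≤ δ' ∧ 1 / 4000 * (ε / B) ≤ ε' ∧ ε' ≤ 1 * (ε / B) ∧
      1 / 4000 * (δ / B) ≤ δ' ∧ δ' ≤ 1 * (δ / B) ∧ ε = ε / 2 + ε' * m ∧
      δ = (1 + Real.exp (ε / 2)) * Real.exp ε * (δ / 30) + δ' * Real.exp (ε' * m) * m := by
  have hm : 0 < m := hB.trans_le hBm
  -- `c` is the share of `δ` that the test consumes.
  set c := (1 + Real.exp (ε / 2)) * Real.exp ε / 30 with hc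
  have hc0 : 0 ≤ c := by positivity
  have hc1 : c ≤ 1 / 2 := by
    have := exp_mul_le (a := ε / 2) (b := ε) (by linarith) hε1
    rw [hc]
    linarith
  have he1 : 1 ≤ Real.exp (ε / 2) := Real.one_le_exp (by linarith)
  have he2 : Real.exp (ε / 2) ≤ 3 :=
    (Real.exp_le_exp.2 (by linarith : ε / 2 ≤ 1)).trans (by linarith [Real.exp_one_lt_d9])
  have hem : ε / (2 * m) * m = ε / 2 := by field_simp
  -- The two equations are solved exactly: `ε' * m = ε / 2`, and then `δ'` follows. As `1 - c ≥ 1 /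
  -- 2`, `exp (ε / 2) ≤ 3` and `m ≤ 400 * B`, one has `δ' ≥ δ / (2400 * B)`, within the constant `1
  -- / 4000`.
  refine ⟨ε / (2 * m), δ * (1 - c) / (Real.exp (ε / 2) * m), by positivity, ?_, ?_, ?_, ?_, ?_, ?_,
    ?_⟩
  · have : 0 ≤ 1 - c := by linarith
    positivity
  · rw [div_mul_div_comm, div_le_div_iff₀ (by positivity) (by positivity)]
    nlinarith
  · rw [one_mul, div_le_div_iff₀ (by positivity) (by positivity)]
    nlinarith
  · rw [div_mul_div_comm, div_le_div_iff₀ (by positivity) (by positivity)]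
    have h1 : Real.exp (ε / 2) * m ≤ 3 * (400 * B) := by nlinarith
    have h2 : δ * (1 / 2) ≤ δ * (1 - c) := by nlinarith
    have h3 : δ * (1 / 2) * (4000 * B) ≤ δ * (1 - c) * (4000 * B) := by gcongr
    have h4 : δ * (Real.exp (ε / 2) * m) ≤ δ * (3 * (400 * B)) := by gcongr
    nlinarith [mul_pos hδ hB]
  · rw [one_mul, div_le_div_iff₀ (by positivity) (by positivity)]
    have h1 : B ≤ Real.exp (ε / 2) * m := by nlinarith
    have h2 : δ * (1 - c) ≤ δ := by nlinarith
    calc δ * (1 - c) * B ≤ δ * B := by gcongr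
      _ ≤ δ * (Real.exp (ε / 2) * m) := by gcongr
  · rw [hem]
    ring
  · rw [hem]
    have : δ * (1 - c) / (Real.exp (ε / 2) * m) * Real.exp (ε / 2) * m = δ * (1 - c) := by
      field_simp
    rw [this, hc]
    ring

/-- From `T ≥ 2` the logarithm is at least `log 2 > 1 / 2`. It thus absorbs `log 30 ≤ 5 * log 2` and
the rounding up: `16 * 6 + 2 = 98`. -/
theorem bbSlack_bounds {ε δ β : ℝ} {T : ℕ} (hε : 0 < ε) (hε1 : ε ≤ 1) (hδ : 0 < δ) (hδ1 : δ ≤ 1)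
    (hβ : 0 < β) (hβ1 : β ≤ 1) (hT : 2 ≤ T) :
    0 < Real.log (T / (β * δ)) / ε ∧
    Real.log (T / (β * δ)) / ε ≤ bbSlack (ε / 2) (δ / 30) β T ∧
    (bbSlack (ε / 2) (δ / 30) β T : ℝ) ≤ 98 * (Real.log (T / (β * δ)) / ε) ∧
    1 ≤ 2 * (Real.log (T / (β * δ)) / ε) := by
  have hT' : (2 : ℝ) ≤ T := by exact_mod_cast hT
  set x := T / (β * δ) with hx
  have hx2 : 2 ≤ x := by
    rw [hx, le_div_iff₀ (by positivity)]
    nlinarith [mul_le_one₀ hβ1 hδ.le hδ1]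
  have hlog2 : Real.log 2 ≤ Real.log x := Real.log_le_log (by norm_num) hx2
  have h2 := Real.log_two_gt_d9
  have hlog30 : Real.log 30 ≤ 5 * Real.log 2 := by
    have : Real.log 30 ≤ Real.log (2 ^ 5) := Real.log_le_log (by norm_num) (by norm_num)
    rwa [Real.log_pow] at this
  have heq : Real.log (T / (β * (δ / 30))) = Real.log 30 + Real.log x := by
    rw [← Real.log_mul (by norm_num) (by positivity), hx]
    congr 1
    field_simp
  have hy : 8 * Real.log (T / (β * (δ / 30))) / (ε / 2) =
      16 * ((Real.log 30 + Real.log x) / ε) := by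
    rw [heq]
    field_simp
    ring
  have h30 : 0 ≤ Real.log 30 := Real.log_nonneg (by norm_num)
  have hL : 0 < Real.log x := by linarith
  have hone : 1 ≤ 2 * (Real.log x / ε) := by
    have : Real.log x ≤ Real.log x / ε := by
      rw [le_div_iff₀ hε]
      nlinarith
    linarith
  refine ⟨by positivity, ?_, ?_, hone⟩
  · refine le_trans ?_ (Nat.le_ceil _)
    rw [hy]
    have : Real.log x / ε ≤ (Real.log 30 + Real.log x) / ε := by
      gcongr
      linarith
    have : 0 < Real.log x / ε := by positivity
    linarith
  · refine (Nat.ceil_lt_add_one (by rw [hy]; positivity)).le.trans ?_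
    rw [hy]
    have : (Real.log 30 + Real.log x) / ε ≤ 6 * (Real.log x / ε) := by
      rw [← mul_div_assoc]
      gcongr
      linarith
    linarith

theorem mainTheorem2 :
    ∃ (K c₁ c₂ : ℝ) (C : ℕ) (P : StreamRAM.Program), 0 < c₁ ∧ 0 < c₂ ∧
      ∀ (V : Type u) [LinearOrder V] [Infinite V] (Y : Type v) [MeasurableSpace Y]
        (T D : ℕ) (β : ℝ), 1 ≤ T → 0 < β → β ≤ 1 →
      -- general parameters `ε_Test`, `β_Test`
      (∀ (εTest βTest : ℝ) (ℓ D' : ℕ), 0 < εTest → 0 < βTest → βTest ≤ 1 →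
        ℓ = bbSlack εTest βTest β T → D' = D + ℓ →
        -- (1) node privacy from restricted edge privacy
        (∀ ε' δ' ε δ : ℝ, 0 ≤ ε' → 0 ≤ δ' →
          ε = εTest + ε' * (D' + ℓ) →
          δ = (1 + Real.exp εTest) * Real.exp ε * βTest
            + δ' * Real.exp (ε' * (D' + ℓ)) * (D' + ℓ) →
          (∀ A : StreamAlg.{u, v, w} V Y,
            RestrictedEdgeDP (T := T) D' A.coinLaw (fun S => A.output S) ε' δ' →
            NodeDP (T := T) (bbLaw A εTest T) (fun S => bbOutput A εTest βTest β D S) ε δ) ∧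
          (ε ≤ 1 → δ ≤ K * (βTest + δ' * (D + ℓ)))) ∧
        -- (2) node privacy from restricted node privacy
        (∀ ε' δ' ε δ : ℝ, 0 ≤ ε' → 0 ≤ δ' →
          ε = εTest + ε' * (2 * ℓ + 1) →
          δ = (1 + Real.exp εTest) * Real.exp ε * βTest
            + δ' * Real.exp (ε' * (2 * ℓ + 1)) * (2 * ℓ + 1) →
          (∀ A : StreamAlg.{u, v, w} V Y,
            RestrictedNodeDP (T := T) D' A.coinLaw (fun S => A.output S) ε' δ' →
            NodeDP (T := T) (bbLaw A εTest T) (fun S => bbOutput A εTest βTest β D S) ε δ) ∧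
          (ε ≤ 1 → δ' ≤ 1 → δ ≤ K * (βTest + δ' * ℓ))) ∧
        -- (3) accuracy
        (∀ (A : StreamAlg.{u, v, w} V Y) (S : GraphStream V T) (t' : Fin T),
          (S.flat (t' + 1)).Bounded D 0 →
          ENNReal.ofReal (1 - β) ≤ bbLaw A εTest T
            {p | ∀ t ≤ t', bbOutput A εTest βTest β D S p t
              = Sum.inl (A.outputOn T (proj D' S.toList) p.1 t)}) ∧
        -- (4) time and space complexity
        (∀ (A : StreamAlg.{u, v, w} V Y) (S : GraphStream V T) (ω : A.Coins) (ξ : ℕ → ℝ)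
            (t : Fin T),
          ∃ s : StreamRAM.Config V Y,
            StreamRAM.RunProgram A ω ξ P D' ℓ εTest (bbThreshold εTest βTest)
              (S.toList.take (t + 1)) s ∧
            s.out = (List.ofFn (bbOutput A εTest βTest β D S
              (ω, (svtThresholdScale εTest * ξ 0,
                fun i => svtQueryScale 1 εTest * ξ (i + 1))))).take (t + 1) ∧
            s.time ≤ A.runtime ω ((proj D' S.toList).take (t + 1))
              + C * ((S.flat (t + 1)).verts.card + (S.flat (t + 1)).edges.card + (t + 1)) ∧
            s.space ≤ A.space ω ((proj D' S.toList).take (t + 1))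
              + C * ((S.flat (t + 1)).verts.card + 1))) ∧
      -- the choice `ε_Test = ε / 2`, `β_Test = δ / 30` for target parameters `ε`, `δ`
      (∀ (ε δ : ℝ) (ℓ D' : ℕ), 0 < ε → ε ≤ 1 → 0 < δ → δ ≤ 1 → 2 ≤ T →
        ℓ = bbSlack (ε / 2) (δ / 30) β T → D' = D + ℓ →
        -- in (1)
        (∀ B : ℝ, B = D + Real.log (T / (β * δ)) / ε →
          ∃ ε' δ' : ℝ, c₁ * (ε / B) ≤ ε' ∧ ε' ≤ c₂ * (ε / B) ∧
            c₁ * (δ / B) ≤ δ' ∧ δ' ≤ c₂ * (δ / B) ∧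
            ε = ε / 2 + ε' * (D' + ℓ) ∧
            δ = (1 + Real.exp (ε / 2)) * Real.exp ε * (δ / 30)
              + δ' * Real.exp (ε' * (D' + ℓ)) * (D' + ℓ) ∧
            ∀ A : StreamAlg.{u, v, w} V Y,
              RestrictedEdgeDP (T := T) D' A.coinLaw (fun S => A.output S) ε' δ' →
              NodeDP (T := T) (bbLaw A (ε / 2) T)
                (fun S => bbOutput A (ε / 2) (δ / 30) β D S) ε δ) ∧
        -- in (2)
        (∀ B : ℝ, B = Real.log (T / (β * δ)) / ε →
          ∃ ε' δ' : ℝ, c₁ * (ε / B) ≤ ε' ∧ ε' ≤ c₂ * (ε / B) ∧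
            c₁ * (δ / B) ≤ δ' ∧ δ' ≤ c₂ * (δ / B) ∧
            ε = ε / 2 + ε' * (2 * ℓ + 1) ∧
            δ = (1 + Real.exp (ε / 2)) * Real.exp ε * (δ / 30)
              + δ' * Real.exp (ε' * (2 * ℓ + 1)) * (2 * ℓ + 1) ∧
            ∀ A : StreamAlg.{u, v, w} V Y,
              RestrictedNodeDP (T := T) D' A.coinLaw (fun S => A.output S) ε' δ' →
              NodeDP (T := T) (bbLaw A (ε / 2) T)
                (fun S => bbOutput A (ε / 2) (δ / 30) β D S) ε δ)) := by
  -- `privacy_loss_le` gives `15 * βTest + 9 * M`. In the second case `M` contains `βTest`, so at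
  -- least `24` is needed.
  refine ⟨27, 1 / 4000, 1, 50, StreamRAM.bbProgram, by norm_num, one_pos, ?_⟩
  intro V _ _ Y _ T D β hT hβ hβ1
  refine ⟨?_, ?_⟩
  · intro εTest βTest ℓ D' hε hβT hβT1 hℓ hD'
    have hD'R : (D' : ℝ) = D + ℓ := by rw [hD']; push_cast; ring
    refine ⟨?_, ?_, ?_, ?_⟩
    · intro ε' δ' ε δ hε' hδ' hεeq hδeq
      refine ⟨fun A hA => nodeDP_of_restrictedEdgeDP A hε hβT hβT1 hβ hβ1 hT hℓ hD' hε' hδ' hεeq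
        hδeq hA, fun hε1 => ?_⟩
      have hpos : 0 ≤ ε' * ((D' : ℝ) + ℓ) := by positivity
      have h := privacy_loss_le (εTest := εTest) (βTest := βTest) (ε := ε) (δ' := δ')
        (η := ε' * (D' + ℓ)) (m := D' + ℓ) (M := δ' * (D + ℓ)) (by linarith) hβT.le hε1
        (by linarith) hδ' (by positivity)
        (by
          rw [hD'R]
          have h1 : 0 ≤ δ' * (D : ℝ) := by positivity
          have h2 : 0 ≤ δ' * (ℓ : ℝ) := by positivity
          linarith)
      have h3 : 0 ≤ δ' * ((D : ℝ) + ℓ) := by positivity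
      rw [hδeq]
      linarith
    · intro ε' δ' ε δ hε' hδ' hεeq hδeq
      refine ⟨fun A hA => nodeDP_of_restrictedNodeDP A hε hβT hβT1 hℓ hD' hε' hδ' hεeq
        hδeq hA, fun hε1 hδ1 => ?_⟩
      have hpos : 0 ≤ ε' * (2 * (ℓ : ℝ) + 1) := by positivity
      -- For `ℓ ≥ 1` the summand `1` is absorbed by `ℓ`. For `ℓ = 0` one has `βTest ≥ 1 ≥ δ'`, which
      -- is where `δ' ≤ 1` enters.
      have hM : δ' * (2 * (ℓ : ℝ) + 1) ≤ 3 * (βTest + δ' * ℓ) := by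
        by_cases h0 : ℓ = 0
        · have hb := one_le_of_bbSlack_eq_zero hε hβ hβ1 hβT hT (hℓ ▸ h0)
          rw [h0]
          push_cast
          linarith
        · have h1 : (1 : ℝ) ≤ ℓ := by exact_mod_cast Nat.one_le_iff_ne_zero.2 h0
          nlinarith
      have h := privacy_loss_le (εTest := εTest) (βTest := βTest) (ε := ε) (δ' := δ')
        (η := ε' * (2 * ℓ + 1)) (m := 2 * ℓ + 1) (M := βTest + δ' * ℓ) (by linarith) hβT.le hε1
        (by linarith) hδ' (by positivity) hM
      have h3 : 0 ≤ δ' * (ℓ : ℝ) := by positivity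
      rw [hδeq]
      linarith
    · exact fun A S t' hS => bbOutput_accuracy A hε hβT hβ hβ1 hT hℓ hD' S t' hS
    · exact fun A S ω ξ t => StreamRAM.bbProgram_correct hℓ hD' A S ω ξ t
  · intro ε δ ℓ D' hε hε1 hδ hδ1 hT2 hℓ hD'
    have hD'R : (D' : ℝ) = D + ℓ := by rw [hD']; push_cast; ring
    obtain ⟨hpos, hlow, hup, hone⟩ := bbSlack_bounds hε hε1 hδ hδ1 hβ hβ1 hT2
    rw [← hℓ] at hlow hup
    refine ⟨?_, ?_⟩
    · intro B hB
      have hD0 : (0 : ℝ) ≤ D := Nat.cast_nonneg D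
      obtain ⟨ε', δ', hε', hδ', h1, h2, h3, h4, h5, h6⟩ := exists_parameters (m := D' + ℓ) (B := B)
        hε hε1 hδ (by linarith) (by rw [hD'R]; linarith) (by rw [hD'R]; linarith)
      exact ⟨ε', δ', h1, h2, h3, h4, h5, h6, fun A hA => nodeDP_of_restrictedEdgeDP A
        (half_pos hε) (by positivity) (by linarith) hβ hβ1 hT hℓ hD' hε' hδ' h5 h6 hA⟩
    · intro B hB
      obtain ⟨ε', δ', hε', hδ', h1, h2, h3, h4, h5, h6⟩ := exists_parameters (m := 2 * ℓ + 1)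
        (B := B) hε hε1 hδ (by linarith) (by linarith) (by linarith)
      exact ⟨ε', δ', h1, h2, h3, h4, h5, h6, fun A hA => nodeDP_of_restrictedNodeDP A
        (half_pos hε) (by positivity) (by linarith) hℓ hD' hε' hδ' h5 h6 hA⟩
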